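/- **Definitions.** Let $\Bbbk$ be a field. A *pipe dream* of size $n$ is a filling, by crosses and elbows, of the triangle of cells $(i,j)$ (row $i$ numbered from top to bottom, column $j$ from left to right) with $i,j\ge 0$, $i+j\le n$, whose cells on the antidiagonal $i+j=n$ are elbows. Pipes enter at the left of the rows $0,\dots,n$; in a cross a pipe goes straight on, and in an elbow the pipe coming from the left turns up and the pipe coming from below turns right, so that every pipe exits at the top. The pipe entering in row $i$ is labelled $i$. We consider only *reduced* pipe dreams (two pipes cross at most once) with an elbow in the cell $(0,0)$; $\Pi_n$ is the set of those of size $n$ and $\Pi=\bigsqcup_{n\ge 0}\Pi_n$. For $P\in\Pi_n$, $\omega_P\in\mathfrak S_n$ is the permutation such that the pipe exiting in column $j\in\{1,\dots,n\}$ has label $\omega_P(j)$. A gap $\gamma\in\{0,\dots,n\}$ is a *global descent* of $\omega\in\mathfrak S_n$ if $\omega(\{1,\dots,\gamma\})=\{n-\gamma+1,\dots,n\}$. *Coproduct.* For $P\in\Pi_n$ and $0\le k\le n$, the *horizontal packing* $L_k(P)$ is obtained by removing the pipes entering in the rows $>k$ and contracting the horizontal steps of the other pipes that are crossed vertically by a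 removed pipe; equivalently, $L_k(P)$ is the filling of size $k$ whose crosses are the crosses of $P$ between two pipes with labels $\le k$, each moved to the left in its row by the number of removed pipes passing to its left. The *vertical packing* $V_k(P)$ is defined symmetrically with respect to the main diagonal: it removes the pipes exiting in the columns $>k$ and contracts the vertical steps that they cross horizontally. For $P\in\Pi_n$ put $$\Delta(P)=\sum_{\gamma} V_\gamma(P)\otimes L_{n-\gamma}(P),$$ where $\gamma$ ranges over the global descents of $\omega_P$ (the pair $(V_\gamma(P),L_{n-\gamma}(P))$ *untangles* $P$ at $\gamma$). *Product.* For $P\in\Pi_m$, $Q\in\Pi_n$ and a global descent $\gamma$ of $\omega_P$, the *insertion* $P\blacktriangleright_\gamma Q$ is obtained from $P$ by inserting $n$ columns after column $\gamma$ and $n$ rows after row $m-\gamma$, filling with $Q$ the triangle of cells in the rows $m-\gamma,\dots,m-\gamma+n$ and columns $\gamma,\dots,\gamma+n$, and filling with crosses the remaining cells in the new rows and in the new columns. A *$P/Q$-shuffle* is a word $s$ with $m$ letters $p$ and $n$ letters $q$ such that for each maximal block of letters $p$ the number of letters $q$ preceding it is a global descent of $\omega_Q$, and for each maximal block of letters $q$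 the number of letters $p$ preceding it is a global descent of $\omega_P$. The *tangled insertion* $P\star_s Q$ is obtained by untangling $Q$ successively at all gaps marked by the $p$-blocks of $s$ into pieces $Q_1,\dots,Q_\ell$, one for each $q$-block of $s$ from left to right, and inserting these pieces successively in $P$ at the positions of the corresponding $q$-blocks. Put $$P\star Q=\sum_{s} P\star_s Q,$$ where $s$ ranges over all $P/Q$-shuffles. Let $\Bbbk\Pi$ be the $\Bbbk$-vector space with basis $\Pi$, graded by the spans $\Bbbk\Pi_n$ of the sets $\Pi_n$, and extend $\star$ bilinearly and $\Delta$ linearly. **Proposition.** These operations are well defined: $L_k(P),V_k(P)\in\Pi_k$ for all $P\in\Pi_n$ and $0\le k\le n$, $P\blacktriangleright_\gamma Q\in\Pi_{m+n}$ for all $P\in\Pi_m$, $Q\in\Pi_n$ and every global descent $\gamma$ of $\omega_P$, and $P\star_s Q\in\Pi_{m+n}$ for every $P/Q$-shuffle $s$. The product $\star$ and the coproduct $\Delta$ endow $\Bbbk\Pi$ with the structure of a graded connected Hopf algebra over $\Bbbk$. That is, $\star$ is associative with unit the pipe dream of size $0$; $\Delta$ is coassociative with counit $\varepsilon$ given on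 $P\in\Pi$ by $\varepsilon(P)=1$ if $P\in\Pi_0$ and $\varepsilon(P)=0$ otherwise; $\Delta$ and $\varepsilon$ are morphisms of algebras, so that in particular $\Delta(P\star Q)=\Delta(P)\star\Delta(Q)$ with the componentwise product on the right-hand side; there is an antipode; product, coproduct, unit, counit and antipode respect the grading; and $\Bbbk\Pi_0$ is one-dimensional. -/

import Mathlib

open scoped TensorProduct

universe u

/-- A filling of the triangle of cells `(i, j)` (row `i`, column `j`, both indexed from `0`) with
`i + j ≤ size` by crosses and elbows; `cross` is the set of cells that hold a cross, all the other
cells hold an elbow. -/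
@[ext]
structure Filling where
  size : ℕ
  cross : Finset (ℕ × ℕ)
deriving DecidableEq

namespace Filling

/- A pipe enters every row `i` from the left at column `0`, and bears the label `i`. A cross lets a
pipe go straight ahead (left to right or bottom to top). An elbow turns the pipe that comes from the
left upwards and turns the pipe that comes from below to the right. -/
mutual

/-- The label of the pipe entering the cell `(i, j)` from the left. -/
def west (F : Filling) : ℕ → ℕ → ℕ
  | i, 0 => i
  | i, j + 1 => if (i, j) ∈ F.cross then F.west i j else F.south i j
termination_by i j => (j, F.size - (i + j), 0)

/-- The label of the pipe entering the cell `(i, j)` from below. No pipe enters a cell of the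
antidiagonal `i + j = size` from below, and there the value is a dummy that exceeds `size`. -/
def south (F : Filling) : ℕ → ℕ → ℕ
  | i, j =>
    if i + j < F.size then
      if (i + 1, j) ∈ F.cross then F.south (i + 1) j else F.west (i + 1) j
    else i + j + 1
termination_by i j => (j, F.size - (i + j), 1)

end

/-- The label of the pipe that exits at the top of column `j`: for `1 ≤ j ≤ size` this is the value
at `j` of the permutation `ω` of the filling. -/
def perm (F : Filling) (j : ℕ) : ℕ :=
  if (0, j) ∈ F.cross then F.south 0 j else F.west 0 j

/-- Reduced pipe dreams with an elbow in the top left corner: every cell of the antidiagonal is an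
elbow (so that every pipe exits at the top), the top left cell is an elbow, and two pipes
cross in at most one cell. -/
structure IsPipeDream (F : Filling) : Prop where
  triangular : ∀ c ∈ F.cross, c.1 + c.2 < F.size
  corner : (0, 0) ∉ F.cross
  reduced : ∀ c ∈ F.cross, ∀ d ∈ F.cross,
    s(F.west c.1 c.2, F.south c.1 c.2) = s(F.west d.1 d.2, F.south d.1 d.2) → c = d

/-- The gap `γ ∈ {0, …, n}` is a global descent of `ω`: `ω([γ]) = [n] \ [n - γ]`. -/
def IsGlobalDescent (F : Filling) (γ : ℕ) : Prop :=
  γ ≤ F.size ∧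
    (Finset.Icc 1 γ).image F.perm = Finset.Icc 1 F.size \ Finset.Icc 1 (F.size - γ)

instance (F : Filling) (γ : ℕ) : Decidable (F.IsGlobalDescent γ) :=
  inferInstanceAs (Decidable (_ ∧ _))

/-- Reflection across the main diagonal, exchanging rows and columns. -/
def transpose (F : Filling) : Filling where
  size := F.size
  cross := F.cross.image Prod.swap

/-- Horizontal packing at `k`. All pipes entering in the rows `> k` are removed, and the horizontal
steps of the other pipes that they cross vertically are contracted. So the crosses of the result are
those between two remaining pipes, each moved to the left in its row by the number of removed
pipes that pass to its left. -/
def hpack (F : Filling) (k : ℕ) : Filling where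
  size := k
  cross := (F.cross.filter fun c => F.west c.1 c.2 ≤ k ∧ F.south c.1 c.2 ≤ k).image fun c =>
    (c.1, c.2 - ((Finset.range c.2).filter fun j => k < F.south c.1 j).card)

/-- Vertical packing at `k`, symmetric to the horizontal one: the pipes exiting in the columns `> k`
are removed, and the vertical steps that they cross horizontally are contracted. -/
def vpack (F : Filling) (k : ℕ) : Filling :=
  (F.transpose.hpack k).transpose

/-- The insertion of `G` (of size `n`) at the gap `γ` in `F` (of size `m`): `n` columns are inserted
after column `γ` of `F` and `n` rows after row `m - γ`, the triangle of cells in the rows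
`m - γ, …, m - γ + n` and columns `γ, …, γ + n` is filled with `G`, and the remaining cells
in the new columns and in the new rows are filled with crosses. -/
def insertAt (F : Filling) (γ : ℕ) (G : Filling) : Filling where
  size := F.size + G.size
  cross :=
    (F.cross.image fun c =>
        (if c.1 ≤ F.size - γ then c.1 else c.1 + G.size,
          if c.2 ≤ γ then c.2 else c.2 + G.size)) ∪
      (G.cross.image fun c => (F.size - γ + c.1, γ + c.2)) ∪
      Finset.range (F.size - γ) ×ˢ Finset.Icc (γ + 1) (γ + G.size) ∪
      Finset.Icc (F.size - γ + 1) (F.size - γ + G.size) ×ˢ Finset.range γ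

end Filling

/-- The two letters of shuffle words. -/
inductive Letter
  | p
  | q
deriving DecidableEq

namespace Filling

/-- The words `s` with `m` letters `p` and `n` letters `q`, where `m` and `n` are the sizes of `F`
and `G`, such that each `p`-block occurs at a global descent of `G` (the gap of `G` marked by a
`p`-block is the number of letters `q` before it) and each `q`-block occurs at a global descent
of `F`. -/
def shuffles (F G : Filling) : Finset (List Letter) :=
  (List.replicate F.size Letter.p ++ List.replicate G.size Letter.q).permutations.toFinset.filter
    fun s => ∀ i < s.length,
      (s[i]? = some Letter.p → G.IsGlobalDescent ((s.take i).count Letter.q)) ∧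
      (s[i]? = some Letter.q → F.IsGlobalDescent ((s.take i).count Letter.p))

/-- Auxiliary to `tangle`: the arguments are the list of the blocks of the word still to be read,
the number `pos` of letters already read, the pipe dream built so far and the part of `G`
still to be inserted. Reading a `q`-block of length `l` untangles the remaining part of `G` at its
gap `l`, and inserts the piece of size `l` at the position of the block. -/
def tangleAux : List (List Letter) → ℕ → Filling → Filling → Filling
  | [], _, R, _ => R
  | b :: bs, pos, R, G =>
    if b.head? = some Letter.q then
      tangleAux bs (pos + b.length) (R.insertAt pos (G.vpack b.length))
        (G.hpack (G.size - b.length))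
    else tangleAux bs (pos + b.length) R G

/-- `F ⋆ₛ G`: untangle `G` at the gaps marked by the `p`-blocks of `s`, and insert the resulting
pieces successively in `F` at the positions of the `q`-blocks of `s`. -/
def tangle (s : List Letter) (F G : Filling) : Filling :=
  tangleAux (s.splitBy fun a b => a = b) 0 F G

end Filling

/-- The set of all reduced pipe dreams with an elbow in the top left corner. -/
abbrev PipeDream : Type := {F : Filling // F.IsPipeDream}

/-- The pipe dream of size `0`, which consists of a single elbow. -/
def PipeDream.elbow : PipeDream :=
  ⟨⟨0, ∅⟩, ⟨by simp, by simp, by simp⟩⟩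

section HP

variable (k : Type u) [Field k]

/-- The `k`-vector space with basis the set of pipe dreams. -/
abbrev HP : Type u := PipeDream →₀ k

namespace HP

open Classical in
/-- The basis vector of a filling that is a pipe dream (and `0` for other fillings). -/
noncomputable def of (F : Filling) : HP k :=
  if h : F.IsPipeDream then Finsupp.single ⟨F, h⟩ 1 else 0

/-- The product `P ⋆ Q = ∑ₛ P ⋆ₛ Q` over the `P/Q`-shuffles `s`, extended bilinearly. -/
noncomputable def product : HP k →ₗ[k] HP k →ₗ[k] HP k :=
  Finsupp.linearCombination k fun P : PipeDream =>
    Finsupp.linearCombination k fun Q : PipeDream =>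
      ∑ s ∈ P.1.shuffles Q.1, of k (Filling.tangle s P.1 Q.1)

/-- The coproduct `Δ P = ∑_γ vpack_γ P ⊗ hpack_{n - γ} P` over the global descents `γ` of `ω_P`,
extended linearly. -/
noncomputable def coproduct : HP k →ₗ[k] HP k ⊗[k] HP k :=
  Finsupp.linearCombination k fun P : PipeDream =>
    ∑ γ ∈ (Finset.range (P.1.size + 1)).filter P.1.IsGlobalDescent,
      of k (P.1.vpack γ) ⊗ₜ[k] of k (P.1.hpack (P.1.size - γ))

/-- The span of the pipe dreams of size `n`. -/
noncomputable def degree (n : ℕ) : Submodule k (HP k) :=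
  Submodule.span k {x | ∃ P : PipeDream, P.1.size = n ∧ x = Finsupp.single P 1}

end HP

/-- A Hopf algebra `A` over `k` is graded and connected with respect to the family `𝒜` of
subspaces. -/
structure IsGradedConnectedHopf (A : Type u) [Ring A] [HopfAlgebra k A]
    (𝒜 : ℕ → Submodule k A) : Prop where
  isInternal : DirectSum.IsInternal 𝒜
  gradedMonoid : SetLike.GradedMonoid 𝒜
  comul_mem : ∀ n, ∀ x ∈ 𝒜 n, Coalgebra.comul (R := k) x ∈
    ⨆ (i : ℕ) (j : ℕ) (_ : i + j = n),
      LinearMap.range (TensorProduct.map (𝒜 i).subtype (𝒜 j).subtype)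
  counit_eq_zero : ∀ n ≠ 0, ∀ x ∈ 𝒜 n, Coalgebra.counit (R := k) x = 0
  antipode_mem : ∀ n, ∀ x ∈ 𝒜 n, HopfAlgebra.antipode k x ∈ 𝒜 n
  connected : Module.finrank k (𝒜 0) = 1

end HP

/-!
The proof rests on a description of pipe dreams by labels. The two pipes that enter a cell are those
that leave it (`Filling.cell_flux`), so that labels can be counted row by row. It follows that a
filling is reduced exactly if in every cross the horizontal pipe has the smaller label
(`Filling.isPipeDream_iff`), a condition on single cells, and that a pipe dream is determined by its
size and its labelled crosses, the triples of a row, a horizontal label and a vertical label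
(`Filling.IsPipeDream.ext_crossings`). The operations become transparent on labelled crosses: the
horizontal packing at `k` selects those with vertical label `≤ k`
(`Filling.IsPipeDream.mem_crossings_hpack`), and an insertion has four explicit families of them
(`Filling.mem_crossings_insertAt`). The vertical packing is the mirror image of the horizontal one,
and the two commute at global descents (`Filling.IsGlobalDescent.hpack_vpack_comm`), which is
coassociativity. The packings of an insertion are insertions of packings, and insertions satisfy the
axioms of a partial composition (`Filling.insertAt_insertAt_nested`,
`Filling.insertAt_insertAt_comm`).

Tangled insertion is rewritten as a recursion `Filling.weave` along the letters of the word. Cutting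
the word `s` of a tangled insertion into `s = u v` cuts the pipe dream `P ⋆ₛ Q` into the tangled
insertions along `u` and `v` of the corresponding packings of `P` and `Q`, and all global descents
of `P ⋆ₛ Q` arise in this way (`Filling.Weaving.cut`). As the pairs of shuffles of the packings
are the cut shuffles, this says that `Δ` is multiplicative (`Filling.sum_packings_tangle`). For the
associativity of the product, both `(P ⋆ Q) ⋆ R` and `P ⋆ (Q ⋆ R)` are sums over the shuffles of
three words, and the summands agree (`Filling.weave_weave`).

The antipode is obtained as for every connected graded bialgebra: the equation for a left
convolution inverse of the identity can be solved by recursion on the size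
(`PipeDreamAlgebra.leftInv`). The left inverse found in this way has a left inverse for the same
reason, and is therefore two-sided.
-/

namespace Filling

variable {F G P Q R : Filling}

/-! ### Pipes through the cells of a filling -/

/-- The label of the pipe leaving the cell `(i, j)` at its top. -/
def north (F : Filling) (i j : ℕ) : ℕ :=
  if (i, j) ∈ F.cross then F.south i j else F.west i j

/-- All crosses lie strictly above the antidiagonal. -/
def Triangular (F : Filling) : Prop := ∀ i j, (i, j) ∈ F.cross → i + j < F.size

/-- In every cross the pipe with the smaller label runs horizontally. For triangular fillings this
is equivalent to being reduced. -/
def Ascending (F : Filling) : Prop := ∀ i j, (i, j) ∈ F.cross → F.west i j < F.south i j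

lemma IsPipeDream.triangular' (hF : F.IsPipeDream) : F.Triangular :=
  fun i j h => hF.triangular (i, j) h

@[simp] lemma west_zero (F : Filling) (i : ℕ) : F.west i 0 = i := by rw [west]

lemma west_succ (F : Filling) (i j : ℕ) :
    F.west i (j + 1) = if (i, j) ∈ F.cross then F.west i j else F.south i j := by rw [west]

lemma south_of_lt {i j : ℕ} (h : i + j < F.size) : F.south i j = F.north (i + 1) j := by
  rw [south, if_pos h, north]

lemma south_of_le {i j : ℕ} (h : F.size ≤ i + j) : F.south i j = i + j + 1 := by
  rw [south, if_neg (by omega)]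

/-- The permutation lists the pipes leaving the top row. -/
lemma perm_eq_north (F : Filling) (j : ℕ) : F.perm j = F.north 0 j := rfl

lemma north_of_cross {i j : ℕ} (h : (i, j) ∈ F.cross) : F.north i j = F.south i j := if_pos h

lemma north_of_elbow {i j : ℕ} (h : (i, j) ∉ F.cross) : F.north i j = F.west i j := if_neg h

lemma west_succ_of_cross {i j : ℕ} (h : (i, j) ∈ F.cross) : F.west i (j + 1) = F.west i j := by
  rw [west_succ, if_pos h]

lemma west_succ_of_elbow {i j : ℕ} (h : (i, j) ∉ F.cross) : F.west i (j + 1) = F.south i j := by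
  rw [west_succ, if_neg h]

lemma Triangular.north_diag (hF : F.Triangular) {i j : ℕ} (h : i + j = F.size) :
    F.north i j = F.west i j :=
  north_of_elbow fun hc => by have := hF i j hc; omega

/-- The two pipes entering a cell are the two pipes leaving it. -/
lemma cell_flux (f : ℕ → ℕ) (F : Filling) (i j : ℕ) :
    f (F.north i j) + f (F.west i (j + 1)) = f (F.west i j) + f (F.south i j) := by
  rw [north, west_succ]
  split_ifs <;> omega

/-- The pipes that enter the first `j` cells of a row from below or from the left are those that
leave them; here they are counted with weights. -/
lemma row_flux (f : ℕ → ℕ) (F : Filling) (i j : ℕ) :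
    ∑ x ∈ Finset.range j, f (F.north i x) + f (F.west i j) =
      f i + ∑ x ∈ Finset.range j, f (F.south i x) := by
  induction j with
  | zero => simp
  | succ j ih =>
    rw [Finset.sum_range_succ, Finset.sum_range_succ]
    have := cell_flux f F i j
    omega

/-- The pipes leaving the row `i` at its top are those with the labels `i, …, size`. -/
lemma Triangular.north_row_sum (hF : F.Triangular) (f : ℕ → ℕ) {i d : ℕ} (h : i + d = F.size) :
    ∑ x ∈ Finset.range (d + 1), f (F.north i x) = ∑ x ∈ Finset.range (d + 1), f (i + x) := by
  induction d generalizing i with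
  | zero => simp [hF.north_diag h]
  | succ d ih =>
    rw [Finset.sum_range_succ, hF.north_diag h, row_flux,
      Finset.sum_range_succ' (fun x => f (i + x)), add_zero, add_comm]
    congr 1
    rw [Finset.sum_congr rfl fun x hx => by
      rw [south_of_lt (by have := Finset.mem_range.1 hx; omega)], ih (by omega)]
    exact Finset.sum_congr rfl fun x _ => by congr 1; omega

/-- At every moment of the scan of row `i` from left to right, the pipes in sight are those with the
labels `i, …, size`, each exactly once. -/
lemma Triangular.front_sum (hF : F.Triangular) (f : ℕ → ℕ) {i j e : ℕ} (h : i + j + e = F.size) :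
    ∑ x ∈ Finset.range j, f (F.north i x) + f (F.west i j) +
      ∑ x ∈ Finset.range e, f (F.south i (j + x)) =
    ∑ x ∈ Finset.range (j + e + 1), f (i + x) := by
  have h1 := row_flux f F i (j + e)
  have h2 := row_flux f F i j
  have h3 := hF.north_row_sum f (i := i) (d := j + e) (by omega)
  rw [Finset.sum_range_succ, hF.north_diag (by omega)] at h3
  rw [Finset.sum_range_add (fun x => f (F.south i x))] at h1
  omega

lemma Triangular.le_west_le (hF : F.Triangular) {i j : ℕ} (h : i + j ≤ F.size) :
    i ≤ F.west i j ∧ F.west i j ≤ F.size := by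
  have := hF.front_sum (fun l => if i ≤ l ∧ l ≤ F.size then 0 else 1)
    (i := i) (j := j) (e := F.size - i - j) (by omega)
  rw [Finset.sum_eq_zero (s := Finset.range (j + (F.size - i - j) + 1))] at this
  · by_contra hc
    simp only [if_neg hc] at this
    omega
  · intro x hx
    have := Finset.mem_range.1 hx
    rw [if_pos (by omega)]

lemma Triangular.le_north_le (hF : F.Triangular) {i j : ℕ} (h : i + j ≤ F.size) :
    i ≤ F.north i j ∧ F.north i j ≤ F.size := by
  have := hF.north_row_sum (fun l => if i ≤ l ∧ l ≤ F.size then 0 else 1)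
    (i := i) (d := F.size - i) (by omega)
  rw [Finset.sum_eq_zero (s := Finset.range _) (f := fun x => if i ≤ i + x ∧ _ then 0 else 1)
    (fun x hx => by have := Finset.mem_range.1 hx; rw [if_pos (by omega)]),
    Finset.sum_eq_zero_iff] at this
  have := this j (Finset.mem_range.2 (by omega))
  by_contra hc
  simp [hc] at this

lemma Triangular.lt_south_le (hF : F.Triangular) {i j : ℕ} (h : i + j < F.size) :
    i < F.south i j ∧ F.south i j ≤ F.size := by
  rw [south_of_lt h]
  have := hF.le_north_le (i := i + 1) (j := j) (by omega)
  omega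

lemma Triangular.lt_south (hF : F.Triangular) {i j : ℕ} : i < F.south i j := by
  rcases lt_or_ge (i + j) F.size with h | h
  · exact (hF.lt_south_le h).1
  · rw [south_of_le h]; omega

lemma lt_of_south_le {i j : ℕ} (h : F.south i j ≤ F.size) :
    i + j < F.size := by
  by_contra hc
  rw [south_of_le (by omega)] at h
  omega

/-- At every moment of the scan of a row, a label occurs at most once among the pipes in sight. -/
lemma Triangular.front_le_one (hF : F.Triangular) (l : ℕ) {i j e : ℕ} (h : i + j + e = F.size) :
    ∑ x ∈ Finset.range j, (if F.north i x = l then 1 else 0) + (if F.west i j = l then 1 else 0) +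
      ∑ x ∈ Finset.range e, (if F.south i (j + x) = l then 1 else 0) ≤ 1 := by
  rw [hF.front_sum (fun y => if y = l then 1 else 0) h, Finset.sum_ite, Finset.sum_const_zero,
    add_zero, Finset.sum_const, smul_eq_mul, mul_one, Finset.card_le_one]
  intro a ha b hb
  simp only [Finset.mem_filter] at ha hb
  omega

lemma Triangular.west_ne_south (hF : F.Triangular) {i j j' : ℕ} (hj : j ≤ j')
    (h : i + j' < F.size) : F.west i j ≠ F.south i j' := by
  intro he
  have h1 := hF.front_le_one (F.west i j) (i := i) (j := j) (e := F.size - i - j) (by omega)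
  have h2 := Finset.single_le_sum (f := fun x => if F.south i (j + x) = F.west i j then 1 else 0)
    (fun _ _ => Nat.zero_le _) (Finset.mem_range.2 (show j' - j < F.size - i - j by omega))
  simp only [show j + (j' - j) = j' by omega, ← he, if_true] at h1 h2
  omega

lemma Triangular.west_ne_north (hF : F.Triangular) {i j j' : ℕ} (hj : j' < j)
    (h : i + j ≤ F.size) : F.west i j ≠ F.north i j' := by
  intro he
  have h1 := hF.front_le_one (F.west i j) (i := i) (j := j) (e := F.size - i - j) (by omega)
  have h2 := Finset.single_le_sum (f := fun x => if F.north i x = F.west i j then 1 else 0)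
    (fun _ _ => Nat.zero_le _) (Finset.mem_range.2 hj)
  simp only [← he, if_true] at h1 h2
  omega

lemma Triangular.north_ne_south (hF : F.Triangular) {i j j' : ℕ} (hj : j' < j)
    (h : i + j < F.size) : F.north i j' ≠ F.south i j := by
  intro he
  have h1 := hF.front_le_one (F.north i j') (i := i) (j := j) (e := F.size - i - j) (by omega)
  have h2 := Finset.single_le_sum (f := fun x => if F.south i (j + x) = F.north i j' then 1 else 0)
    (fun _ _ => Nat.zero_le _) (Finset.mem_range.2 (show 0 < F.size - i - j by omega))
  have h3 := Finset.single_le_sum (f := fun x => if F.north i x = F.north i j' then 1 else 0)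
    (fun _ _ => Nat.zero_le _) (Finset.mem_range.2 hj)
  simp only [add_zero, ← he, if_true] at h1 h2 h3
  omega

lemma Triangular.north_inj (hF : F.Triangular) {i x y : ℕ} (hx : i + x ≤ F.size)
    (hy : i + y ≤ F.size) (h : F.north i x = F.north i y) : x = y := by
  wlog hxy : x < y generalizing x y
  · rcases lt_trichotomy x y with h1 | h1 | h1
    · exact absurd h1 hxy
    · exact h1
    · exact (this hy hx h.symm h1).symm
  exfalso
  by_cases hc : (i, y) ∈ F.cross
  · rw [north_of_cross hc] at h
    exact hF.north_ne_south hxy (hF _ _ hc) h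
  · rw [north_of_elbow hc] at h
    exact hF.west_ne_north hxy hy h.symm

lemma Triangular.south_inj (hF : F.Triangular) {i x y : ℕ} (hx : i + x < F.size)
    (hy : i + y < F.size) (h : F.south i x = F.south i y) : x = y := by
  rw [south_of_lt hx, south_of_lt hy] at h
  exact hF.north_inj (by omega) (by omega) h

lemma Triangular.exists_north (hF : F.Triangular) {i l : ℕ} (hi : i ≤ l) (hl : l ≤ F.size) :
    ∃ j, i + j ≤ F.size ∧ F.north i j = l := by
  by_contra! hc
  have := hF.north_row_sum (fun y => if y = l then 1 else 0) (i := i) (d := F.size - i) (by omega)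
  rw [Finset.sum_eq_zero (fun x hx => by
    rw [if_neg (hc x (by have := Finset.mem_range.1 hx; omega))])] at this
  have h2 := Finset.single_le_sum (f := fun x => if i + x = l then 1 else 0)
    (fun _ _ => Nat.zero_le _) (Finset.mem_range.2 (show l - i < F.size - i + 1 by omega))
  simp only [show i + (l - i) = l by omega, if_true] at h2
  omega

lemma Triangular.exists_south (hF : F.Triangular) {i l : ℕ} (hi : i < l) (hl : l ≤ F.size) :
    ∃ j, i + j < F.size ∧ F.south i j = l := by
  obtain ⟨j, hj, h⟩ := hF.exists_north (show i + 1 ≤ l from hi) hl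
  exact ⟨j, by omega, by rw [south_of_lt (by omega), h]⟩

/-! ### Reduced fillings -/

/-- If the pipe `F.south i x` is to the left of `F.south i y` below row `i`, then `F.south i y`
cannot cross it horizontally in row `i`. -/
lemma Triangular.not_cross_of_lt (hF : F.Triangular) {i x y : ℕ} (hxy : x < y)
    (hy : i + y < F.size) {j : ℕ} (hc : (i, j) ∈ F.cross)
    (hw : F.west i j = F.south i y) (hs : F.south i j = F.south i x) : False := by
  have hj := hF.south_inj (hF _ _ hc) (by omega) hs
  subst hj
  exact hF.west_ne_south hxy.le hy hw

/-- Two pipes that do not cross in row `i` are in the same order above and below it. -/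
lemma Triangular.order_north (hF : F.Triangular) {i x y : ℕ} (hxy : x < y)
    (hy : i + y < F.size)
    (hn : ∀ j, (i, j) ∈ F.cross → F.west i j = F.south i x → F.south i j = F.south i y → False) :
    ∃ x' y', x' < y' ∧ i + y' ≤ F.size ∧ F.north i x' = F.south i x ∧
      F.north i y' = F.south i y := by
  obtain ⟨y', hy', hn'⟩ := hF.exists_north (hF.lt_south_le hy).1.le (hF.lt_south_le hy).2
  have hsx := hF.lt_south_le (show i + x < F.size by omega)
  obtain ⟨x', hx', hm'⟩ := hF.exists_north hsx.1.le hsx.2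
  refine ⟨x', y', ?_, hy', hm', hn'⟩
  have hyy : y ≤ y' := by
    by_contra hlt
    exact hF.north_ne_south (j' := y') (j := y) (by omega) hy hn'
  have hxy' : x' ≤ y := by
    by_contra hlt
    have hw : F.west i y = F.south i x := by
      by_contra hne
      have h1 := hF.front_sum (fun l => if l = F.south i x then 1 else 0)
        (i := i) (j := y) (e := F.size - i - y) (by omega)
      rw [Finset.sum_eq_zero (s := Finset.range y), if_neg hne,
        Finset.sum_eq_zero (s := Finset.range (F.size - i - y))] at h1
      · have h2 := Finset.single_le_sum (f := fun z => if i + z = F.south i x then 1 else 0)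
          (fun _ _ => Nat.zero_le _)
          (Finset.mem_range.2 (show F.south i x - i < y + (F.size - i - y) + 1 by omega))
        simp only [show i + (F.south i x - i) = F.south i x by omega, if_true] at h2
        omega
      · intro z hz
        have := Finset.mem_range.1 hz
        rw [if_neg]
        intro h
        have := hF.south_inj (by omega) (by omega) h
        omega
      · intro z hz
        have := Finset.mem_range.1 hz
        rw [if_neg]
        intro h
        have := hF.north_inj (by omega) (by omega) (h.trans hm'.symm)
        omega
    by_cases hc : (i, y) ∈ F.cross
    · exact hn y hc hw rfl
    · have h1 := north_of_elbow hc
      rw [hw] at h1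
      have := hF.north_inj (by omega) hx' (h1.trans hm'.symm)
      omega
  rcases hxy'.lt_or_eq with h | h
  · omega
  · rcases hyy.lt_or_eq with h' | h'
    · omega
    · subst h h'
      have := hF.south_inj (by omega) hy (hm'.symm.trans hn')
      omega

/-- The order of two pipes that never cross in the rows `r, …, i` persists from row `i` to
row `r`. -/
lemma Triangular.order_persists (hF : F.Triangular) {a b i r : ℕ} (hri : r ≤ i)
    (hab : ∃ x y, x < y ∧ i + y ≤ F.size ∧ F.north i x = a ∧ F.north i y = b)
    (hn : ∀ r' j, r ≤ r' → r' < i → (r', j) ∈ F.cross → F.west r' j = a →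
      F.south r' j = b → False) :
    ∃ x y, x < y ∧ r + y ≤ F.size ∧ F.north r x = a ∧ F.north r y = b := by
  induction i, hri using Nat.le_induction with
  | base => exact hab
  | succ i hri ih =>
    obtain ⟨x, y, hxy, hy, ha, hb⟩ := hab
    refine ih ?_ fun r' j h1 h2 => hn r' j h1 (by omega)
    rw [← south_of_lt (by omega)] at ha hb
    subst ha hb
    exact hF.order_north hxy (by omega) fun j => hn i j hri (by omega)

/-- Once two pipes have crossed with the smaller label running horizontally, the larger label
stays to the left of the smaller one as long as they do not cross again; from there it can
meet the smaller one again only by running horizontally, which is excluded. -/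
lemma Triangular.reduced_of_ascending (hF : F.Triangular) (hA : F.Ascending) :
    ∀ c ∈ F.cross, ∀ d ∈ F.cross,
      s(F.west c.1 c.2, F.south c.1 c.2) = s(F.west d.1 d.2, F.south d.1 d.2) → c = d := by
  have key : ∀ i j r j', (i, j) ∈ F.cross → (r, j') ∈ F.cross → r < i →
      F.west i j = F.west r j' → F.south i j = F.south r j' → False := by
    intro i j r j' hc hd hri hw hs
    have hlt := hF _ _ hc
    -- after its cross the larger label is to the left of the smaller one
    have h0 : ∃ x y, x < y ∧ i + y ≤ F.size ∧ F.north i x = F.south i j ∧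
        F.north i y = F.west i j := by
      obtain ⟨y, hy, hyw⟩ := hF.exists_north (hF.le_west_le (by omega)).1
        (hF.le_west_le (i := i) (j := j) (by omega)).2
      refine ⟨j, y, ?_, hy, north_of_cross hc, hyw⟩
      by_contra hle
      rcases (not_lt.1 hle).lt_or_eq with h | h
      · exact hF.west_ne_north h hlt.le hyw.symm
      · subst h
        rw [north_of_cross hc] at hyw
        exact hF.west_ne_south le_rfl hlt hyw.symm
    obtain ⟨x, y, hxy, hy, ha, hb⟩ := hF.order_persists (r := r + 1) hri h0
      fun r' j'' _ _ hc' h1 h2 => by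
        have := hA _ _ hc'
        have := hA _ _ hc
        omega
    rw [← south_of_lt (by omega)] at ha hb
    exact hF.not_cross_of_lt hxy (by omega) hd (by omega) (by omega)
  rintro ⟨i, j⟩ hc ⟨r, j'⟩ hd h
  have h1 := hA _ _ hc
  have h2 := hA _ _ hd
  have h3 : F.west i j = F.west r j' ∧ F.south i j = F.south r j' := by
    rcases Sym2.eq_iff.1 h with h | h <;> simp only at h <;> omega
  rcases lt_trichotomy i r with hir | hir | hir
  · exact (key r j' i j hd hc hir h3.1.symm h3.2.symm).elim
  · subst hir
    rw [hF.south_inj (hF _ _ hc) (hF _ _ hd) h3.2]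
  · exact (key i j r j' hc hd hir h3.1 h3.2).elim

/-- The pipe with the smaller label enters to the left of the other one, and stays there until the
two cross. So it runs horizontally in their only cross. -/
lemma IsPipeDream.ascending (hF : F.IsPipeDream) : F.Ascending := by
  intro i j hc
  by_contra hle
  have hT := hF.triangular'
  have hlt := hT _ _ hc
  have hne := hT.west_ne_south le_rfl hlt
  set a := F.south i j with ha
  set b := F.west i j with hb
  have hia := hT.lt_south_le hlt
  have hib := hT.le_west_le hlt.le
  -- the pipes `a < b` have their only cross in row `i < a`, so `a` is to the left of `b` below it
  have hcross : ∀ r' j', (r', j') ∈ F.cross → F.west r' j' = a → F.south r' j' = b → False := by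
    intro r' j' hc' h1 h2
    have := hF.reduced _ hc' _ hc (by simp only [h1, h2, ← ha, ← hb]; exact Sym2.eq_swap)
    simp only [Prod.mk.injEq] at this
    obtain ⟨rfl, rfl⟩ := this
    omega
  have h0 : ∃ x y, x < y ∧ a + y ≤ F.size ∧ F.north a x = a ∧ F.north a y = b := by
    obtain ⟨x, hx, hxa⟩ := hT.exists_north (i := a) le_rfl hia.2
    obtain ⟨y, hy, hyb⟩ := hT.exists_south (show a < b by omega) hib.2
    obtain ⟨y', hy', hyb'⟩ := hT.exists_north (show a ≤ b by omega) hib.2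
    refine ⟨x, y', ?_, hy', hxa, hyb'⟩
    have hyy : y ≤ y' := by
      by_contra hlt
      exact hT.north_ne_south (j' := y') (j := y) (by omega) hy (hyb'.trans hyb.symm)
    -- until it meets `b` or turns up, the pipe `a` runs along row `a`
    have hrun : ∀ z ≤ y, z ≤ x → F.west a z = a := by
      intro z hz hzx
      have hxn : ∀ z' < z, F.north a z' ≠ a := fun z' hz' h => by
        have := hT.north_inj (by omega) hx (h.trans hxa.symm)
        omega
      have h1 := row_flux (fun l => if l = a then 1 else 0) F a z
      rw [Finset.sum_eq_zero (fun z' hz' => if_neg (hxn z' (Finset.mem_range.1 hz')))] at h1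
      by_contra hne
      simp only [if_neg hne, if_true] at h1
      omega
    rcases lt_or_ge y x with h | h
    · exfalso
      by_cases hcy : (a, y) ∈ F.cross
      · exact hcross a y hcy (hrun y le_rfl h.le) hyb
      · have h1 := north_of_elbow hcy
        rw [hrun y le_rfl h.le] at h1
        have := hT.north_inj (by omega) hx (h1.trans hxa.symm)
        omega
    · rcases (h.trans hyy).lt_or_eq with h' | h'
      · exact h'
      · subst h'
        omega
  obtain ⟨x, y, hxy, hy, h1, h2⟩ := hT.order_persists (r := i + 1) (by omega) h0
    fun r' j' _ _ => hcross r' j'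
  rw [← south_of_lt (by omega)] at h1 h2
  exact hT.not_cross_of_lt hxy (by omega) hc h2.symm h1.symm

/-- Reducedness can be checked cell by cell. -/
lemma isPipeDream_iff :
    F.IsPipeDream ↔ F.Triangular ∧ (0, 0) ∉ F.cross ∧ F.Ascending :=
  ⟨fun h => ⟨h.triangular', h.corner, h.ascending⟩, fun ⟨h1, h2, h3⟩ =>
    ⟨fun c hc => h1 c.1 c.2 hc, h2, h1.reduced_of_ascending h3⟩⟩

/-- The labelled crosses of a filling: row, label of the horizontal pipe, label of the vertical
pipe. -/
def crossings (F : Filling) : Set (ℕ × ℕ × ℕ) :=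
  {t | ∃ j, (t.1, j) ∈ F.cross ∧ F.west t.1 j = t.2.1 ∧ F.south t.1 j = t.2.2}

lemma mem_crossings {i a b : ℕ} :
    (i, a, b) ∈ F.crossings ↔ ∃ j, (i, j) ∈ F.cross ∧ F.west i j = a ∧ F.south i j = b := Iff.rfl

lemma IsPipeDream.mem_cross_iff (hF : F.IsPipeDream) {i j : ℕ} (h : i + j < F.size) :
    (i, j) ∈ F.cross ↔ (i, F.west i j, F.south i j) ∈ F.crossings := by
  refine ⟨fun hc => ⟨j, hc, rfl, rfl⟩, ?_⟩
  rintro ⟨j', hc, -, h2⟩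
  have := hF.triangular'.south_inj (hF.triangular' _ _ hc) h h2
  exact this ▸ hc

/-- A pipe dream is determined by its labelled crosses. -/
lemma IsPipeDream.ext_crossings (hF : F.IsPipeDream) (hG : G.IsPipeDream)
    (hs : F.size = G.size) (hX : F.crossings = G.crossings) : F = G := by
  have key : ∀ d i, i + d = F.size →
      (∀ j < d, F.south i j = G.south i j) ∧ ∀ j ≤ d, F.west i j = G.west i j ∧
        F.north i j = G.north i j := by
    intro d
    induction d with
    | zero =>
      intro i hi
      refine ⟨by simp, fun j hj => ?_⟩
      obtain rfl : j = 0 := by omega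
      rw [hF.triangular'.north_diag (by omega), hG.triangular'.north_diag (by omega)]
      simp
    | succ d ih =>
      intro i hi
      have hS : ∀ j < d + 1, F.south i j = G.south i j := fun j hj => by
        rw [south_of_lt (by omega), south_of_lt (by omega)]
        exact ((ih (i + 1) (by omega)).2 j (by omega)).2
      have hmem : ∀ j < d + 1, F.west i j = G.west i j → ((i, j) ∈ F.cross ↔ (i, j) ∈ G.cross) := by
        intro j hj hw
        rw [hF.mem_cross_iff (by omega), hG.mem_cross_iff (by omega), hw, hS j hj, hX]
      have hW : ∀ j ≤ d + 1, F.west i j = G.west i j := by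
        intro j
        induction j with
        | zero => simp
        | succ j ihj =>
          intro hj
          have hw := ihj (by omega)
          rw [west_succ, west_succ, hw, hS j (by omega)]
          simp only [hmem j (by omega) hw]
      refine ⟨hS, fun j hj => ⟨hW j hj, ?_⟩⟩
      rcases hj.lt_or_eq with h | h
      · rw [north, north, hW j hj, hS j h]
        simp only [hmem j h (hW j hj)]
      · rw [hF.triangular'.north_diag (by omega), hG.triangular'.north_diag (by omega), hW j hj]
  refine Filling.ext hs (Finset.ext ?_)
  rintro ⟨i, j⟩
  by_cases hij : i + j < F.size
  · rw [hF.mem_cross_iff hij, hG.mem_cross_iff (by omega), hX]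
    have := key (F.size - i) i (by omega)
    rw [this.1 j (by omega), (this.2 j (by omega)).1]
  · exact ⟨fun h => absurd (hF.triangular' _ _ h) hij,
      fun h => absurd (hG.triangular' _ _ h) (by omega)⟩

/-! ### Horizontal packing -/

/-- The number of pipes with label `≤ k` entering the first `j` cells of row `i` from below. -/
def southCount (F : Filling) (k i j : ℕ) : ℕ :=
  ((Finset.range j).filter fun x => F.south i x ≤ k).card

/-- The number of pipes with label `≤ k` leaving the first `j` cells of row `i` at the top. -/
def northCount (F : Filling) (k i j : ℕ) : ℕ :=
  ((Finset.range j).filter fun x => F.north i x ≤ k).card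

@[simp] lemma southCount_zero (F : Filling) (k i : ℕ) : F.southCount k i 0 = 0 := rfl

@[simp] lemma northCount_zero (F : Filling) (k i : ℕ) : F.northCount k i 0 = 0 := rfl

lemma southCount_succ (F : Filling) (k i j : ℕ) :
    F.southCount k i (j + 1) = F.southCount k i j + if F.south i j ≤ k then 1 else 0 := by
  simp only [southCount, Finset.card_filter, Finset.sum_range_succ]

lemma northCount_succ (F : Filling) (k i j : ℕ) :
    F.northCount k i (j + 1) = F.northCount k i j + if F.north i j ≤ k then 1 else 0 := by
  simp only [northCount, Finset.card_filter, Finset.sum_range_succ]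

lemma southCount_mono (F : Filling) (k i : ℕ) : Monotone (F.southCount k i) :=
  monotone_nat_of_le_succ fun j => by rw [southCount_succ]; omega

lemma northCount_mono (F : Filling) (k i : ℕ) : Monotone (F.northCount k i) :=
  monotone_nat_of_le_succ fun j => by rw [northCount_succ]; omega

lemma southCount_lt {k i j j' : ℕ} (h : j < j') (hs : F.south i j ≤ k) :
    F.southCount k i j < F.southCount k i j' := by
  have := F.southCount_mono k i (show j + 1 ≤ j' from h)
  rw [southCount_succ, if_pos hs] at this
  omega

lemma northCount_lt {k i j j' : ℕ} (h : j < j') (hs : F.north i j ≤ k) :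
    F.northCount k i j < F.northCount k i j' := by
  have := F.northCount_mono k i (show j + 1 ≤ j' from h)
  rw [northCount_succ, if_pos hs] at this
  omega

lemma southCount_inj {k i j j' : ℕ} (hs : F.south i j ≤ k) (hs' : F.south i j' ≤ k)
    (h : F.southCount k i j = F.southCount k i j') : j = j' := by
  rcases lt_trichotomy j j' with h1 | h1 | h1
  · have := southCount_lt h1 hs; omega
  · exact h1
  · have := southCount_lt h1 hs'; omega

/-- `row_flux` for the pipes with labels `≤ k`. -/
lemma northCount_add_west {k i : ℕ} (hi : i ≤ k) (j : ℕ) :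
    F.northCount k i j + (if F.west i j ≤ k then 1 else 0) = 1 + F.southCount k i j := by
  have := row_flux (fun l => if l ≤ k then 1 else 0) F i j
  rw [if_pos hi] at this
  simpa only [northCount, southCount, Finset.card_filter] using this

lemma southCount_eq_northCount {k i j : ℕ} (hj : i + j ≤ F.size) :
    F.southCount k i j = F.northCount k (i + 1) j := by
  rw [southCount, northCount]
  congr 1
  refine Finset.filter_congr fun x hx => ?_
  rw [south_of_lt (by have := Finset.mem_range.1 hx; omega)]

lemma sub_card_filter_eq_southCount (F : Filling) (k i j : ℕ) :
    j - ((Finset.range j).filter fun x => k < F.south i x).card = F.southCount k i j := by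
  have := Finset.card_filter_add_card_filter_not (s := Finset.range j) (fun x => F.south i x ≤ k)
  simp only [not_le, Finset.card_range] at this
  rw [southCount]
  omega

/-- All pipes with a label in `{i + 1, …, k}` enter row `i` from below. -/
lemma Triangular.add_southCount_le (hF : F.Triangular) {k i j : ℕ} (hi : i ≤ k)
    (hj : i + j ≤ F.size) : i + F.southCount k i j ≤ k := by
  have : F.southCount k i j ≤ (Finset.Icc (i + 1) k).card := by
    refine Finset.card_le_card_of_injOn (F.south i) ?_ ?_
    · intro x hx
      simp only [Finset.coe_filter, Finset.mem_range, Set.mem_ofPred_eq] at hx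
      simp only [Finset.coe_Icc, Set.mem_Icc]
      exact ⟨(hF.lt_south_le (by omega)).1, hx.2⟩
    · intro x hx y hy h
      simp only [Finset.coe_filter, Finset.mem_range, Set.mem_ofPred_eq] at hx hy
      exact hF.south_inj (by omega) (by omega) h
  rw [Nat.card_Icc] at this
  omega

lemma Triangular.add_southCount_lt (hF : F.Triangular) {k i j : ℕ} (hk : k ≤ F.size)
    (hs : F.south i j ≤ k) : i + F.southCount k i j < k := by
  have h1 := lt_of_south_le (hs.trans hk)
  have h2 := hF.lt_south_le h1
  have := hF.add_southCount_le (j := j + 1) (show i ≤ k by omega) (by omega)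
  rw [southCount_succ, if_pos hs] at this
  omega

lemma mem_hpack_cross {k i y : ℕ} : (i, y) ∈ (F.hpack k).cross ↔
    ∃ j, (i, j) ∈ F.cross ∧ F.west i j ≤ k ∧ F.south i j ≤ k ∧ F.southCount k i j = y := by
  simp only [hpack, Finset.mem_image, Finset.mem_filter, Prod.mk.injEq, Prod.exists,
    sub_card_filter_eq_southCount]
  constructor
  · rintro ⟨a, b, ⟨h1, h2, h3⟩, rfl, h5⟩
    exact ⟨b, h1, h2, h3, h5⟩
  · rintro ⟨j, h1, h2, h3, h4⟩
    exact ⟨i, j, ⟨h1, h2, h3⟩, rfl, h4⟩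

@[simp] lemma hpack_size (F : Filling) (k : ℕ) : (F.hpack k).size = k := rfl

lemma mem_hpack_cross_southCount {k i j : ℕ} (hs : F.south i j ≤ k) :
    (i, F.southCount k i j) ∈ (F.hpack k).cross ↔ (i, j) ∈ F.cross ∧ F.west i j ≤ k := by
  rw [mem_hpack_cross]
  constructor
  · rintro ⟨j', h1, h2, h3, h4⟩
    have := southCount_inj hs h3 h4.symm
    subst this
    exact ⟨h1, h2⟩
  · rintro ⟨h1, h2⟩
    exact ⟨j, h1, h2, hs, rfl⟩

/-- In the packing, a pipe with label `≤ k` keeps its row and moves left, past the removed pipes. -/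
lemma hpack_row (hA : F.Ascending) {k i : ℕ} (hi : i ≤ k)
    (hS : ∀ j, F.south i j ≤ k → (F.hpack k).south i (F.southCount k i j) = F.south i j) :
    (∀ j, F.west i j ≤ k → (F.hpack k).west i (F.southCount k i j) = F.west i j) ∧
    ∀ j, i + j ≤ F.size → F.north i j ≤ k →
      (F.hpack k).north i (F.northCount k i j) = F.north i j := by
  have hW : ∀ j, F.west i j ≤ k → (F.hpack k).west i (F.southCount k i j) = F.west i j := by
    intro j
    induction j with
    | zero => simp
    | succ j ih =>
      intro hw
      rw [southCount_succ]
      by_cases hs : F.south i j ≤ k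
      · rw [if_pos hs]
        by_cases hc : (i, j) ∈ F.cross
        · rw [west_succ_of_cross hc] at hw ⊢
          rw [west_succ_of_cross ((mem_hpack_cross_southCount hs).2 ⟨hc, hw⟩), ih hw]
        · rw [west_succ_of_elbow hc] at hw ⊢
          rw [west_succ_of_elbow fun h => hc ((mem_hpack_cross_southCount hs).1 h).1, hS j hs]
      · rw [if_neg hs, add_zero]
        by_cases hc : (i, j) ∈ F.cross
        · rw [west_succ_of_cross hc] at hw ⊢
          exact ih hw
        · rw [west_succ_of_elbow hc] at hw
          exact absurd hw hs
  refine ⟨hW, fun j hj hn => ?_⟩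
  have hcount := northCount_add_west (F := F) hi j
  by_cases hc : (i, j) ∈ F.cross
  · rw [north_of_cross hc] at hn ⊢
    have hw : F.west i j ≤ k := by have := hA i j hc; omega
    rw [if_pos hw] at hcount
    rw [show F.northCount k i j = F.southCount k i j by omega,
      north_of_cross ((mem_hpack_cross_southCount hn).2 ⟨hc, hw⟩), hS j hn]
  · have hn' := hn
    rw [north_of_elbow hc] at hn ⊢
    rw [if_pos hn] at hcount
    rw [show F.northCount k i j = F.southCount k i j by omega, north_of_elbow, hW j hn]
    intro hcross
    obtain ⟨j', h1, h2, h3, h4⟩ := mem_hpack_cross.1 hcross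
    have hcount' := northCount_add_west (F := F) hi j'
    rw [if_pos h2] at hcount'
    rcases lt_trichotomy j j' with h | h | h
    · have := northCount_lt h hn'
      omega
    · subst h
      exact hc h1
    · have := southCount_lt h h3
      omega

/-- The labels of the pipes in a packing, by induction on the rows from the bottom to the top. -/
lemma hpack_labels (hF : F.Triangular) (hA : F.Ascending) {k i : ℕ} (hk : k ≤ F.size) (hi : i ≤ k) :
    (∀ j, F.south i j ≤ k → (F.hpack k).south i (F.southCount k i j) = F.south i j) ∧
    (∀ j, F.west i j ≤ k → (F.hpack k).west i (F.southCount k i j) = F.west i j) ∧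
    ∀ j, i + j ≤ F.size → F.north i j ≤ k →
      (F.hpack k).north i (F.northCount k i j) = F.north i j := by
  obtain ⟨d, hd⟩ := Nat.exists_eq_add_of_le hi
  induction d generalizing i with
  | zero =>
    have hS : ∀ j, F.south i j ≤ k → (F.hpack k).south i (F.southCount k i j) = F.south i j := by
      intro j hj
      have := hF.lt_south (i := i) (j := j)
      omega
    exact ⟨hS, hpack_row hA hi hS⟩
  | succ d ih =>
    have hS : ∀ j, F.south i j ≤ k → (F.hpack k).south i (F.southCount k i j) = F.south i j := by
      intro j hj
      have h1 := hF.add_southCount_lt hk hj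
      have h2 := lt_of_south_le (hj.trans hk)
      rw [south_of_lt (by rwa [hpack_size]), south_of_lt h2, southCount_eq_northCount (by omega)]
      rw [south_of_lt h2] at hj
      exact (ih (i := i + 1) (by omega) (by omega)).2.2 j (by omega) hj
    exact ⟨hS, hpack_row hA hi hS⟩

lemma IsPipeDream.hpack_south (hF : F.IsPipeDream) {k i j : ℕ} (hk : k ≤ F.size)
    (hs : F.south i j ≤ k) : (F.hpack k).south i (F.southCount k i j) = F.south i j :=
  (hpack_labels hF.triangular' hF.ascending hk
    (by have := hF.triangular'.lt_south (i := i) (j := j); omega)).1 j hs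

lemma IsPipeDream.hpack_west (hF : F.IsPipeDream) {k i j : ℕ} (hk : k ≤ F.size) (hi : i ≤ k)
    (hs : F.west i j ≤ k) : (F.hpack k).west i (F.southCount k i j) = F.west i j :=
  (hpack_labels hF.triangular' hF.ascending hk hi).2.1 j hs

lemma IsPipeDream.hpack_north (hF : F.IsPipeDream) {k i j : ℕ} (hk : k ≤ F.size)
    (hj : i + j ≤ F.size) (hs : F.north i j ≤ k) :
    (F.hpack k).north i (F.northCount k i j) = F.north i j :=
  (hpack_labels hF.triangular' hF.ascending hk
    (by have := hF.triangular'.le_north_le hj; omega)).2.2 j hj hs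

lemma IsPipeDream.hpack (hF : F.IsPipeDream) {k : ℕ} (hk : k ≤ F.size) :
    (F.hpack k).IsPipeDream := by
  refine isPipeDream_iff.2 ⟨?_, ?_, ?_⟩
  · intro i y h
    obtain ⟨j, h1, h2, h3, rfl⟩ := mem_hpack_cross.1 h
    exact hF.triangular'.add_southCount_lt hk h3
  · intro h
    obtain ⟨j, h1, h2, h3, h4⟩ := mem_hpack_cross.1 h
    have hcount := northCount_add_west (F := F) (Nat.zero_le k) j
    rw [if_pos h2, h4] at hcount
    rcases Nat.eq_zero_or_pos j with rfl | hj
    · exact hF.corner h1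
    · have := northCount_lt (F := F) (k := k) (i := 0) hj
        (by rw [north_of_elbow hF.corner]; simp)
      omega
  · intro i y h
    obtain ⟨j, h1, h2, h3, rfl⟩ := mem_hpack_cross.1 h
    have hi : i ≤ k := by have := hF.triangular'.lt_south (i := i) (j := j); omega
    rw [hF.hpack_south hk h3, hF.hpack_west hk hi h2]
    exact hF.ascending i j h1

/-- Packing selects the labelled crosses whose pipes both remain, that is, those whose larger label,
the vertical one, remains. -/
lemma IsPipeDream.mem_crossings_hpack (hF : F.IsPipeDream) {k : ℕ} (hk : k ≤ F.size)
    {i a b : ℕ} : (i, a, b) ∈ (F.hpack k).crossings ↔ (i, a, b) ∈ F.crossings ∧ b ≤ k := by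
  simp only [mem_crossings]
  constructor
  · rintro ⟨y, h, rfl, rfl⟩
    obtain ⟨j, h1, h2, h3, rfl⟩ := mem_hpack_cross.1 h
    have hi : i ≤ k := by have := hF.triangular'.lt_south (i := i) (j := j); omega
    rw [hF.hpack_south hk h3, hF.hpack_west hk hi h2]
    exact ⟨⟨j, h1, rfl, rfl⟩, h3⟩
  · rintro ⟨⟨j, h, rfl, rfl⟩, h3⟩
    have h2 : F.west i j ≤ k := by have := hF.ascending i j h; omega
    have hi : i ≤ k := by have := hF.triangular'.lt_south (i := i) (j := j); omega
    exact ⟨F.southCount k i j, (mem_hpack_cross_southCount h3).2 ⟨h, h2⟩,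
      hF.hpack_west hk hi h2, hF.hpack_south hk h3⟩

lemma IsPipeDream.hpack_hpack (hF : F.IsPipeDream) {k l : ℕ} (hl : l ≤ k) (hk : k ≤ F.size) :
    (F.hpack k).hpack l = F.hpack l := by
  refine ((hF.hpack hk).hpack hl).ext_crossings (hF.hpack (hl.trans hk)) rfl ?_
  ext ⟨i, a, b⟩
  rw [(hF.hpack hk).mem_crossings_hpack hl, hF.mem_crossings_hpack hk,
    hF.mem_crossings_hpack (hl.trans hk)]
  exact ⟨fun h => ⟨h.1.1, h.2⟩, fun h => ⟨⟨h.1, h.2.trans hl⟩, h.2⟩⟩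

lemma IsPipeDream.hpack_self (hF : F.IsPipeDream) : F.hpack F.size = F := by
  refine (hF.hpack le_rfl).ext_crossings hF rfl ?_
  ext ⟨i, a, b⟩
  rw [hF.mem_crossings_hpack le_rfl, and_iff_left_iff_imp]
  rintro ⟨j, hc, -, hb⟩
  exact hb.symm.le.trans (hF.triangular'.lt_south_le (hF.triangular' _ _ hc)).2

/-- Packing does not change the order in which the remaining pipes leave a row. -/
lemma IsPipeDream.hpack_north_card (hF : F.IsPipeDream) {k i : ℕ} (hk : k ≤ F.size)
    (S : ℕ → Prop) [DecidablePred S] (hS : ∀ l, S l → l ≤ k) {j : ℕ}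
    (hj : i + j ≤ F.size + 1) :
    ((Finset.range (F.northCount k i j)).filter fun y => S ((F.hpack k).north i y)).card =
      ((Finset.range j).filter fun x => S (F.north i x)).card := by
  induction j with
  | zero => simp
  | succ j ih =>
    rw [northCount_succ]
    by_cases hn : F.north i j ≤ k
    · rw [if_pos hn, Finset.card_filter, Finset.card_filter, Finset.sum_range_succ,
        Finset.sum_range_succ, ← Finset.card_filter, ← Finset.card_filter, ih (by omega),
        hF.hpack_north hk (by omega) hn]
    · rw [if_neg hn, add_zero, ih (by omega), Finset.card_filter, Finset.card_filter,
        Finset.sum_range_succ, if_neg fun h => hn (hS _ h), add_zero]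

/-! ### Reflection across the diagonal -/

@[simp] lemma transpose_size (F : Filling) : F.transpose.size = F.size := rfl

@[simp] lemma mem_transpose_cross {i j : ℕ} : (i, j) ∈ F.transpose.cross ↔ (j, i) ∈ F.cross := by
  simp [transpose]

@[simp] lemma transpose_transpose (F : Filling) : F.transpose.transpose = F := by
  refine Filling.ext rfl (Finset.ext fun ⟨i, j⟩ => ?_)
  rw [mem_transpose_cross, mem_transpose_cross]

lemma Triangular.transpose (hF : F.Triangular) : F.transpose.Triangular := fun i j h => by
  have := hF _ _ (mem_transpose_cross.1 h)
  rw [transpose_size]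
  omega

/-- The reflected filling has the same pipes, run through backwards. So a label of the reflection
is the column in which the pipe exits, and `F.perm` translates it into the label of the pipe
in `F`. -/
lemma Triangular.perm_transpose_labels (hF : F.Triangular) (d : ℕ) :
    ∀ i j, i + j + d = F.size →
      F.perm (F.transpose.west j i) = F.north i j ∧
      (d ≠ 0 → F.perm (F.transpose.south j i) = F.west i (j + 1)) := by
  suffices H : ∀ i d j, i + j + d = F.size →
      F.perm (F.transpose.west j i) = F.north i j ∧
      (d ≠ 0 → F.perm (F.transpose.south j i) = F.west i (j + 1)) from fun i j => H i d j
  intro i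
  induction i with
  | zero =>
    intro d
    induction d with
    | zero => intro j h; simp [perm_eq_north]
    | succ d ih =>
      intro j h
      refine ⟨by simp [perm_eq_north], fun _ => ?_⟩
      have h1 := ih (j + 1) (by omega)
      rw [south_of_lt (by rw [transpose_size]; omega), north]
      split_ifs with hc <;> rw [mem_transpose_cross] at hc
      · have := hF _ _ hc
        rw [h1.2 (by omega), west_succ_of_cross hc]
      · rw [h1.1, north_of_elbow hc]
  | succ i ih =>
    have hW : ∀ d j, i + 1 + j + d = F.size →
        F.perm (F.transpose.west j (i + 1)) = F.north (i + 1) j := by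
      intro d j h
      have h1 := ih (d + 1) j (by omega)
      rw [west_succ, ← south_of_lt (by omega)]
      split_ifs with hc <;> rw [mem_transpose_cross] at hc
      · rw [h1.1, north_of_cross hc]
      · rw [h1.2 (by omega), west_succ_of_elbow hc]
    intro d
    induction d with
    | zero => exact fun j h => ⟨hW 0 j h, by simp⟩
    | succ d ihd =>
      intro j h
      refine ⟨hW (d + 1) j h, fun _ => ?_⟩
      have h1 := ihd (j + 1) (by omega)
      rw [south_of_lt (by rw [transpose_size]; omega), north]
      split_ifs with hc <;> rw [mem_transpose_cross] at hc
      · have := hF _ _ hc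
        rw [h1.2 (by omega), west_succ_of_cross hc]
      · rw [h1.1, north_of_elbow hc]

lemma Triangular.perm_transpose_west (hF : F.Triangular) {i j : ℕ} (h : i + j ≤ F.size) :
    F.perm (F.transpose.west j i) = F.north i j :=
  (hF.perm_transpose_labels (F.size - i - j) i j (by omega)).1

lemma Triangular.perm_transpose_south (hF : F.Triangular) {i j : ℕ} (h : i + j < F.size) :
    F.perm (F.transpose.south j i) = F.west i (j + 1) :=
  (hF.perm_transpose_labels (F.size - i - j) i j (by omega)).2 (by omega)

lemma Triangular.perm_transpose_north (hF : F.Triangular) {i j : ℕ} (h : i + j ≤ F.size) :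
    F.perm (F.transpose.north j i) = F.west i j := by
  rw [north]
  split_ifs with hc <;> rw [mem_transpose_cross] at hc
  · rw [hF.perm_transpose_south (hF _ _ hc), west_succ_of_cross hc]
  · rw [hF.perm_transpose_west h, north_of_elbow hc]

lemma Triangular.perm_perm_transpose (hF : F.Triangular) {i : ℕ} (h : i ≤ F.size) :
    F.perm (F.transpose.perm i) = i := by
  rw [perm_eq_north F.transpose, hF.perm_transpose_north (by omega), west_zero]

lemma Triangular.perm_transpose_perm (hF : F.Triangular) {i : ℕ} (h : i ≤ F.size) :
    F.transpose.perm (F.perm i) = i := by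
  simpa using hF.transpose.perm_perm_transpose (i := i) h

lemma Triangular.perm_le (hF : F.Triangular) {i : ℕ} (h : i ≤ F.size) : F.perm i ≤ F.size :=
  (hF.le_north_le (i := 0) (by omega)).2

lemma Triangular.perm_inj (hF : F.Triangular) {i j : ℕ} (hi : i ≤ F.size) (hj : j ≤ F.size)
    (h : F.perm i = F.perm j) : i = j :=
  hF.north_inj (i := 0) (by omega) (by omega) h

lemma IsPipeDream.perm_zero (hF : F.IsPipeDream) : F.perm 0 = 0 := by
  rw [perm_eq_north, north_of_elbow hF.corner, west_zero]

lemma IsPipeDream.perm_pos (hF : F.IsPipeDream) {i : ℕ} (h0 : 0 < i) (h : i ≤ F.size) :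
    0 < F.perm i := by
  by_contra hc
  have := hF.triangular'.perm_inj (i := i) (j := 0) h (by omega) (by rw [hF.perm_zero]; omega)
  omega

/-- The reflection permutes the labels by `F.perm`, so that it stays reduced. -/
lemma IsPipeDream.transpose (hF : F.IsPipeDream) : F.transpose.IsPipeDream := by
  have hT := hF.triangular'
  refine ⟨fun c hc => hT.transpose c.1 c.2 hc, by simpa using hF.corner, ?_⟩
  have key : ∀ i j, (i, j) ∈ F.cross →
      s(F.west i j, F.south i j) =
        Sym2.map F.perm s(F.transpose.west j i, F.transpose.south j i) := by
    intro i j hc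
    have := hT _ _ hc
    rw [Sym2.map_mk, hT.perm_transpose_west this.le, hT.perm_transpose_south this,
      north_of_cross hc, west_succ_of_cross hc, Sym2.eq_swap]
  rintro ⟨i, j⟩ hc ⟨i', j'⟩ hd h
  simp only [mem_transpose_cross] at hc hd
  have := hF.reduced _ hc _ hd (by
    simp only
    rw [key _ _ hc, key _ _ hd]
    exact congrArg _ h)
  simp only [Prod.mk.injEq] at this ⊢
  exact this.symm

lemma IsPipeDream.vpack (hF : F.IsPipeDream) {k : ℕ} (hk : k ≤ F.size) :
    (F.vpack k).IsPipeDream := (hF.transpose.hpack hk).transpose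

@[simp] lemma vpack_size (F : Filling) (k : ℕ) : (F.vpack k).size = k := rfl

lemma transpose_vpack (F : Filling) (k : ℕ) : (F.vpack k).transpose = F.transpose.hpack k := by
  rw [Filling.vpack, transpose_transpose]

lemma transpose_injective {F G : Filling} (h : F.transpose = G.transpose) : F = G := by
  rw [← transpose_transpose F, h, transpose_transpose]

lemma IsPipeDream.vpack_vpack (hF : F.IsPipeDream) {k l : ℕ} (hl : l ≤ k) (hk : k ≤ F.size) :
    (F.vpack k).vpack l = F.vpack l := by
  apply transpose_injective
  rw [transpose_vpack, transpose_vpack, transpose_vpack, hF.transpose.hpack_hpack hl hk]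

lemma IsPipeDream.vpack_self (hF : F.IsPipeDream) : F.vpack F.size = F := by
  apply transpose_injective
  rw [transpose_vpack]
  exact hF.transpose.hpack_self

/-! ### Global descents -/

lemma IsGlobalDescent.le {γ : ℕ} (h : F.IsGlobalDescent γ) : γ ≤ F.size := h.1

/-- As the permutation is injective, one of the two inclusions in the definition of a global descent
implies the other. -/
lemma isGlobalDescent_iff (hF : F.Triangular) {γ : ℕ} :
    F.IsGlobalDescent γ ↔ γ ≤ F.size ∧ ∀ j, 1 ≤ j → j ≤ γ → F.size - γ < F.perm j := by
  refine and_congr_right fun hγ => ⟨fun h j h1 h2 => ?_, fun h => ?_⟩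
  · have := h ▸ Finset.mem_image_of_mem F.perm (Finset.mem_Icc.2 ⟨h1, h2⟩)
    simp only [Finset.mem_sdiff, Finset.mem_Icc] at this
    omega
  · refine Finset.eq_of_subset_of_card_le ?_ ?_
    · intro l hl
      obtain ⟨j, hj, rfl⟩ := Finset.mem_image.1 hl
      rw [Finset.mem_Icc] at hj
      have := h j hj.1 hj.2
      have := hF.perm_le (i := j) (by omega)
      simp only [Finset.mem_sdiff, Finset.mem_Icc]
      omega
    · rw [Finset.card_image_of_injOn, Finset.card_sdiff_of_subset]
      · simp only [Nat.card_Icc]; omega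
      · exact Finset.Icc_subset_Icc_right (by omega)
      · intro x hx y hy hxy
        simp only [Finset.coe_Icc, Set.mem_Icc] at hx hy
        exact hF.perm_inj (by omega) (by omega) hxy

lemma Triangular.isGlobalDescent_zero (hF : F.Triangular) : F.IsGlobalDescent 0 :=
  (isGlobalDescent_iff hF).2 ⟨by omega, fun j _ _ => by omega⟩

lemma IsPipeDream.isGlobalDescent_size (hF : F.IsPipeDream) : F.IsGlobalDescent F.size :=
  (isGlobalDescent_iff hF.triangular').2
    ⟨le_rfl, fun j h1 h2 => by rw [Nat.sub_self]; exact hF.perm_pos h1 h2⟩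

lemma IsGlobalDescent.lt_perm {γ : ℕ} (h : F.IsGlobalDescent γ) (hF : F.Triangular) {j : ℕ}
    (h1 : 1 ≤ j) (h2 : j ≤ γ) : F.size - γ < F.perm j :=
  ((isGlobalDescent_iff hF).1 h).2 j h1 h2

lemma IsGlobalDescent.perm_le {γ : ℕ} (h : F.IsGlobalDescent γ) (hF : F.Triangular) {j : ℕ}
    (h1 : γ < j) (h2 : j ≤ F.size) : F.perm j ≤ F.size - γ := by
  by_contra hc
  have hmem : F.perm j ∈ Finset.Icc 1 F.size \ Finset.Icc 1 (F.size - γ) := by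
    have := hF.perm_le h2
    simp only [Finset.mem_sdiff, Finset.mem_Icc]
    omega
  rw [← h.2] at hmem
  obtain ⟨j', hj', he⟩ := Finset.mem_image.1 hmem
  rw [Finset.mem_Icc] at hj'
  have := hF.perm_inj (by omega) h2 he
  omega

lemma IsGlobalDescent.transpose {γ : ℕ} (h : F.IsGlobalDescent γ) (hF : F.IsPipeDream) :
    F.transpose.IsGlobalDescent (F.size - γ) := by
  have hT := hF.triangular'
  refine (isGlobalDescent_iff hT.transpose).2 ⟨by rw [transpose_size]; omega, fun l h1 h2 => ?_⟩
  rw [transpose_size]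
  by_contra hc
  have := h.lt_perm hT (hF.transpose.perm_pos h1 (by rw [transpose_size]; omega)) (by omega)
  rw [hT.perm_perm_transpose (by omega)] at this
  omega

/-- At a global descent `γ`, the pipes with labels `≤ size - γ` exit in column `0` and in the
columns `> γ`. -/
lemma IsGlobalDescent.northCount {γ : ℕ} (h : F.IsGlobalDescent γ) (hF : F.IsPipeDream) {j : ℕ}
    (h1 : γ < j) (h2 : j ≤ F.size + 1) : F.northCount (F.size - γ) 0 j = j - γ := by
  have h0 : ∀ x, x + 1 ≤ γ + 1 → F.northCount (F.size - γ) 0 (x + 1) = 1 := by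
    intro x
    induction x with
    | zero =>
      intro _
      rw [northCount_succ, ← perm_eq_north, hF.perm_zero]
      simp
    | succ x ih =>
      intro hx
      have := h.lt_perm hF.triangular' (j := x + 1) (by omega) (by omega)
      rw [northCount_succ, ih (by omega), ← perm_eq_north, if_neg (by omega)]
  induction j, h1 using Nat.le_induction with
  | base => rw [h0 γ le_rfl]; omega
  | succ j hj ih =>
    rw [northCount_succ, ih (by omega), ← perm_eq_north,
      if_pos (h.perm_le hF.triangular' hj (by omega))]
    omega

lemma IsGlobalDescent.perm_hpack {γ : ℕ} (h : F.IsGlobalDescent γ) (hF : F.IsPipeDream) {j : ℕ}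
    (h1 : 1 ≤ j) (h2 : j + γ ≤ F.size) : (F.hpack (F.size - γ)).perm j = F.perm (j + γ) := by
  rw [perm_eq_north, perm_eq_north, ← hF.hpack_north (k := F.size - γ) (by omega) (by omega)
    (h.perm_le hF.triangular' (by omega) h2), h.northCount hF (by omega) (by omega),
    Nat.add_sub_cancel]

lemma IsGlobalDescent.perm_vpack {γ : ℕ} (h : F.IsGlobalDescent γ) (hF : F.IsPipeDream) {j : ℕ}
    (h1 : 1 ≤ j) (h2 : j ≤ γ) : (F.vpack γ).perm j = F.perm j - (F.size - γ) := by
  have hle := h.le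
  have hT := hF.triangular'
  have h3 := h.lt_perm hT h1 h2
  have h4 := hT.perm_le (i := j) (by omega)
  have h5 := (h.transpose hF).perm_hpack hF.transpose (j := F.perm j - (F.size - γ))
    (by omega) (by rw [transpose_size]; omega)
  rw [transpose_size, Nat.sub_sub_self hle, Nat.sub_add_cancel (by omega),
    hT.perm_transpose_perm (by omega)] at h5
  have h6 := (hF.transpose.hpack (k := γ) hle).triangular'.perm_transpose_perm
    (i := F.perm j - (F.size - γ)) (by rw [hpack_size]; omega)
  rw [h5] at h6
  exact h6

lemma IsGlobalDescent.hpack_iff {γ δ : ℕ} (h : F.IsGlobalDescent γ) (hF : F.IsPipeDream) :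
    (F.hpack (F.size - γ)).IsGlobalDescent δ ↔ F.IsGlobalDescent (γ + δ) := by
  have hle := h.le
  rw [isGlobalDescent_iff hF.triangular', isGlobalDescent_iff (hF.hpack (by omega)).triangular',
    hpack_size]
  constructor
  · rintro ⟨h1, h2⟩
    refine ⟨by omega, fun j hj1 hj2 => ?_⟩
    rcases le_or_gt j γ with hj | hj
    · have := h.lt_perm hF.triangular' hj1 hj
      omega
    · have := h2 (j - γ) (by omega) (by omega)
      rw [h.perm_hpack hF (by omega) (by omega), Nat.sub_add_cancel hj.le] at this
      omega
  · rintro ⟨h1, h2⟩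
    refine ⟨by omega, fun j hj1 hj2 => ?_⟩
    rw [h.perm_hpack hF hj1 (by omega)]
    have := h2 (j + γ) (by omega) (by omega)
    omega

lemma IsGlobalDescent.vpack_iff {γ δ : ℕ} (h : F.IsGlobalDescent γ) (hF : F.IsPipeDream)
    (hδ : δ ≤ γ) : (F.vpack γ).IsGlobalDescent δ ↔ F.IsGlobalDescent δ := by
  have hle := h.le
  rw [isGlobalDescent_iff hF.triangular', isGlobalDescent_iff (hF.vpack (by omega)).triangular',
    vpack_size]
  refine and_congr (by omega) (forall_congr' fun j => forall_congr' fun h1 =>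
    forall_congr' fun h2 => ?_)
  have := h.lt_perm hF.triangular' h1 (h2.trans hδ)
  rw [h.perm_vpack hF h1 (h2.trans hδ)]
  omega

/-! ### Packings in both directions commute -/

/-- The pipes entering the rectangle of the cells above row `i` and weakly to the left of column `j`
are those that leave it. -/
lemma rectangle_flux (f : ℕ → ℕ) {i j : ℕ} (h : i + j ≤ F.size) :
    ∑ x ∈ Finset.range i, f (F.west x (j + 1)) + ∑ y ∈ Finset.range (j + 1), f (F.perm y) =
      ∑ x ∈ Finset.range i, f x + ∑ y ∈ Finset.range (j + 1), f (F.north i y) := by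
  induction i with
  | zero => simp [perm_eq_north]
  | succ i ih =>
    have h1 := row_flux f F i (j + 1)
    have h2 : ∑ y ∈ Finset.range (j + 1), f (F.south i y) =
        ∑ y ∈ Finset.range (j + 1), f (F.north (i + 1) y) :=
      Finset.sum_congr rfl fun y hy => by
        rw [south_of_lt (by have := Finset.mem_range.1 hy; omega)]
    have := ih (by omega)
    rw [Finset.sum_range_succ, Finset.sum_range_succ (fun x => f x)]
    omega

lemma IsPipeDream.west_pos (hF : F.IsPipeDream) {i j : ℕ} (h : (i, j) ∈ F.cross) :
    0 < F.west i j := by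
  have hlt := hF.triangular' _ _ h
  have hle := hF.triangular'.le_west_le hlt.le
  rcases Nat.eq_zero_or_pos i with rfl | hi
  · have hj : 0 < j := Nat.pos_of_ne_zero fun hj => hF.corner (hj ▸ h)
    have := hF.triangular'.west_ne_north hj hlt.le
    rw [← perm_eq_north, hF.perm_zero] at this
    omega
  · omega

/-- The column `e = 0` is special: the pipe that exits there has the label `0`, which survives both
packings. -/
lemma IsGlobalDescent.le_iff_perm {γ e : ℕ} (h : F.IsGlobalDescent γ) (hF : F.IsPipeDream)
    (he : e ≤ F.size) : e ≤ γ ↔ ¬(1 ≤ F.perm e ∧ F.perm e ≤ F.size - γ) := by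
  rcases Nat.eq_zero_or_pos e with rfl | h0
  · rw [hF.perm_zero]; omega
  · have h1 := hF.perm_pos h0 he
    rcases le_or_gt e γ with h2 | h2
    · have := h.lt_perm hF.triangular' h0 h2
      omega
    · have := h.perm_le hF.triangular' h2 he
      omega

/-- The labelled crosses of a vertical packing at a global descent `δ`. A cross in the cell `(i, j)`
moves up by the number of removed pipes that pass above it; these are the removed pipes that enter
above row `i`, and those that leave row `i` at the top, to the left of the cell. -/
lemma IsGlobalDescent.mem_crossings_vpack {δ : ℕ} (h : F.IsGlobalDescent δ) (hF : F.IsPipeDream)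
    {r a b : ℕ} : (r, a, b) ∈ (F.vpack δ).crossings ↔
      ∃ i j, (i, j) ∈ F.cross ∧ F.size - δ < F.west i j ∧
        i - (((Finset.range i).filter fun l => 1 ≤ l ∧ l ≤ F.size - δ).card +
          ((Finset.range j).filter fun x => 1 ≤ F.north i x ∧ F.north i x ≤ F.size - δ).card) = r ∧
        F.west i j - (F.size - δ) = a ∧ F.south i j - (F.size - δ) = b := by
  have hle := h.le
  have hT := hF.triangular'
  have hH := hF.transpose.hpack (k := δ) hle
  -- the exits of the two pipes that cross in the cell `(i, j)`, and the packed cell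
  have key : ∀ i j, (i, j) ∈ F.cross → F.size - δ < F.west i j →
      F.transpose.west j i ≤ δ ∧ F.transpose.south j i ≤ δ := by
    intro i j hc hw
    have hlt := hT _ _ hc
    have hA := hF.ascending _ _ hc
    rw [h.le_iff_perm hF (hT.transpose.le_west_le (by rw [transpose_size]; omega)).2,
      h.le_iff_perm hF (hT.transpose.lt_south_le (by rw [transpose_size]; omega)).2,
      hT.perm_transpose_west (by omega), hT.perm_transpose_south (by omega), north_of_cross hc,
      west_succ_of_cross hc]
    omega
  have key' : ∀ i j, (i, j) ∈ F.cross → F.transpose.west j i ≤ δ → F.transpose.south j i ≤ δ →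
      F.size - δ < F.west i j ∧
      F.transpose.southCount δ j i =
        i - (((Finset.range i).filter fun l => 1 ≤ l ∧ l ≤ F.size - δ).card +
          ((Finset.range j).filter
            fun x => 1 ≤ F.north i x ∧ F.north i x ≤ F.size - δ).card) ∧
      (F.vpack δ).west (F.transpose.southCount δ j i) j = F.west i j - (F.size - δ) ∧
      (F.vpack δ).south (F.transpose.southCount δ j i) j = F.south i j - (F.size - δ) := by
    intro i j hc hw hs
    have hlt := hT _ _ hc
    have hA := hF.ascending _ _ hc
    have hpw := hT.perm_transpose_west hlt.le
    have hps := hT.perm_transpose_south hlt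
    rw [north_of_cross hc] at hpw
    rw [west_succ_of_cross hc] at hps
    have hwpos := hF.west_pos hc
    have hw0 : 0 < F.transpose.west j i := Nat.pos_of_ne_zero fun h0 => by
      rw [h0, hF.perm_zero] at hpw; omega
    have hs0 : 0 < F.transpose.south j i := by
      have := hT.transpose.lt_south (i := j) (j := i); omega
    have hjδ : j ≤ δ :=
      (hT.transpose.le_west_le (i := j) (j := i) (by rw [transpose_size]; omega)).1.trans hw
    have hlow : F.size - δ < F.west i j := by
      have := h.lt_perm hT hs0 hs
      omega
    have hcross : (j, F.transpose.southCount δ j i) ∈ (F.transpose.hpack δ).cross :=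
      (mem_hpack_cross_southCount hs).2 ⟨mem_transpose_cross.2 hc, hw⟩
    have hHt := hH.triangular' _ _ hcross
    refine ⟨hlow, ?_, ?_, ?_⟩
    · have h1 := rectangle_flux (F := F)
        (fun l => if 1 ≤ l ∧ l ≤ F.size - δ then 1 else 0) hlt.le
      rw [Finset.sum_eq_zero (s := Finset.range (j + 1)) (f := fun y =>
        if 1 ≤ F.perm y ∧ F.perm y ≤ F.size - δ then 1 else 0) (fun y hy => if_neg (by
          rw [← h.le_iff_perm hF (by have := Finset.mem_range.1 hy; omega)]
          have := Finset.mem_range.1 hy; omega)),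
        Finset.sum_range_succ (fun y => if 1 ≤ F.north i y ∧ F.north i y ≤ F.size - δ
          then 1 else 0), north_of_cross hc, if_neg (by omega)] at h1
      simp only [← Finset.card_filter, add_zero] at h1
      rw [← h1]
      have h2 := Finset.card_filter_add_card_filter_not (s := Finset.range i)
        (fun x => 1 ≤ F.west x (j + 1) ∧ F.west x (j + 1) ≤ F.size - δ)
      rw [Finset.card_range] at h2
      have h3 : F.transpose.southCount δ j i = ((Finset.range i).filter
          fun x => ¬(1 ≤ F.west x (j + 1) ∧ F.west x (j + 1) ≤ F.size - δ)).card := by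
        rw [southCount]
        congr 1
        refine Finset.filter_congr fun x hx => ?_
        rw [Finset.mem_range] at hx
        rw [h.le_iff_perm hF (hT.transpose.lt_south_le (by rw [transpose_size]; omega)).2,
          hT.perm_transpose_south (by omega)]
      omega
    · have h1 := hH.triangular'.perm_transpose_west (i := j)
        (j := F.transpose.southCount δ j i) hHt.le
      rw [north_of_cross hcross, hF.transpose.hpack_south hle hs] at h1
      have h2 := hH.triangular'.perm_transpose_perm
        (hH.transpose.triangular'.le_west_le (i := F.transpose.southCount δ j i) (j := j)
          (by rw [transpose_size]; omega)).2
      rw [h1] at h2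
      rw [← hps, ← h.perm_vpack hF hs0 hs]
      exact h2.symm
    · have h1 := hH.triangular'.perm_transpose_south hHt
      rw [west_succ_of_cross hcross, hF.transpose.hpack_west hle hjδ hw] at h1
      have h2 := hH.triangular'.perm_transpose_perm
        (hH.transpose.triangular'.lt_south_le (i := F.transpose.southCount δ j i) (j := j)
          (by rw [transpose_size]; omega)).2
      rw [h1] at h2
      rw [← hpw, ← h.perm_vpack hF hw0 hw]
      exact h2.symm
  rw [mem_crossings]
  constructor
  · rintro ⟨j, hc, rfl, rfl⟩
    obtain ⟨i, h1, h2, h3, rfl⟩ := mem_hpack_cross.1 (mem_transpose_cross.1 hc)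
    rw [mem_transpose_cross] at h1
    obtain ⟨h4, h5, h6, h7⟩ := key' i j h1 h2 h3
    exact ⟨i, j, h1, h4, h5.symm, h6.symm, h7.symm⟩
  · rintro ⟨i, j, hc, hw, rfl, rfl, rfl⟩
    obtain ⟨h1, h2⟩ := key i j hc hw
    obtain ⟨-, h5, h6, h7⟩ := key' i j hc h1 h2
    rw [← h5]
    exact ⟨j, mem_transpose_cross.2 ((mem_hpack_cross_southCount h2).2
      ⟨mem_transpose_cross.2 hc, h1⟩), h6, h7⟩

/-- The part of a pipe dream between two of its global descents does not depend on the order in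
which the two ends are cut off. -/
lemma IsGlobalDescent.hpack_vpack_comm {γ δ : ℕ} (hγ : F.IsGlobalDescent γ)
    (hδ : F.IsGlobalDescent δ) (hF : F.IsPipeDream) (h : γ ≤ δ) :
    (F.vpack δ).hpack (δ - γ) = (F.hpack (F.size - γ)).vpack (δ - γ) := by
  have hle := hδ.le
  have hT := hF.triangular'
  have hL := hF.hpack (k := F.size - γ) (by omega)
  have hδ' : (F.hpack (F.size - γ)).IsGlobalDescent (δ - γ) := by
    rwa [hγ.hpack_iff hF, Nat.add_sub_cancel' h]
  refine ((hF.vpack hle).hpack (by rw [vpack_size]; omega)).ext_crossings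
    (hL.vpack (by rw [hpack_size]; omega)) rfl ?_
  ext ⟨r, a, b⟩
  rw [(hF.vpack hle).mem_crossings_hpack (by rw [vpack_size]; omega), hδ.mem_crossings_vpack hF,
    hδ'.mem_crossings_vpack hL, hpack_size, show F.size - γ - (δ - γ) = F.size - δ by omega]
  have count : ∀ i j, (i, j) ∈ F.cross → F.south i j ≤ F.size - γ →
      ((Finset.range (F.southCount (F.size - γ) i j)).filter fun x =>
        1 ≤ (F.hpack (F.size - γ)).north i x ∧
          (F.hpack (F.size - γ)).north i x ≤ F.size - δ).card =
      ((Finset.range j).filter fun x => 1 ≤ F.north i x ∧ F.north i x ≤ F.size - δ).card := by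
    intro i j hc hs
    have h1 := hF.ascending _ _ hc
    have h2 := hT.lt_south (i := i) (j := j)
    have h3 := hT _ _ hc
    have h4 := northCount_add_west (F := F) (k := F.size - γ) (i := i) (by omega) j
    rw [if_pos (by omega)] at h4
    rw [show F.southCount (F.size - γ) i j = F.northCount (F.size - γ) i j by omega]
    exact hF.hpack_north_card (by omega) (fun l => 1 ≤ l ∧ l ≤ F.size - δ)
      (fun l hl => by omega) (by omega)
  constructor
  · rintro ⟨⟨i, j, hc, hw, rfl, rfl, rfl⟩, hb⟩
    have h1 := hF.ascending _ _ hc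
    have hs : F.south i j ≤ F.size - γ := by omega
    have h2 := hT.lt_south (i := i) (j := j)
    refine ⟨i, F.southCount (F.size - γ) i j,
      (mem_hpack_cross_southCount hs).2 ⟨hc, by omega⟩, ?_⟩
    rw [hF.hpack_south (by omega) hs, hF.hpack_west (by omega) (by omega) (by omega),
      count i j hc hs]
    exact ⟨hw, rfl, rfl, rfl⟩
  · rintro ⟨i, y, hc, hw, rfl, rfl, rfl⟩
    obtain ⟨j, h1, h2, hs, rfl⟩ := mem_hpack_cross.1 hc
    have h3 := hT.lt_south (i := i) (j := j)
    rw [hF.hpack_west (by omega) (by omega) h2] at hw ⊢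
    rw [hF.hpack_south (by omega) hs, count i j h1 hs]
    exact ⟨⟨i, j, h1, hw, rfl, rfl, rfl⟩, by omega⟩

/-! ### Insertion: cells and pipes -/

/-- The effect on the rows and labels of `P` of inserting `n` rows after row `g`. -/
def shift (g n a : ℕ) : ℕ := if a ≤ g then a else a + n

lemma shift_of_le {g n a : ℕ} (h : a ≤ g) : shift g n a = a := if_pos h

lemma shift_of_lt {g n a : ℕ} (h : g < a) : shift g n a = a + n := if_neg (by omega)

@[simp] lemma insertAt_size (P Q : Filling) (γ : ℕ) : (P.insertAt γ Q).size = P.size + Q.size := rfl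

lemma mem_insertAt {γ r c : ℕ} : (r, c) ∈ (P.insertAt γ Q).cross ↔
    (∃ a b, (a, b) ∈ P.cross ∧ shift (P.size - γ) Q.size a = r ∧ shift γ Q.size b = c) ∨
    (∃ a b, (a, b) ∈ Q.cross ∧ P.size - γ + a = r ∧ γ + b = c) ∨
    (r < P.size - γ ∧ γ < c ∧ c ≤ γ + Q.size) ∨
    (P.size - γ < r ∧ r ≤ P.size - γ + Q.size ∧ c < γ) := by
  simp only [insertAt, shift, Finset.mem_union, Finset.mem_image, Finset.mem_product,
    Finset.mem_range, Finset.mem_Icc, Prod.exists, Prod.mk.injEq, Nat.succ_le_iff, or_assoc,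
    and_assoc]

lemma shift_injective (g n : ℕ) : Function.Injective (shift g n) := by
  intro a b h
  unfold shift at h
  split_ifs at h <;> omega

lemma Triangular.insertAt (hP : P.Triangular) {γ : ℕ} (hγ : γ ≤ P.size) (hQ : Q.Triangular) :
    (P.insertAt γ Q).Triangular := by
  intro r c h
  rw [insertAt_size]
  rcases mem_insertAt.1 h with ⟨a, b, h1, rfl, rfl⟩ | ⟨a, b, h1, rfl, rfl⟩ | h1 | h1
  · have := hP _ _ h1
    unfold shift
    split_ifs <;> omega
  · have := hQ _ _ h1
    omega
  · omega
  · omega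

lemma mem_insertAt_old (hQ : Q.Triangular) (hQ0 : (0, 0) ∉ Q.cross) {γ r c : ℕ} :
    (shift (P.size - γ) Q.size r, shift γ Q.size c) ∈ (P.insertAt γ Q).cross ↔
      (r, c) ∈ P.cross := by
  refine ⟨fun h => ?_, fun h => mem_insertAt.2 (Or.inl ⟨r, c, h, rfl, rfl⟩)⟩
  rcases mem_insertAt.1 h with ⟨a, b, h1, h2, h3⟩ | ⟨a, b, h1, h2, h3⟩ | h1 | h1
  · rwa [← shift_injective _ _ h2, ← shift_injective _ _ h3]
  · have := hQ _ _ h1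
    obtain ⟨rfl, rfl⟩ : a = 0 ∧ b = 0 := by
      unfold shift at h2 h3
      split_ifs at h2 h3 <;> omega
    exact absurd h1 hQ0
  · unfold shift at h1
    split_ifs at h1 <;> omega
  · unfold shift at h1
    split_ifs at h1 <;> omega

lemma mem_insertAt_new (hP : P.Triangular) {γ : ℕ} (hγ : γ ≤ P.size) {a b : ℕ} :
    (P.size - γ + a, γ + b) ∈ (P.insertAt γ Q).cross ↔ (a, b) ∈ Q.cross := by
  refine ⟨fun h => ?_, fun h => mem_insertAt.2 (Or.inr (Or.inl ⟨a, b, h, rfl, rfl⟩))⟩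
  rcases mem_insertAt.1 h with ⟨r, c, h1, h2, h3⟩ | ⟨a', b', h1, h2, h3⟩ | h1 | h1
  · have := hP _ _ h1
    unfold shift at h2 h3
    split_ifs at h2 h3 <;> omega
  · obtain rfl : a' = a := by omega
    obtain rfl : b' = b := by omega
    exact h1
  · omega
  · omega

/-- If a segment of a row of `R` is a copy of a segment of a row of `F`, and the pipes entering it
correspond to each other by `τ`, then so do the pipes inside it and the pipes leaving it. -/
lemma segment_labels {R F : Filling} {r r' c c' len : ℕ} {τ : ℕ → ℕ}
    (hc : ∀ x < len, (r, c + x) ∈ R.cross ↔ (r', c' + x) ∈ F.cross)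
    (hs : ∀ x < len, R.south r (c + x) = τ (F.south r' (c' + x)))
    (hw : R.west r c = τ (F.west r' c')) :
    (∀ x ≤ len, R.west r (c + x) = τ (F.west r' (c' + x))) ∧
      ∀ x < len, R.north r (c + x) = τ (F.north r' (c' + x)) := by
  have hW : ∀ x ≤ len, R.west r (c + x) = τ (F.west r' (c' + x)) := by
    intro x
    induction x with
    | zero => exact fun _ => hw
    | succ x ih =>
      intro hx
      rw [← add_assoc, ← add_assoc, west_succ, west_succ, ih (by omega), hs x (by omega)]
      simp only [hc x (by omega)]
      split_ifs <;> rfl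
  refine ⟨hW, fun x hx => ?_⟩
  rw [north, north, hW x hx.le, hs x hx]
  simp only [hc x hx]
  split_ifs <;> rfl

/-- A pipe runs straight through a row of crosses. -/
lemma west_of_crosses {R : Filling} {r c len : ℕ} (hc : ∀ x < len, (r, c + x) ∈ R.cross) :
    ∀ x ≤ len, R.west r (c + x) = R.west r c := by
  intro x
  induction x with
  | zero => exact fun _ => rfl
  | succ x ih =>
    intro hx
    rw [← add_assoc, west_succ_of_cross (hc x (by omega)), ih (by omega)]

section labels

variable (hP : P.IsPipeDream) (hQ : Q.IsPipeDream) {γ : ℕ} (hγ : γ ≤ P.size)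
include hP hQ hγ

/-- Below the inserted rows, an insertion looks like `P`, with the labels shifted. -/
lemma insertAt_labels_below (d : ℕ) : ∀ r, P.size - γ < r → r + d = P.size →
    (∀ c < d, (P.insertAt γ Q).south (r + Q.size) c = P.south r c + Q.size) ∧
    (∀ c ≤ d, (P.insertAt γ Q).west (r + Q.size) c = P.west r c + Q.size ∧
      (P.insertAt γ Q).north (r + Q.size) c = P.north r c + Q.size) := by
  have hR := hP.triangular'.insertAt hγ hQ.triangular'
  induction d with
  | zero =>
    intro r h1 h2
    refine ⟨by simp, fun c hc => ?_⟩
    obtain rfl : c = 0 := by omega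
    rw [hR.north_diag (by rw [insertAt_size]; omega), hP.triangular'.north_diag (by omega)]
    simp
  | succ d ih =>
    intro r h1 h2
    have hS : ∀ c < d + 1, (P.insertAt γ Q).south (r + Q.size) c = P.south r c + Q.size := by
      intro c hc
      rw [south_of_lt (by rw [insertAt_size]; omega), south_of_lt (by omega), add_right_comm]
      exact ((ih (r + 1) (by omega) (by omega)).2 c (by omega)).2
    have hseg := segment_labels (R := P.insertAt γ Q) (F := P) (r := r + Q.size) (r' := r)
      (c := 0) (c' := 0) (len := d + 1) (τ := fun a => a + Q.size)
      (fun x hx => by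
        have := mem_insertAt_old (P := P) hQ.triangular' hQ.corner (γ := γ) (r := r) (c := x)
        rwa [shift_of_lt h1, shift_of_le (by omega), ← zero_add x] at this)
      (fun x hx => by simpa using hS x hx) (by simp)
    simp only [zero_add] at hseg
    refine ⟨hS, fun c hc => ⟨hseg.1 c hc, ?_⟩⟩
    rcases hc.lt_or_eq with h | h
    · exact hseg.2 c h
    · rw [hR.north_diag (by rw [insertAt_size]; omega), hP.triangular'.north_diag (by omega)]
      exact hseg.1 c hc

/-- In the inserted rows, the pipes of `Q` run straight through the crosses on the left and then as
in `Q`, while the pipes of `P` from below run straight upwards through these crosses. -/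
lemma insertAt_south_middle (e : ℕ) : ∀ a, a + e = Q.size →
    (∀ c < γ, (P.insertAt γ Q).south (P.size - γ + a) c = P.south (P.size - γ) c + Q.size) ∧
    (∀ b < e, (P.insertAt γ Q).south (P.size - γ + a) (γ + b) = Q.south a b + (P.size - γ)) ∧
    (0 < a → (∀ c ≤ γ, (P.insertAt γ Q).west (P.size - γ + a) c = P.size - γ + a) ∧
      ∀ b ≤ e, (P.insertAt γ Q).west (P.size - γ + a) (γ + b) = Q.west a b + (P.size - γ) ∧
        (P.insertAt γ Q).north (P.size - γ + a) (γ + b) = Q.north a b + (P.size - γ)) := by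
  have hR := hP.triangular'.insertAt hγ hQ.triangular'
  have row : ∀ a, 0 < a → ∀ e, a + e = Q.size →
      (∀ b < e, (P.insertAt γ Q).south (P.size - γ + a) (γ + b) = Q.south a b + (P.size - γ)) →
      (∀ c ≤ γ, (P.insertAt γ Q).west (P.size - γ + a) c = P.size - γ + a) ∧
      ∀ b ≤ e, (P.insertAt γ Q).west (P.size - γ + a) (γ + b) = Q.west a b + (P.size - γ) ∧
        (P.insertAt γ Q).north (P.size - γ + a) (γ + b) = Q.north a b + (P.size - γ) := by
    intro a ha e h hS
    have hW : ∀ c ≤ γ, (P.insertAt γ Q).west (P.size - γ + a) c = P.size - γ + a := by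
      intro c hc
      have := west_of_crosses (R := P.insertAt γ Q) (r := P.size - γ + a) (c := 0) (len := γ)
        (fun x hx => mem_insertAt.2 (Or.inr (Or.inr (Or.inr ⟨by omega, by omega, by omega⟩)))) c hc
      simpa using this
    have hseg := segment_labels (R := P.insertAt γ Q) (F := Q) (r := P.size - γ + a) (r' := a)
      (c := γ) (c' := 0) (len := e) (τ := fun l => l + (P.size - γ))
      (fun x hx => by rw [mem_insertAt_new hP.triangular' hγ, zero_add])
      (fun x hx => by rw [zero_add]; exact hS x hx) (by rw [hW γ le_rfl, west_zero, add_comm])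
    simp only [zero_add] at hseg
    refine ⟨hW, fun b hb => ⟨hseg.1 b hb, ?_⟩⟩
    rcases hb.lt_or_eq with h' | h'
    · exact hseg.2 b h'
    · rw [hR.north_diag (by rw [insertAt_size]; omega), hQ.triangular'.north_diag (by omega)]
      exact hseg.1 b hb
  induction e with
  | zero =>
    intro a h
    have h2 : ∀ b < 0, (P.insertAt γ Q).south (P.size - γ + a) (γ + b) =
      Q.south a b + (P.size - γ) := by simp
    refine ⟨fun c hc => ?_, h2, fun ha => row a ha 0 h h2⟩
    have h3 := ((insertAt_labels_below hP hQ hγ (γ - 1) (P.size - γ + 1) (by omega) (by omega)).2 c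
      (by omega)).2
    rw [south_of_lt (by rw [insertAt_size]; omega), south_of_lt (by omega), ← h3]
    congr 1
    omega
  | succ e ih =>
    intro a h
    obtain ⟨h1, h2, h3⟩ := ih (a + 1) (by omega)
    obtain ⟨h4, h5⟩ := h3 (by omega)
    have hS : ∀ b < e + 1, (P.insertAt γ Q).south (P.size - γ + a) (γ + b) =
        Q.south a b + (P.size - γ) := by
      intro b hb
      rw [south_of_lt (by rw [insertAt_size]; omega), south_of_lt (by omega)]
      exact (h5 b (by omega)).2
    refine ⟨fun c hc => ?_, hS, fun ha => row a ha (e + 1) h hS⟩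
    rw [south_of_lt (by rw [insertAt_size]; omega), ← h1 c hc]
    exact north_of_cross
      (mem_insertAt.2 (Or.inr (Or.inr (Or.inr ⟨by omega, by omega, by omega⟩))))

/-- The top row of the inserted copy of `Q`, which is a row of `P` up to the column `γ` and a row
of `Q` after it. -/
lemma insertAt_labels_row :
    (∀ c ≤ γ, (P.insertAt γ Q).west (P.size - γ) c =
        shift (P.size - γ) Q.size (P.west (P.size - γ) c) ∧
      (P.insertAt γ Q).north (P.size - γ) c =
        shift (P.size - γ) Q.size (P.north (P.size - γ) c)) ∧
    (∀ b, 0 < b → b ≤ Q.size →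
      (P.insertAt γ Q).west (P.size - γ) (γ + b) = Q.west 0 b + (P.size - γ) ∧
      (P.insertAt γ Q).north (P.size - γ) (γ + b) = Q.perm b + (P.size - γ)) := by
  have hR := hP.triangular'.insertAt hγ hQ.triangular'
  obtain ⟨h1, h2, -⟩ := insertAt_south_middle hP hQ hγ Q.size 0 (by omega)
  rw [add_zero] at h1 h2
  have helbow : (P.size - γ, γ) ∉ (P.insertAt γ Q).cross := by
    have := mem_insertAt_new (Q := Q) hP.triangular' hγ (a := 0) (b := 0)
    rw [add_zero, add_zero] at this
    exact this.not.2 hQ.corner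
  have helbow' : (P.size - γ, γ) ∉ P.cross := fun h => by
    have := hP.triangular' _ _ h; omega
  have hseg := segment_labels (R := P.insertAt γ Q) (F := P) (r := P.size - γ) (r' := P.size - γ)
      (c := 0) (c' := 0) (len := γ) (τ := shift (P.size - γ) Q.size)
      (fun x hx => by
        have := mem_insertAt_old (P := P) hQ.triangular' hQ.corner (γ := γ) (r := P.size - γ)
          (c := x)
        rwa [shift_of_le le_rfl, shift_of_le (by omega), ← zero_add x] at this)
      (fun x hx => by
        rw [zero_add, h1 x hx, shift_of_lt hP.triangular'.lt_south])
      (by rw [west_zero, west_zero, shift_of_le le_rfl])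
  simp only [zero_add] at hseg
  have hseg' : 0 < Q.size → _ := fun hn =>
    segment_labels (R := P.insertAt γ Q) (F := Q) (r := P.size - γ) (r' := 0)
      (c := γ + 1) (c' := 1) (len := Q.size - 1) (τ := fun l => l + (P.size - γ))
      (fun x hx => by
        have := mem_insertAt_new (Q := Q) hP.triangular' hγ (a := 0) (b := 1 + x)
        rwa [add_zero, ← add_assoc] at this)
      (fun x hx => by rw [add_assoc]; exact h2 (1 + x) (by omega))
      (by rw [west_succ_of_elbow helbow, west_succ_of_elbow hQ.corner]; exact h2 0 hn)
  refine ⟨fun c hc => ⟨hseg.1 c hc, ?_⟩, fun b hb hb' => ?_⟩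
  · rcases hc.lt_or_eq with h | rfl
    · exact hseg.2 c h
    · rw [north_of_elbow helbow, north_of_elbow helbow', hseg.1 c le_rfl]
  · have hs := hseg' (by omega)
    have h3 := hs.1 (b - 1) (by omega)
    rw [add_assoc, show 1 + (b - 1) = b by omega] at h3
    refine ⟨h3, ?_⟩
    rcases hb'.lt_or_eq with h | rfl
    · have h4 := hs.2 (b - 1) (by omega)
      rwa [add_assoc, show 1 + (b - 1) = b by omega] at h4
    · rw [hR.north_diag (by rw [insertAt_size]; omega), perm_eq_north,
        hQ.triangular'.north_diag (by omega)]
      exact h3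

/-- Above the inserted rows, the pipes leaving `Q` run straight upwards through the inserted
columns, and the rest looks like `P`. -/
lemma insertAt_labels_above (d : ℕ) : ∀ r, r + d + 1 = P.size - γ →
    ((∀ c ≤ γ, (P.insertAt γ Q).south r c = shift (P.size - γ) Q.size (P.south r c)) ∧
      (∀ b, 0 < b → b ≤ Q.size →
        (P.insertAt γ Q).south r (γ + b) = Q.perm b + (P.size - γ)) ∧
      (∀ c, γ < c → r + c < P.size →
        (P.insertAt γ Q).south r (c + Q.size) = shift (P.size - γ) Q.size (P.south r c))) ∧
    (∀ c ≤ γ, (P.insertAt γ Q).west r c = shift (P.size - γ) Q.size (P.west r c) ∧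
      (P.insertAt γ Q).north r c = shift (P.size - γ) Q.size (P.north r c)) ∧
    (∀ b, 0 < b → b ≤ Q.size →
      (P.insertAt γ Q).west r (γ + b) = shift (P.size - γ) Q.size (P.west r (γ + 1)) ∧
      (P.insertAt γ Q).north r (γ + b) = Q.perm b + (P.size - γ)) ∧
    (∀ c, γ < c → r + c ≤ P.size →
      (P.insertAt γ Q).west r (c + Q.size) = shift (P.size - γ) Q.size (P.west r c) ∧
      (P.insertAt γ Q).north r (c + Q.size) = shift (P.size - γ) Q.size (P.north r c)) := by
  have hR := hP.triangular'.insertAt hγ hQ.triangular'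
  have row : ∀ r, r < P.size - γ →
    ((∀ c ≤ γ, (P.insertAt γ Q).south r c = shift (P.size - γ) Q.size (P.south r c)) ∧
      (∀ b, 0 < b → b ≤ Q.size →
        (P.insertAt γ Q).south r (γ + b) = Q.perm b + (P.size - γ)) ∧
      (∀ c, γ < c → r + c < P.size →
        (P.insertAt γ Q).south r (c + Q.size) = shift (P.size - γ) Q.size (P.south r c))) →
    (∀ c ≤ γ, (P.insertAt γ Q).west r c = shift (P.size - γ) Q.size (P.west r c) ∧
      (P.insertAt γ Q).north r c = shift (P.size - γ) Q.size (P.north r c)) ∧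
    (∀ b, 0 < b → b ≤ Q.size →
      (P.insertAt γ Q).west r (γ + b) = shift (P.size - γ) Q.size (P.west r (γ + 1)) ∧
      (P.insertAt γ Q).north r (γ + b) = Q.perm b + (P.size - γ)) ∧
    (∀ c, γ < c → r + c ≤ P.size →
      (P.insertAt γ Q).west r (c + Q.size) = shift (P.size - γ) Q.size (P.west r c) ∧
      (P.insertAt γ Q).north r (c + Q.size) = shift (P.size - γ) Q.size (P.north r c)) := by
    rintro r hr ⟨h1, h2, h3⟩
    have hseg := segment_labels (R := P.insertAt γ Q) (F := P) (r := r) (r' := r)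
      (c := 0) (c' := 0) (len := γ + 1) (τ := shift (P.size - γ) Q.size)
      (fun x hx => by
        have := mem_insertAt_old (P := P) hQ.triangular' hQ.corner (γ := γ) (r := r) (c := x)
        rwa [shift_of_le hr.le, shift_of_le (by omega), ← zero_add x] at this)
      (fun x hx => by rw [zero_add, h1 x (by omega)])
      (by rw [west_zero, west_zero, shift_of_le hr.le])
    simp only [zero_add] at hseg
    have hcross : ∀ x < Q.size, (r, γ + 1 + x) ∈ (P.insertAt γ Q).cross := fun x hx =>
      mem_insertAt.2 (Or.inr (Or.inr (Or.inl ⟨by omega, by omega, by omega⟩)))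
    have hmid := west_of_crosses hcross
    rw [hseg.1 (γ + 1) le_rfl] at hmid
    have hseg' := segment_labels (R := P.insertAt γ Q) (F := P) (r := r) (r' := r)
      (c := γ + 1 + Q.size) (c' := γ + 1) (len := P.size - γ - 1 - r)
      (τ := shift (P.size - γ) Q.size)
      (fun x hx => by
        have := mem_insertAt_old (P := P) hQ.triangular' hQ.corner (γ := γ) (r := r)
          (c := γ + 1 + x)
        rwa [shift_of_le hr.le, shift_of_lt (by omega), add_right_comm] at this)
      (fun x hx => by rw [add_right_comm]; exact h3 _ (by omega) (by omega))
      (hmid Q.size le_rfl)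
    refine ⟨fun c hc => ⟨hseg.1 c (by omega), hseg.2 c (by omega)⟩, fun b hb hb' => ?_,
      fun c hc hc' => ?_⟩
    · have h4 := hmid (b - 1) (by omega)
      have h5 := hcross (b - 1) (by omega)
      rw [add_assoc, show 1 + (b - 1) = b by omega] at h4 h5
      exact ⟨h4, by rw [north_of_cross h5, h2 b hb hb']⟩
    · have h4 := hseg'.1 (c - γ - 1) (by omega)
      rw [show γ + 1 + Q.size + (c - γ - 1) = c + Q.size by omega,
        show γ + 1 + (c - γ - 1) = c by omega] at h4
      refine ⟨h4, ?_⟩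
      rcases hc'.lt_or_eq with h | h
      · have h5 := hseg'.2 (c - γ - 1) (by omega)
        rwa [show γ + 1 + Q.size + (c - γ - 1) = c + Q.size by omega,
          show γ + 1 + (c - γ - 1) = c by omega] at h5
      · rw [hR.north_diag (by rw [insertAt_size]; omega), hP.triangular'.north_diag h, h4]
  induction d with
  | zero =>
    intro r h
    obtain ⟨h1, h2⟩ := insertAt_labels_row hP hQ hγ
    have hS : (∀ c ≤ γ, (P.insertAt γ Q).south r c = shift (P.size - γ) Q.size (P.south r c)) ∧
      (∀ b, 0 < b → b ≤ Q.size →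
        (P.insertAt γ Q).south r (γ + b) = Q.perm b + (P.size - γ)) ∧
      (∀ c, γ < c → r + c < P.size →
        (P.insertAt γ Q).south r (c + Q.size) = shift (P.size - γ) Q.size (P.south r c)) := by
      rw [add_zero] at h
      refine ⟨fun c hc => ?_, fun b hb hb' => ?_, fun c hc hc' => by omega⟩
      · rw [south_of_lt (by rw [insertAt_size]; omega), south_of_lt (by omega), h]
        exact (h1 c hc).2
      · rw [south_of_lt (by rw [insertAt_size]; omega), h]
        exact (h2 b hb hb').2
    exact ⟨hS, row r (by omega) hS⟩
  | succ d ih =>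
    intro r h
    obtain ⟨-, h1, h2, h3⟩ := ih (r + 1) (by omega)
    have hS : (∀ c ≤ γ, (P.insertAt γ Q).south r c = shift (P.size - γ) Q.size (P.south r c)) ∧
      (∀ b, 0 < b → b ≤ Q.size →
        (P.insertAt γ Q).south r (γ + b) = Q.perm b + (P.size - γ)) ∧
      (∀ c, γ < c → r + c < P.size →
        (P.insertAt γ Q).south r (c + Q.size) = shift (P.size - γ) Q.size (P.south r c)) := by
      refine ⟨fun c hc => ?_, fun b hb hb' => ?_, fun c hc hc' => ?_⟩
      · rw [south_of_lt (by rw [insertAt_size]; omega), south_of_lt (by omega)]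
        exact (h1 c hc).2
      · rw [south_of_lt (by rw [insertAt_size]; omega)]
        exact (h2 b hb hb').2
      · rw [south_of_lt (by rw [insertAt_size]; omega), south_of_lt (by omega)]
        exact (h3 c hc (by omega)).2
    exact ⟨hS, row r (by omega) hS⟩

end labels

/-! ### Insertion: crosses and descents -/

lemma IsPipeDream.le_of_mem_crossings (hF : F.IsPipeDream) {r a b : ℕ}
    (h : (r, a, b) ∈ F.crossings) : r ≤ a ∧ 0 < a ∧ a < b ∧ b ≤ F.size := by
  obtain ⟨j, hc, rfl, rfl⟩ := mem_crossings.1 h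
  have := hF.triangular' _ _ hc
  exact ⟨(hF.triangular'.le_west_le this.le).1, hF.west_pos hc, hF.ascending _ _ hc,
    (hF.triangular'.lt_south_le this).2⟩

/-- The pipes that cross the vertical line after column `γ` exit to the right of it, so that they
bear labels `≤ size - γ`. -/
lemma IsGlobalDescent.west_le {γ : ℕ} (h : F.IsGlobalDescent γ) (hF : F.IsPipeDream) {r : ℕ}
    (hr : r < F.size - γ) : 0 < F.west r (γ + 1) ∧ F.west r (γ + 1) ≤ F.size - γ := by
  have hT := hF.triangular'
  rw [← hT.perm_transpose_south (by omega)]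
  have h1 := hT.transpose.lt_south_le (i := γ) (j := r) (by rw [transpose_size]; omega)
  rw [transpose_size] at h1
  exact ⟨hF.perm_pos (by omega) h1.2, h.perm_le hT h1.1 h1.2⟩

lemma IsPipeDream.exists_perm (hQ : Q.IsPipeDream) {x : ℕ} (hx : 0 < x) (hx' : x ≤ Q.size) :
    ∃ b, 0 < b ∧ b ≤ Q.size ∧ Q.perm b = x :=
  ⟨Q.transpose.perm x, hQ.transpose.perm_pos hx hx', hQ.transpose.triangular'.perm_le hx',
    hQ.triangular'.perm_perm_transpose hx'⟩

section

variable (hP : P.IsPipeDream) (hQ : Q.IsPipeDream) {γ : ℕ}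
include hP hQ

/-- `shift` translates the labels, rows and columns of the crosses of `P` to those of the
insertion. -/
lemma insertAt_labels_old (hγ : γ ≤ P.size) {r c : ℕ} (h : (r, c) ∈ P.cross) :
    (P.insertAt γ Q).west (shift (P.size - γ) Q.size r) (shift γ Q.size c) =
        shift (P.size - γ) Q.size (P.west r c) ∧
      (P.insertAt γ Q).south (shift (P.size - γ) Q.size r) (shift γ Q.size c) =
        shift (P.size - γ) Q.size (P.south r c) := by
  have hlt := hP.triangular' _ _ h
  rcases lt_trichotomy r (P.size - γ) with hr | rfl | hr
  · obtain ⟨⟨h1, -, h2⟩, h3, -, h4⟩ :=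
      insertAt_labels_above hP hQ hγ (P.size - γ - r - 1) r (by omega)
    rw [shift_of_le hr.le]
    rcases le_or_gt c γ with hc | hc
    · rw [shift_of_le hc]
      exact ⟨(h3 c hc).1, h1 c hc⟩
    · rw [shift_of_lt hc]
      exact ⟨(h4 c hc hlt.le).1, h2 c hc hlt⟩
  · rw [shift_of_le le_rfl, shift_of_le (show c ≤ γ by omega),
      shift_of_lt hP.triangular'.lt_south]
    exact ⟨((insertAt_labels_row hP hQ hγ).1 c (by omega)).1,
      (insertAt_south_middle hP hQ hγ Q.size 0 (by omega)).1 c (by omega)⟩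
  · obtain ⟨h1, h2⟩ := insertAt_labels_below hP hQ hγ (P.size - r) r hr (by omega)
    have := hP.triangular'.le_west_le hlt.le
    rw [shift_of_lt hr, shift_of_le (show c ≤ γ by omega),
      shift_of_lt (hr.trans hP.triangular'.lt_south), shift_of_lt (by omega)]
    exact ⟨(h2 c (by omega)).1, h1 c (by omega)⟩

lemma insertAt_labels_new (hγ : γ ≤ P.size) {a b : ℕ} (h : (a, b) ∈ Q.cross) :
    (P.insertAt γ Q).west (P.size - γ + a) (γ + b) = Q.west a b + (P.size - γ) ∧
      (P.insertAt γ Q).south (P.size - γ + a) (γ + b) = Q.south a b + (P.size - γ) := by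
  have hlt := hQ.triangular' _ _ h
  obtain ⟨-, h1, h2⟩ := insertAt_south_middle hP hQ hγ (Q.size - a) a (by omega)
  refine ⟨?_, h1 b (by omega)⟩
  rcases Nat.eq_zero_or_pos a with rfl | ha
  · have hb : 0 < b := Nat.pos_of_ne_zero fun hb => hQ.corner (hb ▸ h)
    exact ((insertAt_labels_row hP hQ hγ).2 b hb (by omega)).1
  · exact ((h2 ha).2 b (by omega)).1

/-- The labelled crosses of an insertion: those of `P` and of `Q`, and those of the pipes of `Q`
with the pipes of `P` entering above, respectively below, the inserted rows. -/
lemma mem_crossings_insertAt (hγ : γ ≤ P.size) {r a b : ℕ} :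
    (r, a, b) ∈ (P.insertAt γ Q).crossings ↔
      (∃ r₀ a₀ b₀, (r₀, a₀, b₀) ∈ P.crossings ∧ shift (P.size - γ) Q.size r₀ = r ∧
        shift (P.size - γ) Q.size a₀ = a ∧ shift (P.size - γ) Q.size b₀ = b) ∨
      (∃ r₀ a₀ b₀, (r₀, a₀, b₀) ∈ Q.crossings ∧ r₀ + (P.size - γ) = r ∧
        a₀ + (P.size - γ) = a ∧ b₀ + (P.size - γ) = b) ∨
      (∃ x, 0 < x ∧ x ≤ Q.size ∧ r < P.size - γ ∧
        shift (P.size - γ) Q.size (P.west r (γ + 1)) = a ∧ x + (P.size - γ) = b) ∨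
      (∃ y b₀, 0 < y ∧ y ≤ Q.size ∧ P.size - γ + y = r ∧ P.size - γ + y = a ∧
        P.size - γ < b₀ ∧ b₀ ≤ P.size ∧ b₀ + Q.size = b) := by
  rw [mem_crossings]
  constructor
  · rintro ⟨j, hc, rfl, rfl⟩
    rcases mem_insertAt.1 hc with ⟨r₀, c₀, h, rfl, rfl⟩ | ⟨a₀, b₀, h, rfl, rfl⟩ | h | h
    · obtain ⟨h1, h2⟩ := insertAt_labels_old hP hQ hγ h
      exact Or.inl ⟨r₀, _, _, ⟨c₀, h, rfl, rfl⟩, rfl, h1.symm, h2.symm⟩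
    · obtain ⟨h1, h2⟩ := insertAt_labels_new hP hQ hγ h
      exact Or.inr (Or.inl ⟨a₀, _, _, ⟨b₀, h, rfl, rfl⟩, add_comm _ _, h1.symm, h2.symm⟩)
    · obtain ⟨⟨-, h1, -⟩, -, h2, -⟩ :=
        insertAt_labels_above hP hQ hγ (P.size - γ - r - 1) r (by omega)
      have h3 := h1 (j - γ) (by omega) (by omega)
      have h4 := h2 (j - γ) (by omega) (by omega)
      rw [Nat.add_sub_cancel' h.2.1.le] at h3 h4
      exact Or.inr (Or.inr (Or.inl ⟨Q.perm (j - γ), hQ.perm_pos (by omega) (by omega),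
        hQ.triangular'.perm_le (by omega), h.1, h4.1.symm, h3.symm⟩))
    · obtain ⟨h1, -, h2⟩ := insertAt_south_middle hP hQ hγ (Q.size - (r - (P.size - γ)))
        (r - (P.size - γ)) (by omega)
      rw [Nat.add_sub_cancel' h.1.le] at h1 h2
      exact Or.inr (Or.inr (Or.inr ⟨r - (P.size - γ), P.south (P.size - γ) j, by omega, by omega,
        by omega, by rw [(h2 (by omega)).1 j (by omega)]; omega, hP.triangular'.lt_south,
        (hP.triangular'.lt_south_le (by omega)).2, (h1 j h.2.2).symm⟩))
  · rintro (⟨r₀, a₀, b₀, h₀, rfl, rfl, rfl⟩ | ⟨r₀, a₀, b₀, h₀, rfl, rfl, rfl⟩ |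
      ⟨x, hx, hx', hr, rfl, rfl⟩ | ⟨y, b₀, hy, hy', rfl, rfl, hb, hb', rfl⟩)
    · obtain ⟨j, h, rfl, rfl⟩ := mem_crossings.1 h₀
      exact ⟨_, (mem_insertAt_old hQ.triangular' hQ.corner).2 h, insertAt_labels_old hP hQ hγ h⟩
    · obtain ⟨j, h, rfl, rfl⟩ := mem_crossings.1 h₀
      refine ⟨γ + j, ?_, ?_⟩
      · rw [add_comm]; exact (mem_insertAt_new hP.triangular' hγ).2 h
      · rw [add_comm r₀]; exact insertAt_labels_new hP hQ hγ h
    · obtain ⟨b, hb, hb', rfl⟩ := hQ.exists_perm hx hx'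
      obtain ⟨⟨-, h1, -⟩, -, h2, -⟩ :=
        insertAt_labels_above hP hQ hγ (P.size - γ - r - 1) r (by omega)
      exact ⟨γ + b, mem_insertAt.2 (Or.inr (Or.inr (Or.inl ⟨hr, by omega, by omega⟩))),
        (h2 b hb hb').1, h1 b hb hb'⟩
    · obtain ⟨j, hj, rfl⟩ := hP.triangular'.exists_south hb hb'
      obtain ⟨h1, -, h2⟩ := insertAt_south_middle hP hQ hγ (Q.size - y) y (by omega)
      exact ⟨j, mem_insertAt.2 (Or.inr (Or.inr (Or.inr ⟨by omega, by omega, by omega⟩))),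
        (h2 hy).1 j (by omega), h1 j (by omega)⟩

/-- In the inserted columns the horizontal pipes have labels `≤ P.size - γ`, as `γ` is a global
descent, while the vertical pipes come from `Q` and have larger labels. -/
lemma IsPipeDream.insertAt (h : P.IsGlobalDescent γ) : (P.insertAt γ Q).IsPipeDream := by
  have hγ := h.le
  refine isPipeDream_iff.2 ⟨hP.triangular'.insertAt hγ hQ.triangular', fun h0 => ?_, ?_⟩
  · rcases mem_insertAt.1 h0 with ⟨a, b, h1, h2, h3⟩ | ⟨a, b, h1, h2, h3⟩ | h1 | h1
    · obtain ⟨rfl, rfl⟩ : a = 0 ∧ b = 0 := by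
        unfold shift at h2 h3
        split_ifs at h2 h3 <;> omega
      exact hP.corner h1
    · obtain ⟨rfl, rfl⟩ : a = 0 ∧ b = 0 := by omega
      exact hQ.corner h1
    · omega
    · omega
  · intro r c hc
    rcases (mem_crossings_insertAt hP hQ hγ).1 (mem_crossings.2 ⟨c, hc, rfl, rfl⟩) with
      ⟨r₀, a₀, b₀, h1, -, h2, h3⟩ | ⟨r₀, a₀, b₀, h1, -, h2, h3⟩ | ⟨x, hx, hx', hr, h2, h3⟩ |
      ⟨y, b₀, hy, hy', h1, h2, hb, hb', h3⟩ <;> rw [← h2, ← h3]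
    · have := hP.le_of_mem_crossings h1
      unfold shift
      split_ifs <;> omega
    · have := hQ.le_of_mem_crossings h1
      omega
    · have := h.west_le hP hr
      rw [shift_of_le this.2]
      omega
    · omega

lemma perm_insertAt (hγ : γ ≤ P.size) :
    (∀ j ≤ γ, (P.insertAt γ Q).perm j = shift (P.size - γ) Q.size (P.perm j)) ∧
    (∀ b, 0 < b → b ≤ Q.size → (P.insertAt γ Q).perm (γ + b) = Q.perm b + (P.size - γ)) ∧
    (∀ j, γ < j → j ≤ P.size →
      (P.insertAt γ Q).perm (j + Q.size) = shift (P.size - γ) Q.size (P.perm j)) := by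
  rcases Nat.eq_zero_or_pos (P.size - γ) with h | h
  · obtain ⟨h1, h2⟩ := insertAt_labels_row hP hQ hγ
    refine ⟨fun j hj => ?_, fun b hb hb' => ?_, fun j hj hj' => by omega⟩
    · have := (h1 j hj).2
      rwa [h] at this ⊢
    · have := (h2 b hb hb').2
      rwa [h] at this ⊢
  · obtain ⟨-, h1, h2, h3⟩ := insertAt_labels_above hP hQ hγ (P.size - γ - 1) 0 (by omega)
    exact ⟨fun j hj => (h1 j hj).2, fun b hb hb' => (h2 b hb hb').2,
      fun j hj hj' => (h3 j hj (by omega)).2⟩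

lemma IsGlobalDescent.insertAt_iff_left (h : P.IsGlobalDescent γ) {δ : ℕ} (hδ : δ ≤ γ) :
    (P.insertAt γ Q).IsGlobalDescent δ ↔ P.IsGlobalDescent δ := by
  have hγ := h.le
  rw [isGlobalDescent_iff hP.triangular', isGlobalDescent_iff (hP.insertAt hQ h).triangular',
    insertAt_size]
  refine and_congr (by omega) (forall_congr' fun j => forall_congr' fun h1 =>
    forall_congr' fun h2 => ?_)
  have := h.lt_perm hP.triangular' h1 (h2.trans hδ)
  rw [(perm_insertAt hP hQ hγ).1 j (h2.trans hδ), shift_of_lt this]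
  omega

lemma IsGlobalDescent.insertAt_iff_mid (h : P.IsGlobalDescent γ) {d : ℕ} (hd : d ≤ Q.size) :
    (P.insertAt γ Q).IsGlobalDescent (γ + d) ↔ Q.IsGlobalDescent d := by
  have hγ := h.le
  obtain ⟨h1, h2, -⟩ := perm_insertAt hP hQ hγ
  rw [isGlobalDescent_iff hQ.triangular', isGlobalDescent_iff (hP.insertAt hQ h).triangular',
    insertAt_size]
  refine and_congr (by omega) ⟨fun h3 j hj hj' => ?_, fun h3 j hj hj' => ?_⟩
  · have := h3 (γ + j) (by omega) (by omega)
    rw [h2 j hj (by omega)] at this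
    omega
  · rcases le_or_gt j γ with h4 | h4
    · have := h.lt_perm hP.triangular' hj h4
      rw [h1 j h4, shift_of_lt this]
      omega
    · have h5 := h2 (j - γ) (by omega) (by omega)
      have := h3 (j - γ) (by omega) (by omega)
      rw [Nat.add_sub_cancel' h4.le] at h5
      omega

lemma IsGlobalDescent.insertAt_iff_right (h : P.IsGlobalDescent γ) {δ : ℕ} (hδ : γ ≤ δ) :
    (P.insertAt γ Q).IsGlobalDescent (δ + Q.size) ↔ P.IsGlobalDescent δ := by
  have hγ := h.le
  obtain ⟨h1, h2, h2'⟩ := perm_insertAt hP hQ hγ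
  rw [isGlobalDescent_iff hP.triangular', isGlobalDescent_iff (hP.insertAt hQ h).triangular',
    insertAt_size]
  refine ⟨fun ⟨hm, h3⟩ => ⟨by omega, fun j hj hj' => ?_⟩,
    fun ⟨hm, h3⟩ => ⟨by omega, fun j hj hj' => ?_⟩⟩
  · rcases le_or_gt j γ with h4 | h4
    · have := h.lt_perm hP.triangular' hj h4
      omega
    · have := h3 (j + Q.size) (by omega) (by omega)
      rw [h2' j h4 (by omega), shift_of_le (h.perm_le hP.triangular' h4 (by omega))] at this
      omega
  · rcases le_or_gt j γ with h4 | h4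
    · have := h.lt_perm hP.triangular' hj h4
      rw [h1 j h4, shift_of_lt this]
      omega
    · rcases le_or_gt j (γ + Q.size) with h5 | h5
      · have h6 := h2 (j - γ) (by omega) (by omega)
        have := hQ.perm_pos (i := j - γ) (by omega) (by omega)
        rw [Nat.add_sub_cancel' h4.le] at h6
        omega
      · have h6 := h2' (j - Q.size) (by omega) (by omega)
        have := h3 (j - Q.size) (by omega) (by omega)
        rw [Nat.sub_add_cancel (by omega)] at h6
        rw [h6]
        unfold shift
        split_ifs <;> omega

end

/-! ### Insertion: packings -/

lemma transpose_insertAt {γ : ℕ} (hγ : γ ≤ P.size) :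
    (P.insertAt γ Q).transpose = P.transpose.insertAt (P.size - γ) Q.transpose := by
  refine Filling.ext rfl (Finset.ext fun ⟨r, c⟩ => ?_)
  rw [mem_transpose_cross, mem_insertAt, mem_insertAt, transpose_size, transpose_size,
    Nat.sub_sub_self hγ]
  refine or_congr ?_ (or_congr ?_ ?_)
  · constructor
    · rintro ⟨a, b, h, h1, h2⟩
      exact ⟨b, a, mem_transpose_cross.2 h, h2, h1⟩
    · rintro ⟨a, b, h, h1, h2⟩
      exact ⟨b, a, mem_transpose_cross.1 h, h2, h1⟩
  · constructor
    · rintro ⟨a, b, h, h1, h2⟩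
      exact ⟨b, a, mem_transpose_cross.2 h, h2, h1⟩
    · rintro ⟨a, b, h, h1, h2⟩
      exact ⟨b, a, mem_transpose_cross.1 h, h2, h1⟩
  · omega

/-- In a horizontal packing, the pipes of `P` that meet the inserted columns meet them in the same
rows. -/
lemma IsGlobalDescent.west_hpack {γ γ' : ℕ} (h : P.IsGlobalDescent γ) (h' : P.IsGlobalDescent γ')
    (hP : P.IsPipeDream) (hle : γ' ≤ γ) {r : ℕ} (hr : r < P.size - γ) :
    (P.hpack (P.size - γ')).west r (γ - γ' + 1) = P.west r (γ + 1) := by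
  have hw := h.west_le hP hr
  have hγ := h.le
  rw [← hP.hpack_west (k := P.size - γ') (by omega) (by omega) (by omega)]
  congr 1
  have h1 := northCount_add_west (F := P) (k := P.size - γ') (i := r) (by omega) (γ + 1)
  rw [if_pos (by omega)] at h1
  have h2 := rectangle_flux (F := P) (fun l => if l ≤ P.size - γ' then 1 else 0)
    (i := r) (j := γ) (by omega)
  have h3 := h'.northCount hP (j := γ + 1) (by omega) (by omega)
  have h4 : ∀ x ∈ Finset.range r, (if P.west x (γ + 1) ≤ P.size - γ' then 1 else 0) = 1 := by
    intro x hx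
    have := Finset.mem_range.1 hx
    have := h.west_le hP (r := x) (by omega)
    rw [if_pos (by omega)]
  have h5 : ∀ x ∈ Finset.range r, (if x ≤ P.size - γ' then 1 else 0) = 1 := by
    intro x hx
    have := Finset.mem_range.1 hx
    rw [if_pos (by omega)]
  rw [Finset.sum_congr rfl h4, Finset.sum_congr rfl h5] at h2
  have h6 : P.northCount (P.size - γ') 0 (γ + 1) = P.northCount (P.size - γ') r (γ + 1) := by
    rw [Filling.northCount, Filling.northCount, Finset.card_filter, Finset.card_filter]
    exact Nat.add_left_cancel h2
  omega

/-- Horizontal packing of an insertion at a gap to the left of the inserted piece (`k = Q.size`) or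
inside it (`γ' = γ`). -/
lemma IsGlobalDescent.hpack_insertAt (hP : P.IsPipeDream) (hQ : Q.IsPipeDream) {γ γ' k : ℕ}
    (h : P.IsGlobalDescent γ) (h' : P.IsGlobalDescent γ') (hle : γ' ≤ γ) (hk : k ≤ Q.size)
    (hor : k = Q.size ∨ γ' = γ) :
    (P.insertAt γ Q).hpack (P.size - γ' + k) =
      (P.hpack (P.size - γ')).insertAt (γ - γ') (Q.hpack k) := by
  have hγ := h.le
  have hPL := hP.hpack (k := P.size - γ') (by omega)
  have hQL := hQ.hpack hk
  have hg : (P.hpack (P.size - γ')).IsGlobalDescent (γ - γ') := by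
    rwa [h'.hpack_iff hP, Nat.add_sub_cancel' hle]
  have hsize : P.size - γ' + k ≤ (P.insertAt γ Q).size := by rw [insertAt_size]; omega
  refine ((hP.insertAt hQ h).hpack hsize).ext_crossings (hPL.insertAt hQL hg) rfl ?_
  ext ⟨r, a, b⟩
  rw [(hP.insertAt hQ h).mem_crossings_hpack hsize, mem_crossings_insertAt hP hQ hγ,
    mem_crossings_insertAt hPL hQL (by rw [hpack_size]; omega), hpack_size, hpack_size,
    show P.size - γ' - (γ - γ') = P.size - γ by omega]
  constructor
  · rintro ⟨⟨r₀, a₀, b₀, h1, h2, h3, h4⟩ | ⟨r₀, a₀, b₀, h1, h2, h3, h4⟩ |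
      ⟨x, hx, hx', hr, h3, h4⟩ | ⟨y, b₀, hy, hy', h1, h2, hb, hb', h4⟩, hb⟩
    · have h5 := hP.le_of_mem_crossings h1
      refine Or.inl ⟨r₀, a₀, b₀, (hP.mem_crossings_hpack (by omega)).2 ⟨h1, ?_⟩, ?_⟩
      · unfold shift at h4; split_ifs at h4 <;> omega
      · unfold shift at h2 h3 h4 ⊢; split_ifs at h2 h3 h4 ⊢ <;> omega
    · exact Or.inr (Or.inl ⟨r₀, a₀, b₀, (hQ.mem_crossings_hpack hk).2 ⟨h1, by
        have := hQ.le_of_mem_crossings h1; omega⟩, h2, h3, h4⟩)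
    · have h5 := h.west_le hP hr
      rw [shift_of_le h5.2] at h3
      refine Or.inr (Or.inr (Or.inl ⟨x, hx, by omega, hr, ?_, h4⟩))
      rw [h.west_hpack h' hP hle hr, shift_of_le h5.2, h3]
    · exact Or.inr (Or.inr (Or.inr ⟨y, b₀, hy, by omega, h1, h2, by omega, by omega, by omega⟩))
  · rintro (⟨r₀, a₀, b₀, h1, h2, h3, h4⟩ | ⟨r₀, a₀, b₀, h1, h2, h3, h4⟩ |
      ⟨x, hx, hx', hr, h3, h4⟩ | ⟨y, b₀, hy, hy', h1, h2, hb, hb', h4⟩)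
    · rw [hP.mem_crossings_hpack (by omega)] at h1
      have h5 := hP.le_of_mem_crossings h1.1
      refine ⟨Or.inl ⟨r₀, a₀, b₀, h1.1, ?_⟩, ?_⟩
      · unfold shift at h2 h3 h4 ⊢; split_ifs at h2 h3 h4 ⊢ <;> omega
      · unfold shift at h4; split_ifs at h4 <;> omega
    · rw [hQ.mem_crossings_hpack hk] at h1
      exact ⟨Or.inr (Or.inl ⟨r₀, a₀, b₀, h1.1, h2, h3, h4⟩), by omega⟩
    · have h5 := h.west_le hP hr
      rw [h.west_hpack h' hP hle hr, shift_of_le h5.2] at h3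
      refine ⟨Or.inr (Or.inr (Or.inl ⟨x, hx, by omega, hr, ?_, h4⟩)), by omega⟩
      rw [shift_of_le h5.2, h3]
    · exact ⟨Or.inr (Or.inr (Or.inr ⟨y, b₀, hy, by omega, h1, h2, by omega, by omega, by omega⟩)),
        by omega⟩

/-- A horizontal packing that removes all pipes of the inserted piece. -/
lemma IsGlobalDescent.hpack_insertAt_of_le (hP : P.IsPipeDream) (hQ : Q.IsPipeDream) {γ k : ℕ}
    (h : P.IsGlobalDescent γ) (hk : k ≤ P.size - γ) :
    (P.insertAt γ Q).hpack k = P.hpack k := by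
  have hγ := h.le
  have hsize : k ≤ (P.insertAt γ Q).size := by rw [insertAt_size]; omega
  refine ((hP.insertAt hQ h).hpack hsize).ext_crossings (hP.hpack (by omega)) rfl ?_
  ext ⟨r, a, b⟩
  rw [(hP.insertAt hQ h).mem_crossings_hpack hsize, mem_crossings_insertAt hP hQ hγ,
    hP.mem_crossings_hpack (by omega)]
  constructor
  · rintro ⟨⟨r₀, a₀, b₀, h1, h2, h3, h4⟩ | ⟨r₀, a₀, b₀, h1, h2, h3, h4⟩ |
      ⟨x, hx, hx', hr, h3, h4⟩ | ⟨y, b₀, hy, hy', h1, h2, hb, hb', h4⟩, hb⟩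
    · have h5 := hP.le_of_mem_crossings h1
      unfold shift at h2 h3 h4
      split_ifs at h2 h3 h4 <;> try omega
      subst h2 h3 h4
      exact ⟨h1, hb⟩
    · have := hQ.le_of_mem_crossings h1
      omega
    · omega
    · omega
  · rintro ⟨h1, h2⟩
    have h5 := hP.le_of_mem_crossings h1
    exact ⟨Or.inl ⟨r, a, b, h1, shift_of_le (by omega), shift_of_le (by omega),
      shift_of_le (by omega)⟩, h2⟩

lemma IsGlobalDescent.vpack_insertAt (hP : P.IsPipeDream) (hQ : Q.IsPipeDream) {γ γ' k : ℕ}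
    (h : P.IsGlobalDescent γ) (h' : P.IsGlobalDescent γ') (hle : γ ≤ γ') (hk : k ≤ Q.size)
    (hor : k = Q.size ∨ γ' = γ) :
    (P.insertAt γ Q).vpack (γ' + k) = (P.vpack γ').insertAt γ (Q.vpack k) := by
  have hγ := h'.le
  apply transpose_injective
  rw [transpose_vpack, transpose_insertAt h.le, transpose_insertAt (by rwa [vpack_size]),
    transpose_vpack, transpose_vpack, vpack_size]
  have := (h.transpose hP).hpack_insertAt hP.transpose hQ.transpose (h'.transpose hP)
    (by omega) hk (by rw [transpose_size]; omega)
  rwa [transpose_size, Nat.sub_sub_self hγ,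
    show P.size - γ - (P.size - γ') = γ' - γ by omega] at this

lemma IsGlobalDescent.vpack_insertAt_of_le (hP : P.IsPipeDream) (hQ : Q.IsPipeDream) {γ k : ℕ}
    (h : P.IsGlobalDescent γ) (hk : k ≤ γ) : (P.insertAt γ Q).vpack k = P.vpack k := by
  have hγ := h.le
  apply transpose_injective
  rw [transpose_vpack, transpose_insertAt hγ, transpose_vpack]
  exact (h.transpose hP).hpack_insertAt_of_le hP.transpose hQ.transpose
    (by rw [transpose_size]; omega)

/-! ### Insertion: associativity -/

lemma insertAt_of_size_eq_zero (hQ : Q.Triangular) (h : Q.size = 0) (γ : ℕ) :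
    P.insertAt γ Q = P := by
  have hshift : ∀ g a, shift g 0 a = a := fun g a => by unfold shift; split_ifs <;> rfl
  refine Filling.ext (by rw [insertAt_size, h, add_zero]) (Finset.ext fun ⟨r, c⟩ => ?_)
  rw [mem_insertAt, h]
  constructor
  · rintro (⟨a, b, h1, h2, h3⟩ | ⟨a, b, h1, h2, h3⟩ | h1 | h1)
    · rw [hshift] at h2 h3
      subst h2 h3
      exact h1
    · have := hQ _ _ h1; omega
    · omega
    · omega
  · exact fun h1 => Or.inl ⟨r, c, h1, hshift _ _, hshift _ _⟩

/-- Insertions into inserted pieces are nested. -/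
lemma insertAt_insertAt_nested (hP : P.Triangular) (hQ : Q.Triangular)
    {γ d : ℕ} (hγ : γ ≤ P.size) (hd : d ≤ Q.size) :
    (P.insertAt γ Q).insertAt (γ + d) R = P.insertAt γ (Q.insertAt d R) := by
  refine Filling.ext (by simp only [insertAt_size]; omega) (Finset.ext fun ⟨r, c⟩ => ?_)
  rw [mem_insertAt, mem_insertAt (P := P)]
  simp only [insertAt_size]
  constructor
  · rintro (⟨r₀, c₀, h1, h2, h3⟩ | ⟨a, b, h1, h2, h3⟩ | h1 | h1)
    · rcases mem_insertAt.1 h1 with ⟨a, b, h1, h4, h5⟩ | ⟨a, b, h1, h4, h5⟩ | h1 | h1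
      · have := hP _ _ h1
        refine Or.inl ⟨a, b, h1, ?_, ?_⟩ <;>
        unfold shift at * <;> split_ifs at * <;> omega
      · have := hQ _ _ h1
        refine Or.inr (Or.inl ⟨shift (Q.size - d) R.size a, shift d R.size b,
          mem_insertAt.2 (Or.inl ⟨a, b, h1, rfl, rfl⟩), ?_, ?_⟩) <;>
        unfold shift at * <;> split_ifs at * <;> omega
      · refine Or.inr (Or.inr (Or.inl ?_))
        unfold shift at *; split_ifs at * <;> omega
      · refine Or.inr (Or.inr (Or.inr ?_))
        unfold shift at *; split_ifs at * <;> omega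
    · exact Or.inr (Or.inl ⟨Q.size - d + a, d + b,
        mem_insertAt.2 (Or.inr (Or.inl ⟨a, b, h1, rfl, rfl⟩)), by omega, by omega⟩)
    · rcases lt_or_ge r (P.size - γ) with h | h
      · exact Or.inr (Or.inr (Or.inl (by omega)))
      · exact Or.inr (Or.inl ⟨r - (P.size - γ), c - γ,
          mem_insertAt.2 (Or.inr (Or.inr (Or.inl (by omega)))), by omega, by omega⟩)
    · rcases lt_or_ge c γ with h | h
      · exact Or.inr (Or.inr (Or.inr (by omega)))
      · exact Or.inr (Or.inl ⟨r - (P.size - γ), c - γ,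
          mem_insertAt.2 (Or.inr (Or.inr (Or.inr (by omega)))), by omega, by omega⟩)
  · rintro (⟨a, b, h1, h2, h3⟩ | ⟨r₀, c₀, h1, h2, h3⟩ | h1 | h1)
    · have := hP _ _ h1
      refine Or.inl ⟨shift (P.size - γ) Q.size a, shift γ Q.size b,
        mem_insertAt.2 (Or.inl ⟨a, b, h1, rfl, rfl⟩), ?_, ?_⟩ <;>
      unfold shift at * <;> split_ifs at * <;> omega
    · rcases mem_insertAt.1 h1 with ⟨a, b, h1, h4, h5⟩ | ⟨a, b, h1, h4, h5⟩ | h1 | h1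
      · have := hQ _ _ h1
        refine Or.inl ⟨P.size - γ + a, γ + b,
          mem_insertAt.2 (Or.inr (Or.inl ⟨a, b, h1, rfl, rfl⟩)), ?_, ?_⟩ <;>
        unfold shift at * <;> split_ifs at * <;> omega
      · exact Or.inr (Or.inl ⟨a, b, h1, by omega, by omega⟩)
      · exact Or.inr (Or.inr (Or.inl (by omega)))
      · exact Or.inr (Or.inr (Or.inr (by omega)))
    · rcases le_or_gt c (γ + d) with h | h
      · refine Or.inl ⟨r, c, mem_insertAt.2 (Or.inr (Or.inr (Or.inl (by omega)))),
          shift_of_le (by omega), shift_of_le (by omega)⟩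
      · rcases le_or_gt c (γ + d + R.size) with h' | h'
        · exact Or.inr (Or.inr (Or.inl (by omega)))
        · exact Or.inl ⟨r, c - R.size, mem_insertAt.2 (Or.inr (Or.inr (Or.inl (by omega)))),
            shift_of_le (by omega), by rw [shift_of_lt (by omega)]; omega⟩
    · rcases le_or_gt r (P.size + Q.size - (γ + d)) with h | h
      · refine Or.inl ⟨r, c, mem_insertAt.2 (Or.inr (Or.inr (Or.inr (by omega)))),
          shift_of_le (by omega), shift_of_le (by omega)⟩
      · rcases le_or_gt r (P.size + Q.size - (γ + d) + R.size) with h' | h'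
        · exact Or.inr (Or.inr (Or.inr (by omega)))
        · exact Or.inl ⟨r - R.size, c, mem_insertAt.2 (Or.inr (Or.inr (Or.inr (by omega)))),
            by rw [shift_of_lt (by omega)]; omega, shift_of_le (by omega)⟩

/-- Insertions at different gaps commute. -/
lemma insertAt_insertAt_comm (hQ : Q.Triangular) (hR : R.Triangular)
    {γ δ : ℕ} (h : γ < δ) (hδ : δ ≤ P.size) :
    (P.insertAt δ R).insertAt γ Q = (P.insertAt γ Q).insertAt (δ + Q.size) R := by
  refine Filling.ext (by simp only [insertAt_size]; omega) (Finset.ext fun ⟨r, c⟩ => ?_)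
  rw [mem_insertAt, mem_insertAt (P := P.insertAt γ Q)]
  simp only [insertAt_size]
  constructor
  · rintro (⟨r₀, c₀, h1, h2, h3⟩ | ⟨a, b, h1, h2, h3⟩ | h1 | h1)
    · rcases mem_insertAt.1 h1 with ⟨a, b, h1, h4, h5⟩ | ⟨a, b, h1, h4, h5⟩ | h1 | h1
      · refine Or.inl ⟨shift (P.size - γ) Q.size a, shift γ Q.size b,
          mem_insertAt.2 (Or.inl ⟨a, b, h1, rfl, rfl⟩), ?_, ?_⟩ <;>
        unfold shift at * <;> split_ifs at * <;> omega
      · have := hR _ _ h1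
        refine Or.inr (Or.inl ⟨a, b, h1, ?_, ?_⟩) <;>
        unfold shift at * <;> split_ifs at * <;> omega
      · refine Or.inr (Or.inr (Or.inl ?_))
        unfold shift at *; split_ifs at * <;> omega
      · refine Or.inr (Or.inr (Or.inr ?_))
        unfold shift at *; split_ifs at * <;> omega
    · have := hQ _ _ h1
      refine Or.inl ⟨P.size - γ + a, γ + b,
        mem_insertAt.2 (Or.inr (Or.inl ⟨a, b, h1, rfl, rfl⟩)), ?_, ?_⟩ <;>
      unfold shift <;> split_ifs <;> omega
    · rcases le_or_gt r (P.size - δ) with h' | h'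
      · exact Or.inl ⟨r, c, mem_insertAt.2 (Or.inr (Or.inr (Or.inl (by omega)))),
          shift_of_le (by omega), shift_of_le (by omega)⟩
      · rcases le_or_gt r (P.size - δ + R.size) with h'' | h''
        · exact Or.inr (Or.inr (Or.inr (by omega)))
        · exact Or.inl ⟨r - R.size, c, mem_insertAt.2 (Or.inr (Or.inr (Or.inl (by omega)))),
            by rw [shift_of_lt (by omega)]; omega, shift_of_le (by omega)⟩
    · exact Or.inl ⟨r - R.size, c, mem_insertAt.2 (Or.inr (Or.inr (Or.inr (by omega)))),
        by rw [shift_of_lt (by omega)]; omega, shift_of_le (by omega)⟩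
  · rintro (⟨r₀, c₀, h1, h2, h3⟩ | ⟨a, b, h1, h2, h3⟩ | h1 | h1)
    · rcases mem_insertAt.1 h1 with ⟨a, b, h1, h4, h5⟩ | ⟨a, b, h1, h4, h5⟩ | h1 | h1
      · refine Or.inl ⟨shift (P.size - δ) R.size a, shift δ R.size b,
          mem_insertAt.2 (Or.inl ⟨a, b, h1, rfl, rfl⟩), ?_, ?_⟩ <;>
        unfold shift at * <;> split_ifs at * <;> omega
      · have := hQ _ _ h1
        refine Or.inr (Or.inl ⟨a, b, h1, ?_, ?_⟩) <;>
        unfold shift at * <;> split_ifs at * <;> omega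
      · refine Or.inr (Or.inr (Or.inl ?_))
        unfold shift at *; split_ifs at * <;> omega
      · refine Or.inr (Or.inr (Or.inr ?_))
        unfold shift at *; split_ifs at * <;> omega
    · have := hR _ _ h1
      refine Or.inl ⟨P.size - δ + a, δ + b,
        mem_insertAt.2 (Or.inr (Or.inl ⟨a, b, h1, rfl, rfl⟩)), ?_, ?_⟩ <;>
      unfold shift <;> split_ifs <;> omega
    · exact Or.inl ⟨r, c - Q.size, mem_insertAt.2 (Or.inr (Or.inr (Or.inl (by omega)))),
        shift_of_le (by omega), by rw [shift_of_lt (by omega)]; omega⟩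
    · rcases le_or_gt c γ with h' | h'
      · exact Or.inl ⟨r, c, mem_insertAt.2 (Or.inr (Or.inr (Or.inr (by omega)))),
          shift_of_le (by omega), shift_of_le (by omega)⟩
      · rcases le_or_gt c (γ + Q.size) with h'' | h''
        · exact Or.inr (Or.inr (Or.inl (by omega)))
        · exact Or.inl ⟨r, c - Q.size, mem_insertAt.2 (Or.inr (Or.inr (Or.inr (by omega)))),
            shift_of_le (by omega), by rw [shift_of_lt (by omega)]; omega⟩

/-! ### Tangled insertion, letter by letter -/

/-- Tangled insertion, reading the word letter by letter: `pos` is the length of the part of the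
word before the current block of letters `q`, of which `l` letters have been read. A letter `p`
closes this (possibly empty) block, so that the corresponding piece of `G` is inserted. Unlike
`tangleAux` this is a recursion on the word itself, which can be cut between any two letters. -/
def weave : List Letter → ℕ → ℕ → Filling → Filling → Filling
  | [], pos, l, R, G => R.insertAt pos (G.vpack l)
  | Letter.q :: s, pos, l, R, G => weave s pos (l + 1) R G
  | Letter.p :: s, pos, l, R, G =>
    weave s (pos + l + 1) 0 (R.insertAt pos (G.vpack l)) (G.hpack (G.size - l))

lemma weave_nil (pos l : ℕ) (R G : Filling) : weave [] pos l R G = R.insertAt pos (G.vpack l) := rfl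

lemma weave_cons_p (s : List Letter) (pos l : ℕ) (R G : Filling) :
    weave (Letter.p :: s) pos l R G =
      weave s (pos + l + 1) 0 (R.insertAt pos (G.vpack l)) (G.hpack (G.size - l)) := rfl

/-- The rest `s` of a word is a correct continuation when `a` letters `p` and `b` letters `q` have
been read: it has the right numbers of letters, and its blocks occur at global descents. -/
def IsContinuation (R G : Filling) : ℕ → ℕ → List Letter → Prop
  | a, b, [] => a = R.size ∧ b = G.size
  | a, b, Letter.q :: s => R.IsGlobalDescent a ∧ IsContinuation R G a (b + 1) s
  | a, b, Letter.p :: s => G.IsGlobalDescent b ∧ IsContinuation R G (a + 1) b s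

/-- Replacing `R` by a filling with `u` more columns inserted to the left, and cutting off the first
`l` letters of `G`, preserves correct continuations. -/
lemma IsContinuation.map {R' G' : Filling} {u l : ℕ} {s : List Letter} {a b : ℕ}
    (h : IsContinuation R G a (l + b) s)
    (hR : ∀ x, a ≤ x → R.IsGlobalDescent x → R'.IsGlobalDescent (x + u))
    (hG : ∀ y, G.IsGlobalDescent (l + y) → G'.IsGlobalDescent y)
    (hRs : R'.size = R.size + u) (hGs : G.size = l + G'.size) :
    IsContinuation R' G' (a + u) b s := by
  induction s generalizing a b with
  | nil =>
    have h1 : a = R.size ∧ l + b = G.size := h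
    exact ⟨by omega, by omega⟩
  | cons x s ih =>
    cases x with
    | p =>
      refine ⟨hG _ h.1, ?_⟩
      have := ih (a := a + 1) h.2 fun x hx => hR x (by omega)
      rwa [add_right_comm] at this
    | q => exact ⟨hR a le_rfl h.1, ih (b := b + 1) h.2 hR⟩

lemma IsContinuation.le {s : List Letter} {a b : ℕ} (h : IsContinuation R G a b s) :
    a ≤ R.size ∧ b ≤ G.size := by
  induction s generalizing a b with
  | nil => exact ⟨h.1.le, h.2.le⟩
  | cons x s ih =>
    cases x with
    | p => have := ih h.2; omega
    | q => have := ih h.2; omega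

/-- The situations that occur while reading a shuffle, with the filling `R` built so far, the part
`G` still to be inserted, and the rest `s` of the word. A block of letters `q` has been begun only
at a global descent of `R`. -/
structure Weaving (R G : Filling) (pos l : ℕ) (s : List Letter) : Prop where
  left : R.IsPipeDream
  right : G.IsPipeDream
  gap : 0 < l → R.IsGlobalDescent pos
  continuation : IsContinuation R G pos l s

lemma IsPipeDream.insertAt_vpack_zero (hG : G.IsPipeDream) (R : Filling) (pos : ℕ) :
    R.insertAt pos (G.vpack 0) = R :=
  insertAt_of_size_eq_zero (hG.vpack (Nat.zero_le _)).triangular' rfl pos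

/-! ### Closing a block of letters -/

section flush

variable {pos l : ℕ} (hR : R.IsPipeDream) (hG : G.IsPipeDream)
  (hgap : 0 < l → R.IsGlobalDescent pos) (hl : l ≤ G.size)
include hR hG hgap hl

lemma isPipeDream_flush : (R.insertAt pos (G.vpack l)).IsPipeDream := by
  rcases Nat.eq_zero_or_pos l with rfl | h
  · rwa [hG.insertAt_vpack_zero]
  · exact hR.insertAt (hG.vpack hl) (hgap h)

lemma flush_descent_left {x : ℕ} (hx : x ≤ pos) :
    (R.insertAt pos (G.vpack l)).IsGlobalDescent x ↔ R.IsGlobalDescent x := by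
  rcases Nat.eq_zero_or_pos l with rfl | h
  · rw [hG.insertAt_vpack_zero]
  · exact (hgap h).insertAt_iff_left hR (hG.vpack hl) hx

lemma flush_descent_right {x : ℕ} (hx : pos ≤ x) :
    (R.insertAt pos (G.vpack l)).IsGlobalDescent (x + l) ↔ R.IsGlobalDescent x := by
  rcases Nat.eq_zero_or_pos l with rfl | h
  · rw [hG.insertAt_vpack_zero, add_zero]
  · exact (hgap h).insertAt_iff_right hR (hG.vpack hl) hx

lemma flush_hpack_left {x : ℕ} (hx : x ≤ pos) (h : R.IsGlobalDescent x) :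
    (R.insertAt pos (G.vpack l)).hpack (R.size - x + l) =
      (R.hpack (R.size - x)).insertAt (pos - x) (G.vpack l) := by
  rcases Nat.eq_zero_or_pos l with rfl | h'
  · rw [hG.insertAt_vpack_zero, hG.insertAt_vpack_zero, add_zero]
  · have := (hgap h').hpack_insertAt hR (hG.vpack hl) h hx le_rfl (Or.inl rfl)
    rwa [(hG.vpack hl).hpack_self] at this

lemma flush_hpack_right {x : ℕ} (hx : pos ≤ x) :
    (R.insertAt pos (G.vpack l)).hpack (R.size - x) = R.hpack (R.size - x) := by
  rcases Nat.eq_zero_or_pos l with rfl | h'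
  · rw [hG.insertAt_vpack_zero]
  · exact (hgap h').hpack_insertAt_of_le hR (hG.vpack hl) (by omega)

lemma flush_vpack_left {x : ℕ} (hx : x ≤ pos) :
    (R.insertAt pos (G.vpack l)).vpack x = R.vpack x := by
  rcases Nat.eq_zero_or_pos l with rfl | h'
  · rw [hG.insertAt_vpack_zero]
  · exact (hgap h').vpack_insertAt_of_le hR (hG.vpack hl) hx

lemma flush_vpack_right {x : ℕ} (hx : pos ≤ x) (h : R.IsGlobalDescent x) :
    (R.insertAt pos (G.vpack l)).vpack (x + l) = (R.vpack x).insertAt pos (G.vpack l) := by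
  rcases Nat.eq_zero_or_pos l with rfl | h'
  · rw [hG.insertAt_vpack_zero, hG.insertAt_vpack_zero, add_zero]
  · have := (hgap h').vpack_insertAt hR (hG.vpack hl) h hx le_rfl (Or.inl rfl)
    rwa [(hG.vpack hl).vpack_self] at this

end flush

/-! ### Cutting a tangled insertion -/

lemma Weaving.read_q {pos l : ℕ} {s : List Letter} (h : Weaving R G pos l (Letter.q :: s)) :
    Weaving R G pos (l + 1) s :=
  ⟨h.left, h.right, fun _ => h.continuation.1, h.continuation.2⟩

lemma Weaving.read_p {pos l : ℕ} {s : List Letter} (h : Weaving R G pos l (Letter.p :: s)) :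
    Weaving (R.insertAt pos (G.vpack l)) (G.hpack (G.size - l)) (pos + l + 1) 0 s := by
  have hl := h.continuation.1
  refine ⟨isPipeDream_flush h.left h.right h.gap hl.le, h.right.hpack (by omega), by simp, ?_⟩
  have h2 : IsContinuation R G (pos + 1) (l + 0) s := h.continuation.2
  rw [add_right_comm]
  exact h2.map (fun x hx hx' =>
    (flush_descent_right h.left h.right h.gap hl.le (by omega)).2 hx')
    (fun y hy => (hl.hpack_iff h.right).2 hy) rfl (by rw [hpack_size]; have := hl.le; omega)

lemma Weaving.isPipeDream {pos l : ℕ} {s : List Letter} (h : Weaving R G pos l s) :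
    (weave s pos l R G).IsPipeDream ∧ (weave s pos l R G).size = R.size + G.size := by
  induction s generalizing pos l R G with
  | nil =>
    obtain ⟨h1, h2⟩ : pos = R.size ∧ l = G.size := h.continuation
    exact ⟨isPipeDream_flush h.left h.right h.gap h2.le,
      by rw [weave, insertAt_size, vpack_size, h2]⟩
  | cons x s ih =>
    cases x with
    | p =>
      have := ih h.read_p
      refine ⟨this.1, this.2.trans ?_⟩
      rw [insertAt_size, hpack_size, vpack_size]
      have := h.continuation.1.le
      omega
    | q => exact ih h.read_q

/-- Cutting the result to the left of the part under construction. -/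
lemma Weaving.cut_before {pos l : ℕ} {s : List Letter} (h : Weaving R G pos l s) {x : ℕ}
    (hx : x ≤ pos) :
    ((weave s pos l R G).IsGlobalDescent x ↔ R.IsGlobalDescent x) ∧
    (R.IsGlobalDescent x →
      (weave s pos l R G).hpack (R.size + G.size - x) =
        weave s (pos - x) l (R.hpack (R.size - x)) G ∧
      (weave s pos l R G).vpack x = R.vpack x) := by
  induction s generalizing pos l R G with
  | nil =>
    obtain ⟨h1, h2⟩ : pos = R.size ∧ l = G.size := h.continuation
    refine ⟨flush_descent_left h.left h.right h.gap h2.le hx, fun hd => ⟨?_, ?_⟩⟩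
    · rw [weave, weave, ← flush_hpack_left h.left h.right h.gap h2.le hx hd]
      congr 1
      omega
    · exact flush_vpack_left h.left h.right h.gap h2.le hx
  | cons y s ih =>
    cases y with
    | p =>
      have hl := h.continuation.1.le
      have hpos := h.continuation.le
      obtain ⟨h1, h2⟩ := ih h.read_p (by omega)
      rw [flush_descent_left h.left h.right h.gap hl hx] at h1 h2
      refine ⟨h1, fun hd => ?_⟩
      obtain ⟨h3, h4⟩ := h2 hd
      rw [flush_vpack_left h.left h.right h.gap hl hx] at h4
      refine ⟨?_, h4⟩
      rw [insertAt_size, vpack_size, hpack_size,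
        show R.size + l - x = R.size - x + l by omega,
        flush_hpack_left h.left h.right h.gap hl hx hd,
        show R.size + l + (G.size - l) - x = R.size + G.size - x by omega,
        show pos + l + 1 - x = pos - x + l + 1 by omega] at h3
      exact h3
    | q => exact ih h.read_q hx

/-- Cutting the result inside the current block of letters `q`. -/
lemma Weaving.cut_inside {pos l : ℕ} {s : List Letter} (h : Weaving R G pos l s) {y : ℕ}
    (hy : y ≤ l) (hpos : R.IsGlobalDescent pos) :
    ((weave s pos l R G).IsGlobalDescent (pos + y) ↔ G.IsGlobalDescent y) ∧
    (G.IsGlobalDescent y →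
      (weave s pos l R G).hpack (R.size + G.size - (pos + y)) =
        weave s 0 (l - y) (R.hpack (R.size - pos)) (G.hpack (G.size - y)) ∧
      (weave s pos l R G).vpack (pos + y) = (R.vpack pos).insertAt pos (G.vpack y)) := by
  have descent : ∀ {l}, G.IsGlobalDescent l → y ≤ l →
      ((R.insertAt pos (G.vpack l)).IsGlobalDescent (pos + y) ↔ G.IsGlobalDescent y) :=
    fun {l} hl hy => (hpos.insertAt_iff_mid h.left (h.right.vpack hl.le) hy).trans
      (hl.vpack_iff h.right hy)
  have hpk : ∀ {l}, G.IsGlobalDescent l → y ≤ l → G.IsGlobalDescent y →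
      (R.insertAt pos (G.vpack l)).hpack (R.size - pos + (l - y)) =
        (R.hpack (R.size - pos)).insertAt 0 ((G.hpack (G.size - y)).vpack (l - y)) := by
    intro l hl hy hd
    rw [hpos.hpack_insertAt h.left (h.right.vpack hl.le) hpos le_rfl (by rw [vpack_size]; omega)
      (Or.inr rfl), Nat.sub_self, hd.hpack_vpack_comm hl h.right hy]
  have vpk : ∀ {l}, l ≤ G.size → y ≤ l →
      (R.insertAt pos (G.vpack l)).vpack (pos + y) = (R.vpack pos).insertAt pos (G.vpack y) := by
    intro l hl hy
    rw [hpos.vpack_insertAt h.left (h.right.vpack hl) hpos le_rfl hy (Or.inr rfl),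
      h.right.vpack_vpack hy hl]
  have hposle := hpos.le
  clear hpos
  induction s generalizing l with
  | nil =>
    obtain ⟨h1, h2⟩ : pos = R.size ∧ l = G.size := h.continuation
    have hl : G.IsGlobalDescent l := h2 ▸ h.right.isGlobalDescent_size
    refine ⟨descent hl hy, fun hd => ⟨?_, vpk h2.le hy⟩⟩
    rw [weave, weave, ← hpk hl hy hd]
    congr 1
    omega
  | cons z s ih =>
    cases z with
    | p =>
      have hl := h.continuation.1
      have hle := hl.le
      obtain ⟨h1, h2⟩ := h.read_p.cut_before (x := pos + y) (by omega)
      rw [descent hl hy] at h1 h2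
      refine ⟨h1, fun hd => ?_⟩
      obtain ⟨h3, h4⟩ := h2 hd
      rw [vpk hle hy] at h4
      refine ⟨?_, h4⟩
      rw [insertAt_size, vpack_size, hpack_size,
        show R.size + l - (pos + y) = R.size - pos + (l - y) by omega, hpk hl hy hd,
        show R.size + l + (G.size - l) - (pos + y) = R.size + G.size - (pos + y) by omega,
        show pos + l + 1 - (pos + y) = 0 + (l - y) + 1 by omega] at h3
      refine h3.trans ?_
      rw [weave, hpack_size, h.right.hpack_hpack (by omega) (by omega),
        show G.size - y - (l - y) = G.size - l by omega]
    | q =>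
      have := ih h.read_q (by omega)
      rw [show l + 1 - y = l - y + 1 by omega] at this
      exact this

/-- Cutting the result at a later place: both the result and its pieces are tangled insertions, for
the two parts of the word. -/
lemma Weaving.cut {pos l : ℕ} {s t : List Letter} (h : Weaving R G pos l (s ++ t)) :
    ((weave (s ++ t) pos l R G).IsGlobalDescent (pos + l + s.length) ↔
      R.IsGlobalDescent (pos + s.count Letter.p) ∧ G.IsGlobalDescent (l + s.count Letter.q)) ∧
    (R.IsGlobalDescent (pos + s.count Letter.p) → G.IsGlobalDescent (l + s.count Letter.q) →
      (weave (s ++ t) pos l R G).hpack (R.size + G.size - (pos + l + s.length)) =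
        weave t 0 0 (R.hpack (R.size - (pos + s.count Letter.p)))
          (G.hpack (G.size - (l + s.count Letter.q))) ∧
      (weave (s ++ t) pos l R G).vpack (pos + l + s.length) =
        weave s pos l (R.vpack (pos + s.count Letter.p)) (G.vpack (l + s.count Letter.q))) := by
  induction s generalizing pos l R G with
  | nil =>
    have hle := h.continuation.le
    simp only [List.nil_append, List.length_nil, List.count_nil, add_zero] at h ⊢
    by_cases hpos : R.IsGlobalDescent pos
    · obtain ⟨h1, h2⟩ := h.cut_inside le_rfl hpos
      refine ⟨by rw [h1]; simp [hpos], fun _ hd => ?_⟩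
      obtain ⟨h3, h4⟩ := h2 hd
      rw [Nat.sub_self] at h3
      rw [weave, h.right.vpack_vpack le_rfl hle.2]
      exact ⟨h3, h4⟩
    · obtain rfl : l = 0 := by
        by_contra hl
        exact hpos (h.gap (by omega))
      have h1 := (h.cut_before le_rfl).1
      rw [add_zero, h1]
      exact ⟨by simp [hpos], fun hd => absurd hd hpos⟩
  | cons x s ih =>
    cases x with
    | p =>
      have hl : G.IsGlobalDescent l := h.continuation.1
      have hle := hl.le
      obtain ⟨h1, h2⟩ := ih h.read_p
      rw [zero_add, hl.hpack_iff h.right, add_zero,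
        show pos + l + 1 + s.count Letter.p = pos + 1 + s.count Letter.p + l by omega,
        flush_descent_right h.left h.right h.gap hle (by omega)] at h1 h2
      have hcp : pos + (Letter.p :: s).count Letter.p = pos + 1 + s.count Letter.p := by
        rw [List.count_cons_self]; omega
      have hcq : (Letter.p :: s).count Letter.q = s.count Letter.q :=
        List.count_cons_of_ne (by decide)
      have hlen : pos + l + (Letter.p :: s).length = pos + l + 1 + s.length := by
        rw [List.length_cons]; omega
      rw [hcp, hcq, hlen]
      refine ⟨h1, fun hd hd' => ?_⟩
      obtain ⟨h3, h4⟩ := h2 hd hd'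
      have hd'le := hd'.le
      rw [insertAt_size, vpack_size, hpack_size,
        show R.size + l - (pos + 1 + s.count Letter.p + l) =
          R.size - (pos + 1 + s.count Letter.p) by omega,
        flush_hpack_right h.left h.right h.gap hle (by omega),
        h.right.hpack_hpack (by omega) (by omega),
        show R.size + l + (G.size - l) - (pos + l + 1 + s.length) =
          R.size + G.size - (pos + l + 1 + s.length) by omega, Nat.sub_sub] at h3
      rw [flush_vpack_right h.left h.right h.gap hle (by omega) hd] at h4
      refine ⟨h3, h4.trans ?_⟩
      have hcomm := hl.hpack_vpack_comm hd' h.right (by omega)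
      rw [Nat.add_sub_cancel_left] at hcomm
      rw [weave, vpack_size, h.right.vpack_vpack (by omega) hd'le, Nat.add_sub_cancel_left, hcomm]
    | q =>
      have hcq : l + (Letter.q :: s).count Letter.q = l + 1 + s.count Letter.q := by
        rw [List.count_cons_self]; omega
      have hcp : (Letter.q :: s).count Letter.p = s.count Letter.p :=
        List.count_cons_of_ne (by decide)
      have hlen : pos + l + (Letter.q :: s).length = pos + (l + 1) + s.length := by
        rw [List.length_cons]; omega
      rw [hcp, hcq, hlen]
      exact ih h.read_q

/-! ### Letterwise and blockwise tangled insertion agree -/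

lemma weave_replicate_q (l m : ℕ) (s : List Letter) (pos : ℕ) (R G : Filling) :
    weave (List.replicate m Letter.q ++ s) pos l R G = weave s pos (l + m) R G := by
  induction m generalizing l with
  | zero => rfl
  | succ m ih =>
    rw [List.replicate_succ, List.cons_append, weave, ih]
    congr 1
    omega

lemma weave_cons_p_zero (hG : G.IsPipeDream) (s : List Letter) (pos : ℕ) (R : Filling) :
    weave (Letter.p :: s) pos 0 R G = weave s (pos + 1) 0 R G := by
  rw [weave, hG.insertAt_vpack_zero, Nat.sub_zero, hG.hpack_self, add_zero]

lemma weave_replicate_p (hG : G.IsPipeDream) (m : ℕ) (s : List Letter) (pos : ℕ) (R : Filling) :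
    weave (List.replicate m Letter.p ++ s) pos 0 R G = weave s (pos + m) 0 R G := by
  induction m generalizing pos with
  | zero => rfl
  | succ m ih =>
    rw [List.replicate_succ, List.cons_append, weave_cons_p_zero hG, ih]
    congr 1
    omega

/-- A block of letters `q` can be closed as soon as no further `q` follows. -/
lemma weave_flush (hG : G.IsPipeDream) {s : List Letter} (hs : s.head? ≠ some Letter.q)
    (pos l : ℕ) (R : Filling) :
    weave s pos l R G =
      weave s (pos + l) 0 (R.insertAt pos (G.vpack l)) (G.hpack (G.size - l)) := by
  have hG' := hG.hpack (Nat.sub_le G.size l)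
  match s, hs with
  | [], _ => rw [weave, weave, hG'.insertAt_vpack_zero]
  | Letter.p :: s, _ => rw [weave_cons_p_zero hG', weave]
  | Letter.q :: s, hs => simp at hs

lemma tangleAux_eq_weave (hG : G.IsPipeDream) {bs : List (List Letter)}
    (hconst : ∀ b ∈ bs, ∃ x m, b = List.replicate (m + 1) x)
    (hchain : bs.IsChain fun a b => a.head? ≠ b.head?) (pos : ℕ) (R : Filling) :
    tangleAux bs pos R G = weave bs.flatten pos 0 R G := by
  induction bs generalizing pos R G with
  | nil => rw [List.flatten_nil, weave, tangleAux, hG.insertAt_vpack_zero]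
  | cons b bs ih =>
    have hconst' : ∀ b ∈ bs, ∃ x m, b = List.replicate (m + 1) x := fun b hb =>
      hconst b (List.mem_cons_of_mem _ hb)
    have ih' := fun {G : Filling} (hG : G.IsPipeDream) pos R =>
      ih (G := G) hG hconst' hchain.tail pos R
    obtain ⟨x, m, rfl⟩ := hconst b List.mem_cons_self
    rw [tangleAux, List.flatten_cons, List.length_replicate]
    cases x with
    | p => rw [if_neg (by simp [List.replicate_succ]), weave_replicate_p hG, ih' hG]
    | q =>
      rw [if_pos (by simp [List.replicate_succ]), weave_replicate_q, zero_add,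
        ih' (hG.hpack (by omega)), ← weave_flush hG]
      match bs, hconst', hchain with
      | [], _, _ => simp
      | b' :: bs, hc, hch =>
        obtain ⟨x, m, rfl⟩ := hc b' List.mem_cons_self
        rw [List.isChain_cons_cons] at hch
        simpa [List.replicate_succ, eq_comm] using hch.1

lemma tangle_eq_weave (hG : G.IsPipeDream) (s : List Letter) (R : Filling) :
    tangle s R G = weave s 0 0 R G := by
  have hconst : ∀ b ∈ s.splitBy (fun a b => a = b), ∃ x m, b = List.replicate (m + 1) x := by
    intro b hb
    have h1 := List.ne_nil_of_mem_splitBy hb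
    have h2 := List.isChain_of_mem_splitBy hb
    simp only [decide_eq_true_eq] at h2
    obtain ⟨x, b, rfl⟩ := List.exists_cons_of_ne_nil h1
    refine ⟨x, b.length, ?_⟩
    rw [List.isChain_iff_pairwise, List.pairwise_cons] at h2
    rw [List.replicate_succ, ← List.eq_replicate_of_mem fun y hy => (h2.1 y hy).symm]
  rw [tangle, tangleAux_eq_weave hG hconst, List.flatten_splitBy]
  refine (List.isChain_getLast_head_splitBy _ s).imp_of_mem_imp ?_
  rintro a b ha hb ⟨h1, h2, h3⟩
  obtain ⟨x, m, rfl⟩ := hconst a ha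
  obtain ⟨y, m', rfl⟩ := hconst b hb
  rw [List.getLast_replicate, List.head_replicate, decide_eq_false_iff_not] at h3
  simpa [List.replicate_succ] using h3

/-! ### Shuffles -/

/-- The recursive form of the condition in the definition of shuffles. -/
lemma isContinuation_iff {s : List Letter} {a b : ℕ} : IsContinuation R G a b s ↔
    a + s.count Letter.p = R.size ∧ b + s.count Letter.q = G.size ∧
    ∀ i < s.length,
      (s[i]? = some Letter.p → G.IsGlobalDescent (b + (s.take i).count Letter.q)) ∧
      (s[i]? = some Letter.q → R.IsGlobalDescent (a + (s.take i).count Letter.p)) := by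
  induction s generalizing a b with
  | nil => simp [IsContinuation]
  | cons x s ih =>
    have hsplit : ∀ p : ℕ → Prop, (∀ i < (x :: s).length, p i) ↔
        p 0 ∧ ∀ i < s.length, p (i + 1) := fun p =>
      ⟨fun h => ⟨h 0 (by simp), fun i hi => h (i + 1) (by simpa using hi)⟩, fun h i hi => by
        cases i with
        | zero => exact h.1
        | succ i => exact h.2 i (by simpa using hi)⟩
    rw [hsplit]
    cases x with
    | p =>
      rw [IsContinuation, ih]
      simp [add_assoc, add_comm 1]
      tauto
    | q =>
      rw [IsContinuation, ih]
      simp [add_assoc, add_comm 1]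
      tauto

lemma mem_shuffles {s : List Letter} : s ∈ R.shuffles G ↔ IsContinuation R G 0 0 s := by
  rw [shuffles, Finset.mem_filter, isContinuation_iff, List.mem_toFinset, List.mem_permutations,
    List.perm_iff_count]
  simp only [zero_add]
  rw [← and_assoc]
  refine and_congr_left fun _ => ⟨fun h => ?_, fun h a => ?_⟩
  · have h1 := h Letter.p
    have h2 := h Letter.q
    simpa [List.count_replicate] using And.intro h1 h2
  · cases a <;> simp [List.count_replicate, h]

lemma weaving_of_mem_shuffles (hR : R.IsPipeDream) (hG : G.IsPipeDream) {s : List Letter}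
    (h : s ∈ R.shuffles G) : Weaving R G 0 0 s :=
  ⟨hR, hG, by simp, mem_shuffles.1 h⟩

end Filling

/-! ### Shuffles of three words -/

/-- The letters of words that shuffle three pipe dreams. -/
inductive Letter₃
  | p
  | q
  | r

namespace Letter₃

/-- The subword of the letters `p` and `q`. -/
def wordPQ : List Letter₃ → List Letter
  | [] => []
  | p :: w => Letter.p :: wordPQ w
  | q :: w => Letter.q :: wordPQ w
  | r :: w => wordPQ w

/-- The subword of the letters `q` and `r`, renamed to `p` and `q`. -/
def wordQR : List Letter₃ → List Letter
  | [] => []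
  | p :: w => wordQR w
  | q :: w => Letter.p :: wordQR w
  | r :: w => Letter.q :: wordQR w

/-- The word in which `p` and `q` are identified; this letter is called `p`, and `r` is
called `q`. -/
def wordLeft : List Letter₃ → List Letter
  | [] => []
  | p :: w => Letter.p :: wordLeft w
  | q :: w => Letter.p :: wordLeft w
  | r :: w => Letter.q :: wordLeft w

/-- The word in which `q` and `r` are identified; this letter is called `q`. -/
def wordRight : List Letter₃ → List Letter
  | [] => []
  | p :: w => Letter.p :: wordRight w
  | q :: w => Letter.q :: wordRight w
  | r :: w => Letter.q :: wordRight w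

/-- Renaming of the letters `p`, `q` to `q`, `r`. -/
def ofLetter : Letter → Letter₃
  | Letter.p => q
  | Letter.q => r

/-- The word with given `wordPQ` and `wordLeft` (if they are compatible, and junk otherwise). -/
def mergeLeft : List Letter → List Letter → List Letter₃
  | s, Letter.q :: t => r :: mergeLeft s t
  | Letter.p :: s, Letter.p :: t => p :: mergeLeft s t
  | Letter.q :: s, Letter.p :: t => q :: mergeLeft s t
  | _, _ => []

/-- The word with given `wordQR` and `wordRight` (if they are compatible, and junk otherwise). -/
def mergeRight : List Letter → List Letter → List Letter₃
  | s, Letter.p :: t => p :: mergeRight s t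
  | Letter.p :: s, Letter.q :: t => q :: mergeRight s t
  | Letter.q :: s, Letter.q :: t => r :: mergeRight s t
  | _, _ => []

lemma mergeLeft_word (w : List Letter₃) : mergeLeft (wordPQ w) (wordLeft w) = w := by
  induction w with
  | nil => simp [wordPQ, wordLeft, mergeLeft]
  | cons x w ih => cases x <;> simp [wordPQ, wordLeft, mergeLeft, ih]

lemma mergeRight_word (w : List Letter₃) : mergeRight (wordQR w) (wordRight w) = w := by
  induction w with
  | nil => simp [wordQR, wordRight, mergeRight]
  | cons x w ih => cases x <;> simp [wordQR, wordRight, mergeRight, ih]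

lemma word_mergeLeft {s t : List Letter} (h : t.count Letter.p = s.length) :
    wordPQ (mergeLeft s t) = s ∧ wordLeft (mergeLeft s t) = t := by
  induction t generalizing s with
  | nil =>
    obtain rfl : s = [] := by simpa [eq_comm] using h
    simp [mergeLeft, wordPQ, wordLeft]
  | cons x t ih =>
    cases x with
    | q => simpa [mergeLeft, wordPQ, wordLeft] using ih (s := s) (by simpa using h)
    | p =>
      match s, h with
      | [], h => simp at h
      | Letter.p :: s, h => simpa [mergeLeft, wordPQ, wordLeft] using ih (s := s) (by simpa using h)
      | Letter.q :: s, h => simpa [mergeLeft, wordPQ, wordLeft] using ih (s := s) (by simpa using h)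

lemma word_mergeRight {s t : List Letter} (h : t.count Letter.q = s.length) :
    wordQR (mergeRight s t) = s ∧ wordRight (mergeRight s t) = t := by
  induction t generalizing s with
  | nil =>
    obtain rfl : s = [] := by simpa [eq_comm] using h
    simp [mergeRight, wordQR, wordRight]
  | cons x t ih =>
    cases x with
    | p => simpa [mergeRight, wordQR, wordRight] using ih (s := s) (by simpa using h)
    | q =>
      match s, h with
      | [], h => simp at h
      | Letter.p :: s, h =>
        simpa [mergeRight, wordQR, wordRight] using ih (s := s) (by simpa using h)
      | Letter.q :: s, h =>
        simpa [mergeRight, wordQR, wordRight] using ih (s := s) (by simpa using h)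

section ofLetter

variable (t : List Letter) (w : List Letter₃)

lemma wordPQ_append :
    wordPQ (t.map ofLetter ++ w) = List.replicate (t.count Letter.p) Letter.q ++ wordPQ w := by
  induction t with
  | nil => rfl
  | cons x t ih => cases x <;> simp [ofLetter, wordPQ, ih, List.replicate_succ]

lemma wordQR_append : wordQR (t.map ofLetter ++ w) = t ++ wordQR w := by
  induction t with
  | nil => rfl
  | cons x t ih => cases x <;> simp [ofLetter, wordQR, ih]

lemma wordLeft_append : wordLeft (t.map ofLetter ++ w) = t ++ wordLeft w := by
  induction t with
  | nil => rfl
  | cons x t ih => cases x <;> simp [ofLetter, wordLeft, ih]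

lemma wordRight_append :
    wordRight (t.map ofLetter ++ w) = List.replicate t.length Letter.q ++ wordRight w := by
  induction t with
  | nil => rfl
  | cons x t ih => cases x <;> simp [ofLetter, wordRight, ih, List.replicate_succ]

end ofLetter

/-- A word begins with a block without letters `p`, which either is the whole word or is followed by
a letter `p`. -/
lemma exists_eq_map_ofLetter (w : List Letter₃) : ∃ t : List Letter, w = t.map ofLetter ∨
    ∃ w', w = t.map ofLetter ++ p :: w' := by
  induction w with
  | nil => exact ⟨[], Or.inl rfl⟩
  | cons x w ih =>
    obtain ⟨t, ih⟩ := ih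
    cases x with
    | p => exact ⟨[], Or.inr ⟨w, rfl⟩⟩
    | q =>
      refine ⟨Letter.p :: t, ih.imp (fun h => by rw [h]; rfl) ?_⟩
      rintro ⟨w', rfl⟩
      exact ⟨w', rfl⟩
    | r =>
      refine ⟨Letter.q :: t, ih.imp (fun h => by rw [h]; rfl) ?_⟩
      rintro ⟨w', rfl⟩
      exact ⟨w', rfl⟩

end Letter₃

namespace Filling

variable {F G P Q R : Filling}

open Letter₃

/-- The analogue of `IsContinuation` for three pipe dreams: every letter occurs at global descents
of the two other pipe dreams. -/
def IsContinuation₃ (P Q R : Filling) : ℕ → ℕ → ℕ → List Letter₃ → Prop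
  | a, b, c, [] => a = P.size ∧ b = Q.size ∧ c = R.size
  | a, b, c, Letter₃.p :: w =>
    Q.IsGlobalDescent b ∧ R.IsGlobalDescent c ∧ IsContinuation₃ P Q R (a + 1) b c w
  | a, b, c, Letter₃.q :: w =>
    P.IsGlobalDescent a ∧ R.IsGlobalDescent c ∧ IsContinuation₃ P Q R a (b + 1) c w
  | a, b, c, Letter₃.r :: w =>
    P.IsGlobalDescent a ∧ Q.IsGlobalDescent b ∧ IsContinuation₃ P Q R a b (c + 1) w

lemma IsContinuation₃.wordPQ {w : List Letter₃} {a b c : ℕ} (h : IsContinuation₃ P Q R a b c w) :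
    IsContinuation P Q a b (wordPQ w) := by
  induction w generalizing a b c with
  | nil => exact ⟨h.1, h.2.1⟩
  | cons x w ih =>
    cases x with
    | p => exact ⟨h.1, ih h.2.2⟩
    | q => exact ⟨h.1, ih h.2.2⟩
    | r => exact ih h.2.2

lemma IsContinuation₃.wordQR {w : List Letter₃} {a b c : ℕ} (h : IsContinuation₃ P Q R a b c w) :
    IsContinuation Q R b c (wordQR w) := by
  induction w generalizing a b c with
  | nil => exact ⟨h.2.1, h.2.2⟩
  | cons x w ih =>
    cases x with
    | p => exact ih h.2.2
    | q => exact ⟨h.2.1, ih h.2.2⟩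
    | r => exact ⟨h.2.1, ih h.2.2⟩

/-- A shuffle of three words is a shuffle of the first two, followed by a shuffle of the result `T`
with the third; all that matters about `T` is its size and its global descents. -/
lemma isContinuation₃_iff_left {T : Filling} (hT : T.size = P.size + Q.size) {w : List Letter₃}
    {a b c : ℕ}
    (hd : ∀ u v, Letter₃.wordPQ w = u ++ v → (T.IsGlobalDescent (a + b + u.length) ↔
      P.IsGlobalDescent (a + u.count Letter.p) ∧ Q.IsGlobalDescent (b + u.count Letter.q))) :
    IsContinuation₃ P Q R a b c w ↔
      IsContinuation P Q a b (Letter₃.wordPQ w) ∧ IsContinuation T R (a + b) c (wordLeft w) := by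
  induction w generalizing a b c with
  | nil => simp only [IsContinuation₃, Letter₃.wordPQ, wordLeft, IsContinuation]; omega
  | cons x w ih =>
    cases x with
    | p =>
      have := ih (a := a + 1) (b := b) (c := c) fun u v huv => by
        have := hd (Letter.p :: u) v (by rw [Letter₃.wordPQ, huv]; rfl)
        simpa [add_assoc, add_comm, add_left_comm] using this
      simp only [IsContinuation₃, Letter₃.wordPQ, wordLeft, IsContinuation, this,
        show a + b + 1 = a + 1 + b by omega]
      tauto
    | q =>
      have := ih (a := a) (b := b + 1) (c := c) fun u v huv => by
        have := hd (Letter.q :: u) v (by rw [Letter₃.wordPQ, huv]; rfl)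
        simpa [add_assoc, add_comm, add_left_comm] using this
      simp only [IsContinuation₃, Letter₃.wordPQ, wordLeft, IsContinuation, this,
        show a + b + 1 = a + (b + 1) by omega]
      tauto
    | r =>
      have := ih (a := a) (b := b) (c := c + 1) hd
      have h0 := hd [] _ rfl
      simp only [List.length_nil, List.count_nil, add_zero] at h0
      simp only [IsContinuation₃, Letter₃.wordPQ, wordLeft, IsContinuation, this, h0]
      tauto

/-- A shuffle of three words is a shuffle of the last two, followed by a shuffle of the first with
the result `T`. -/
lemma isContinuation₃_iff_right {T : Filling} (hT : T.size = Q.size + R.size) {w : List Letter₃}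
    {a b c : ℕ}
    (hd : ∀ u v, Letter₃.wordQR w = u ++ v → (T.IsGlobalDescent (b + c + u.length) ↔
      Q.IsGlobalDescent (b + u.count Letter.p) ∧ R.IsGlobalDescent (c + u.count Letter.q))) :
    IsContinuation₃ P Q R a b c w ↔
      IsContinuation Q R b c (Letter₃.wordQR w) ∧ IsContinuation P T a (b + c) (wordRight w) := by
  induction w generalizing a b c with
  | nil => simp only [IsContinuation₃, Letter₃.wordQR, wordRight, IsContinuation]; omega
  | cons x w ih =>
    cases x with
    | q =>
      have := ih (a := a) (b := b + 1) (c := c) fun u v huv => by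
        have := hd (Letter.p :: u) v (by rw [Letter₃.wordQR, huv]; rfl)
        simpa [add_assoc, add_comm, add_left_comm] using this
      simp only [IsContinuation₃, Letter₃.wordQR, wordRight, IsContinuation, this,
        show b + c + 1 = b + 1 + c by omega]
      tauto
    | r =>
      have := ih (a := a) (b := b) (c := c + 1) fun u v huv => by
        have := hd (Letter.q :: u) v (by rw [Letter₃.wordQR, huv]; rfl)
        simpa [add_assoc, add_comm, add_left_comm] using this
      simp only [IsContinuation₃, Letter₃.wordQR, wordRight, IsContinuation, this,
        show b + c + 1 = b + (c + 1) by omega]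
      tauto
    | p =>
      have := ih (a := a + 1) (b := b) (c := c) hd
      have h0 := hd [] _ rfl
      simp only [List.length_nil, List.count_nil, add_zero] at h0
      simp only [IsContinuation₃, Letter₃.wordQR, wordRight, IsContinuation, this, h0]
      tauto

/-- What a block of letters `q` and `r` in a shuffle of three words tells about the global
descents. -/
lemma IsContinuation₃.append {t : List Letter} {w : List Letter₃} {a b c : ℕ}
    (h : IsContinuation₃ P Q R a b c (t.map ofLetter ++ w)) :
    (t ≠ [] → P.IsGlobalDescent a) ∧
    (∀ u v, t = u ++ Letter.p :: v → R.IsGlobalDescent (c + u.count Letter.q)) ∧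
    IsContinuation₃ P Q R a (b + t.count Letter.p) (c + t.count Letter.q) w := by
  induction t generalizing b c with
  | nil => exact ⟨by simp, by simp, h⟩
  | cons x t ih =>
    cases x with
    | p =>
      obtain ⟨-, h2, h3⟩ := ih h.2.2
      refine ⟨fun _ => h.1, fun u v huv => ?_, ?_⟩
      · rcases u with _ | ⟨y, u⟩
        · exact h.2.1
        · rw [List.cons_append, List.cons.injEq] at huv
          obtain ⟨rfl, huv⟩ := huv
          simpa using h2 u v huv
      · simpa [add_assoc, add_comm 1] using h3
    | q =>
      obtain ⟨-, h2, h3⟩ := ih h.2.2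
      refine ⟨fun _ => h.1, fun u v huv => ?_, ?_⟩
      · rcases u with _ | ⟨y, u⟩
        · simp at huv
        · rw [List.cons_append, List.cons.injEq] at huv
          obtain ⟨rfl, huv⟩ := huv
          simpa [add_assoc, add_comm 1] using h2 u v huv
      · simpa [add_assoc, add_comm 1] using h3

lemma IsContinuation₃.map {P' Q' R' : Filling} {u l l' : ℕ} {w : List Letter₃} {a b c : ℕ}
    (h : IsContinuation₃ P Q R a (l + b) (l' + c) w)
    (hP : ∀ x, a ≤ x → P.IsGlobalDescent x → P'.IsGlobalDescent (x + u))
    (hQ : ∀ y, Q.IsGlobalDescent (l + y) → Q'.IsGlobalDescent y)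
    (hR : ∀ y, R.IsGlobalDescent (l' + y) → R'.IsGlobalDescent y)
    (hPs : P'.size = P.size + u) (hQs : Q.size = l + Q'.size) (hRs : R.size = l' + R'.size) :
    IsContinuation₃ P' Q' R' (a + u) b c w := by
  induction w generalizing a b c with
  | nil =>
    have h1 : a = P.size ∧ l + b = Q.size ∧ l' + c = R.size := h
    exact ⟨by omega, by omega, by omega⟩
  | cons x w ih =>
    cases x with
    | p =>
      refine ⟨hQ _ h.1, hR _ h.2.1, ?_⟩
      have := ih (a := a + 1) h.2.2 fun x hx => hP x (by omega)
      rwa [add_right_comm] at this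
    | q => exact ⟨hP _ le_rfl h.1, hR _ h.2.1, ih (b := b + 1) h.2.2 hP⟩
    | r => exact ⟨hP _ le_rfl h.1, hQ _ h.2.1, ih (c := c + 1) h.2.2 hP⟩

/-! ### Tangled insertion is associative -/

/-- A tangled insertion into an inserted piece is nested. -/
lemma weave_insertAt (hP : P.Triangular) (hR : R.IsPipeDream) {s : List Letter} {pos i l : ℕ}
    (hQ : Q.Triangular) (hpos : pos ≤ P.size) (hi : i + s.count Letter.p ≤ Q.size)
    (hl : l + s.count Letter.q ≤ R.size) :
    weave s (pos + i) l (P.insertAt pos Q) R = P.insertAt pos (weave s i l Q R) := by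
  induction s generalizing i l Q R with
  | nil => exact insertAt_insertAt_nested hP hQ hpos hi
  | cons x s ih =>
    cases x with
    | p =>
      simp only [List.count_cons_self, List.count_cons_of_ne (show Letter.p ≠ Letter.q by decide)]
        at hi hl
      rw [weave, weave, insertAt_insertAt_nested hP hQ hpos (by omega), add_assoc pos,
        add_assoc pos]
      refine ih (hR.hpack (by omega)) ?_ ?_ ?_
      · exact hQ.insertAt (by omega) (hR.vpack (by omega)).triangular'
      · rw [insertAt_size, vpack_size]; omega
      · rw [hpack_size]; omega
    | q =>
      simp only [List.count_cons_self, List.count_cons_of_ne (show Letter.q ≠ Letter.p by decide)]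
        at hi hl
      exact ih hR hQ hi (by omega)

/-- An insertion to the left of all insertions of a tangled insertion commutes with it. -/
lemma insertAt_weave {Y : Filling} (hY : Y.Triangular) (hG : G.IsPipeDream) {s : List Letter}
    {pos l δ : ℕ} (hδ : δ < pos) (hpos : pos + s.count Letter.p ≤ R.size)
    (hl : l + s.count Letter.q ≤ G.size) :
    (weave s pos l R G).insertAt δ Y = weave s (pos + Y.size) l (R.insertAt δ Y) G := by
  induction s generalizing pos l R G with
  | nil => exact insertAt_insertAt_comm hY (hG.vpack hl).triangular' hδ hpos
  | cons x s ih =>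
    cases x with
    | p =>
      simp only [List.count_cons_self, List.count_cons_of_ne (show Letter.p ≠ Letter.q by decide)]
        at hpos hl
      rw [weave, weave, ih (hG.hpack (by omega)) (by omega)
        (by rw [insertAt_size, vpack_size]; omega) (by rw [hpack_size]; omega),
        insertAt_insertAt_comm hY (hG.vpack (by omega)).triangular' hδ (by omega)]
      congr 1
      omega
    | q =>
      simp only [List.count_cons_self, List.count_cons_of_ne (show Letter.q ≠ Letter.p by decide)]
        at hpos hl
      exact ih hG hδ hpos (by omega)

/-- The tangled insertion of `R` into another tangled insertion, read up to the end of the first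
block of letters `q` of the latter: the insertions of pieces of `R` take place inside this
block. -/
lemma weave_append_weave (hP : P.Triangular) {Q' : Filling} (hQ' : Q'.IsPipeDream)
    {s t v : List Letter} {pos i l : ℕ} (hQ : Q.Triangular) (hR : R.IsPipeDream)
    (hpos : pos ≤ P.size) (hi : i + t.count Letter.p = Q.size)
    (hs : pos + s.count Letter.p + 1 ≤ P.size) (hs' : s.count Letter.q ≤ Q'.size)
    (hd : ∀ u v, t = u ++ Letter.p :: v → R.IsGlobalDescent (l + u.count Letter.q))
    (hd' : R.IsGlobalDescent (l + t.count Letter.q)) :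
    weave (t ++ Letter.p :: v) (pos + i) l
        (weave s (pos + Q.size + 1) 0 (P.insertAt pos Q) Q') R =
      weave v (pos + i + l + t.length + 1) 0
        (weave s (pos + i + l + t.length + 1) 0
          (P.insertAt pos (weave t i l Q (R.vpack (l + t.count Letter.q)))) Q')
        (R.hpack (R.size - (l + t.count Letter.q))) := by
  have hstep : ∀ {Q : Filling} {i l : ℕ} {R : Filling}, Q.Triangular → i ≤ Q.size →
      R.IsPipeDream → l ≤ R.size →
      (weave s (pos + Q.size + 1) 0 (P.insertAt pos Q) Q').insertAt (pos + i) (R.vpack l) =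
        weave s (pos + (Q.insertAt i (R.vpack l)).size + 1) 0
          (P.insertAt pos (Q.insertAt i (R.vpack l))) Q' := by
    intro Q i l R hQ hi hR hl
    rw [insertAt_weave (hR.vpack hl).triangular' hQ' (by omega) (by rw [insertAt_size]; omega)
      (by omega), insertAt_insertAt_nested hP hQ hpos hi, insertAt_size, vpack_size]
    congr 1
    omega
  induction t generalizing i l Q R with
  | nil =>
    simp only [List.count_nil, add_zero, List.nil_append, List.length_nil] at hi hd' ⊢
    subst hi
    rw [weave_cons_p, hstep hQ le_rfl hR hd'.le, weave_nil, hR.vpack_vpack le_rfl hd'.le,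
      insertAt_size, vpack_size, ← add_assoc]
  | cons x t ih =>
    cases x with
    | p =>
      simp only [List.count_cons_self, List.count_cons_of_ne (show Letter.p ≠ Letter.q by decide)]
        at hi hd' ⊢
      have hl : R.IsGlobalDescent l := hd [] t rfl
      have hle := hl.le
      have hle' := hd'.le
      have hcomm := hl.hpack_vpack_comm hd' hR (by omega)
      rw [Nat.add_sub_cancel_left] at hcomm
      have := ih (i := i + l + 1) (l := 0) (Q := Q.insertAt i (R.vpack l))
        (R := R.hpack (R.size - l)) (hQ.insertAt (by omega) (hR.vpack hle).triangular')
        (hR.hpack (by omega)) (by rw [insertAt_size, vpack_size]; omega)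
        (fun u v huv => by
          rw [hl.hpack_iff hR, zero_add]
          simpa using hd (Letter.p :: u) v (by rw [huv]; rfl))
        (by rwa [hl.hpack_iff hR, zero_add])
      rw [List.cons_append, weave, hstep hQ (by omega) hR hle,
        show pos + i + l + 1 = pos + (i + l + 1) by omega, this, weave, vpack_size,
        hR.vpack_vpack (by omega) hle', Nat.add_sub_cancel_left, hcomm, zero_add, hpack_size,
        hR.hpack_hpack (by omega) (by omega), Nat.sub_sub, List.length_cons,
        show pos + (i + l + 1) + 0 + t.length + 1 = pos + i + l + (t.length + 1) + 1 by omega]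
    | q =>
      simp only [List.count_cons_self, List.count_cons_of_ne (show Letter.q ≠ Letter.p by decide)]
        at hi hd' ⊢
      have := ih (i := i) (l := l + 1) hQ hR hi
        (fun u v huv => by
          simpa [add_assoc, add_comm 1] using hd (Letter.q :: u) v (by rw [huv]; rfl))
        (by rwa [add_assoc, add_comm 1])
      rw [show l + 1 + t.count Letter.q = l + (t.count Letter.q + 1) by omega,
        show pos + i + (l + 1) + t.length + 1 = pos + i + l + (t.length + 1) + 1 by omega] at this
      exact this

lemma IsContinuation.add_count {s : List Letter} {a b : ℕ} (h : IsContinuation R G a b s) :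
    a + s.count Letter.p = R.size ∧ b + s.count Letter.q = G.size :=
  ⟨(isContinuation_iff.1 h).1, (isContinuation_iff.1 h).2.1⟩

lemma length_eq_count_add_count (s : List Letter) :
    s.length = s.count Letter.p + s.count Letter.q := by
  induction s with
  | nil => rfl
  | cons x s ih => cases x <;> simp [ih] <;> omega

/-- Tangled insertion is associative: both sides are determined by a shuffle `w` of three words. The
induction removes the part of `w` up to the first letter `p`: its letters `q` and `r` describe a
tangled insertion of pieces of `Q` and `R`, which is inserted into `P` as a whole. -/
lemma weave_weave (hP : P.IsPipeDream) (hQ : Q.IsPipeDream) (hR : R.IsPipeDream)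
    {w : List Letter₃} {pos : ℕ} (h : IsContinuation₃ P Q R pos 0 0 w) :
    weave (wordLeft w) pos 0 (weave (wordPQ w) pos 0 P Q) R =
      weave (wordRight w) pos 0 P (weave (wordQR w) 0 0 Q R) := by
  obtain ⟨n, hn⟩ : ∃ n, w.length = n := ⟨_, rfl⟩
  induction n using Nat.strong_induction_on generalizing w pos P Q R with
  | _ n ih =>
  obtain ⟨t, hw | ⟨w', hw⟩⟩ := exists_eq_map_ofLetter w
  · subst hw
    rw [← List.append_nil (t.map ofLetter)] at h ⊢
    have hQR : Weaving Q R 0 0 (Letter₃.wordQR (t.map ofLetter ++ [])) :=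
      ⟨hQ, hR, by simp, h.wordQR⟩
    obtain ⟨-, -, h1⟩ := h.append
    obtain ⟨hpos, hb, hc⟩ : pos = P.size ∧ 0 + t.count Letter.p = Q.size ∧
      0 + t.count Letter.q = R.size := h1
    rw [wordQR_append] at hQR ⊢
    rw [wordPQ_append, wordLeft_append, wordRight_append, weave_replicate_q, weave_replicate_q]
    simp only [Letter₃.wordPQ, Letter₃.wordQR, wordLeft, wordRight, List.append_nil] at hQR ⊢
    have hlen : t.length = Q.size + R.size := by rw [length_eq_count_add_count]; omega
    rw [weave, weave, hb, hQ.vpack_self, zero_add, hlen, ← hQR.isPipeDream.2,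
      hQR.isPipeDream.1.vpack_self]
    exact weave_insertAt (i := 0) hP.triangular' hR hQ.triangular' hpos.le hb.le hc.le
  · subst hw
    have hQR : Weaving Q R 0 0 (Letter₃.wordQR (t.map ofLetter ++ Letter₃.p :: w')) :=
      ⟨hQ, hR, by simp, h.wordQR⟩
    obtain ⟨hgap, hd, hb, hc, h1⟩ := h.append
    rw [zero_add] at hb hc
    have hPQ := h1.wordPQ.add_count
    have hQR' := h1.wordQR.add_count
    rw [wordQR_append] at hQR ⊢
    rw [wordPQ_append, wordLeft_append, wordRight_append, weave_replicate_q, weave_replicate_q]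
    simp only [Letter₃.wordPQ, Letter₃.wordQR, wordLeft, wordRight] at hQR ⊢
    have hcut := hQR.cut.2 (by rwa [zero_add]) (by rwa [zero_add])
    simp only [zero_add] at hcut hPQ hQR'
    rw [weave, weave, zero_add, zero_add, hcut.2, hQR.isPipeDream.2, hcut.1]
    have hbl := hb.le
    have hcl := hc.le
    have h2 := weave_append_weave (P := P) (Q := Q.vpack (t.count Letter.p))
      (Q' := Q.hpack (Q.size - t.count Letter.p)) (R := R) (s := Letter₃.wordPQ w') (t := t)
      (v := wordLeft w') (pos := pos) (i := 0) (l := 0) hP.triangular' (hQ.hpack (by omega))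
      (hQ.vpack hbl).triangular' hR (by omega) (by rw [vpack_size]; omega) (by omega)
      (by rw [hpack_size]; omega) hd (by rwa [zero_add])
    simp only [vpack_size, add_zero, zero_add] at h2
    rw [h2, ← hcut.2]
    have hlen := length_eq_count_add_count t
    have hgap' : 0 < t.length → P.IsGlobalDescent pos := fun ht =>
      hgap (List.ne_nil_of_length_pos ht)
    have hZ := hQR.isPipeDream
    have hZle : t.length ≤ (weave (t ++ Letter₃.wordQR w') 0 0 Q R).size := by rw [hZ.2]; omega
    rw [zero_add, zero_add] at h1
    have h3 := h1.map (l := t.count Letter.p) (l' := t.count Letter.q) (b := 0) (c := 0)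
      (u := t.length)
      (P' := P.insertAt pos ((weave (t ++ Letter₃.wordQR w') 0 0 Q R).vpack t.length))
      (fun x hx hx' => (flush_descent_right hP hZ.1 hgap' hZle (by omega)).2 hx')
      (fun y => (hb.hpack_iff hQ).2) (fun y => (hc.hpack_iff hR).2) rfl
      (by rw [hpack_size]; omega) (by rw [hpack_size]; omega)
    rw [add_right_comm] at h3
    exact ih w'.length (by rw [← hn]; simp; omega) (isPipeDream_flush hP hZ.1 hgap' hZle)
      (hQ.hpack (by omega)) (hR.hpack (by omega)) h3 rfl

end Filling

namespace Filling

variable {F G P Q R : Filling}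

/-! ### Tangled insertions of shuffles -/

/-- The tangled insertions along shuffles are pipe dreams. -/
lemma isPipeDream_tangle (hR : R.IsPipeDream) (hG : G.IsPipeDream) {s : List Letter}
    (hs : s ∈ R.shuffles G) : (tangle s R G).IsPipeDream := by
  rw [tangle_eq_weave hG]
  exact (weaving_of_mem_shuffles hR hG hs).isPipeDream.1

lemma tangle_size (hR : R.IsPipeDream) (hG : G.IsPipeDream) {s : List Letter}
    (hs : s ∈ R.shuffles G) : (tangle s R G).size = R.size + G.size := by
  rw [tangle_eq_weave hG]
  exact (weaving_of_mem_shuffles hR hG hs).isPipeDream.2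

lemma length_of_mem_shuffles {s : List Letter} (hs : s ∈ R.shuffles G) :
    s.length = R.size + G.size := by
  have := (mem_shuffles.1 hs).add_count
  rw [length_eq_count_add_count]
  omega

/-- The global descents of a tangled insertion are the places of the word where both pipe dreams
have global descents. -/
lemma isGlobalDescent_tangle (hR : R.IsPipeDream) (hG : G.IsPipeDream) {s t : List Letter}
    (hs : s ++ t ∈ R.shuffles G) : (tangle (s ++ t) R G).IsGlobalDescent s.length ↔
      R.IsGlobalDescent (s.count Letter.p) ∧ G.IsGlobalDescent (s.count Letter.q) := by
  rw [tangle_eq_weave hG]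
  simpa using (weaving_of_mem_shuffles hR hG hs).cut.1

lemma vpack_tangle (hR : R.IsPipeDream) (hG : G.IsPipeDream) {s t : List Letter}
    (hs : s ++ t ∈ R.shuffles G) (hp : R.IsGlobalDescent (s.count Letter.p))
    (hq : G.IsGlobalDescent (s.count Letter.q)) :
    (tangle (s ++ t) R G).vpack s.length =
      tangle s (R.vpack (s.count Letter.p)) (G.vpack (s.count Letter.q)) := by
  rw [tangle_eq_weave hG, tangle_eq_weave (hG.vpack hq.le)]
  simpa using ((weaving_of_mem_shuffles hR hG hs).cut.2 (by simpa using hp) (by simpa using hq)).2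

lemma hpack_tangle (hR : R.IsPipeDream) (hG : G.IsPipeDream) {s t : List Letter}
    (hs : s ++ t ∈ R.shuffles G) (hp : R.IsGlobalDescent (s.count Letter.p))
    (hq : G.IsGlobalDescent (s.count Letter.q)) :
    (tangle (s ++ t) R G).hpack ((tangle (s ++ t) R G).size - s.length) =
      tangle t (R.hpack (R.size - s.count Letter.p)) (G.hpack (G.size - s.count Letter.q)) := by
  rw [tangle_size hR hG hs, tangle_eq_weave hG, tangle_eq_weave (hG.hpack (by omega))]
  simpa using ((weaving_of_mem_shuffles hR hG hs).cut.2 (by simpa using hp) (by simpa using hq)).1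

/-- Cutting a continuation at global descents `α` and `β`. -/
lemma isContinuation_vpack_iff (hR : R.IsPipeDream) (hG : G.IsPipeDream) {α β : ℕ}
    (hα : R.IsGlobalDescent α) (hβ : G.IsGlobalDescent β) {s t : List Letter} {a b : ℕ} :
    IsContinuation (R.vpack α) (G.vpack β) a b s ∧ IsContinuation R G α β t ↔
      IsContinuation R G a b (s ++ t) ∧ a + s.count Letter.p = α ∧ b + s.count Letter.q = β := by
  induction s generalizing a b with
  | nil =>
    simp only [IsContinuation, vpack_size, List.nil_append, List.count_nil, add_zero]
    constructor
    · rintro ⟨⟨rfl, rfl⟩, h⟩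
      exact ⟨h, rfl, rfl⟩
    · rintro ⟨h, rfl, rfl⟩
      exact ⟨⟨rfl, rfl⟩, h⟩
  | cons x s ih =>
    cases x with
    | p =>
      have := ih (a := a + 1) (b := b)
      simp only [IsContinuation, List.cons_append, List.count_cons_self,
        List.count_cons_of_ne (show Letter.p ≠ Letter.q by decide), and_assoc]
      rw [this, show a + (s.count Letter.p + 1) = a + 1 + s.count Letter.p by omega]
      constructor
      · rintro ⟨h1, h2⟩
        exact ⟨(hβ.vpack_iff hG h1.le).1 h1, h2⟩
      · rintro ⟨h1, h2⟩
        exact ⟨(hβ.vpack_iff hG (by omega)).2 h1, h2⟩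
    | q =>
      have := ih (a := a) (b := b + 1)
      simp only [IsContinuation, List.cons_append, List.count_cons_self,
        List.count_cons_of_ne (show Letter.q ≠ Letter.p by decide), and_assoc]
      rw [this, show b + (s.count Letter.q + 1) = b + 1 + s.count Letter.q by omega]
      constructor
      · rintro ⟨h1, h2⟩
        exact ⟨(hα.vpack_iff hR h1.le).1 h1, h2⟩
      · rintro ⟨h1, h2⟩
        exact ⟨(hα.vpack_iff hR (by omega)).2 h1, h2⟩

lemma isContinuation_hpack_iff (hR : R.IsPipeDream) (hG : G.IsPipeDream) {α β : ℕ}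
    (hα : R.IsGlobalDescent α) (hβ : G.IsGlobalDescent β) {t : List Letter} {a b : ℕ} :
    IsContinuation (R.hpack (R.size - α)) (G.hpack (G.size - β)) a b t ↔
      IsContinuation R G (α + a) (β + b) t := by
  have h1 := hα.le
  have h2 := hβ.le
  induction t generalizing a b with
  | nil => simp only [IsContinuation, hpack_size]; omega
  | cons x t ih =>
    cases x with
    | p => exact and_congr (hβ.hpack_iff hG) (ih (a := a + 1) (b := b))
    | q => exact and_congr (hα.hpack_iff hR) (ih (a := a) (b := b + 1))

/-- Cutting a shuffle at global descents yields shuffles of the packings, and conversely. -/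
lemma append_mem_shuffles_iff (hR : R.IsPipeDream) (hG : G.IsPipeDream) {α β : ℕ}
    (hα : R.IsGlobalDescent α) (hβ : G.IsGlobalDescent β) {s t : List Letter} :
    s ∈ (R.vpack α).shuffles (G.vpack β) ∧
        t ∈ (R.hpack (R.size - α)).shuffles (G.hpack (G.size - β)) ↔
      s ++ t ∈ R.shuffles G ∧ s.count Letter.p = α ∧ s.count Letter.q = β := by
  rw [mem_shuffles, mem_shuffles, mem_shuffles, isContinuation_hpack_iff hR hG hα hβ, add_zero,
    add_zero, isContinuation_vpack_iff hR hG hα hβ, zero_add, zero_add]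

lemma isContinuation₃_mergeLeft (hP : P.IsPipeDream) (hQ : Q.IsPipeDream) {w : List Letter₃} :
    IsContinuation₃ P Q R 0 0 0 w ↔ Letter₃.wordPQ w ∈ P.shuffles Q ∧
      Letter₃.wordLeft w ∈ (tangle (Letter₃.wordPQ w) P Q).shuffles R := by
  by_cases h : Letter₃.wordPQ w ∈ P.shuffles Q
  · rw [isContinuation₃_iff_left (T := tangle (Letter₃.wordPQ w) P Q) (tangle_size hP hQ h),
      mem_shuffles, mem_shuffles]
    intro u v huv
    simp only [zero_add]
    rw [huv] at h ⊢
    exact isGlobalDescent_tangle hP hQ h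
  · exact ⟨fun h' => absurd (mem_shuffles.2 h'.wordPQ) h, fun h' => absurd h'.1 h⟩

lemma isContinuation₃_mergeRight (hQ : Q.IsPipeDream) (hR : R.IsPipeDream) {w : List Letter₃} :
    IsContinuation₃ P Q R 0 0 0 w ↔ Letter₃.wordQR w ∈ Q.shuffles R ∧
      Letter₃.wordRight w ∈ P.shuffles (tangle (Letter₃.wordQR w) Q R) := by
  by_cases h : Letter₃.wordQR w ∈ Q.shuffles R
  · rw [isContinuation₃_iff_right (T := tangle (Letter₃.wordQR w) Q R) (tangle_size hQ hR h),
      mem_shuffles, mem_shuffles]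
    intro u v huv
    simp only [zero_add]
    rw [huv] at h ⊢
    exact isGlobalDescent_tangle hQ hR h
  · exact ⟨fun h' => absurd (mem_shuffles.2 h'.wordQR) h, fun h' => absurd h'.1 h⟩

/-- Sums over the iterated tangled insertions of three pipe dreams do not depend on the bracketing:
both sides are sums over the shuffles of three words. -/
lemma sum_tangle_tangle {M : Type*} [AddCommMonoid M] (f : Filling → M) (hP : P.IsPipeDream)
    (hQ : Q.IsPipeDream) (hR : R.IsPipeDream) :
    ∑ s ∈ P.shuffles Q, ∑ t ∈ (tangle s P Q).shuffles R, f (tangle t (tangle s P Q) R) =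
      ∑ s ∈ Q.shuffles R, ∑ t ∈ P.shuffles (tangle s Q R), f (tangle t P (tangle s Q R)) := by
  rw [Finset.sum_sigma', Finset.sum_sigma']
  have hL : ∀ s t, s ∈ P.shuffles Q → t ∈ (tangle s P Q).shuffles R →
      t.count Letter.p = s.length := fun s t hs ht => by
    have h1 := (mem_shuffles.1 ht).add_count.1
    rw [tangle_size hP hQ hs] at h1
    rw [length_of_mem_shuffles hs]
    omega
  have hRt : ∀ s t, s ∈ Q.shuffles R → t ∈ P.shuffles (tangle s Q R) →
      t.count Letter.q = s.length := fun s t hs ht => by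
    have h1 := (mem_shuffles.1 ht).add_count.2
    rw [tangle_size hQ hR hs] at h1
    rw [length_of_mem_shuffles hs]
    omega
  refine Finset.sum_nbij'
    (fun x => ⟨Letter₃.wordQR (Letter₃.mergeLeft x.1 x.2),
      Letter₃.wordRight (Letter₃.mergeLeft x.1 x.2)⟩)
    (fun x => ⟨Letter₃.wordPQ (Letter₃.mergeRight x.1 x.2),
      Letter₃.wordLeft (Letter₃.mergeRight x.1 x.2)⟩) ?_ ?_ ?_ ?_ ?_
  · rintro ⟨s, t⟩ h
    rw [Finset.mem_sigma] at h ⊢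
    obtain ⟨h1, h2⟩ := Letter₃.word_mergeLeft (hL s t h.1 h.2)
    refine (isContinuation₃_mergeRight hQ hR).1 ((isContinuation₃_mergeLeft hP hQ).2 ?_)
    rw [h1, h2]
    exact h
  · rintro ⟨s, t⟩ h
    rw [Finset.mem_sigma] at h ⊢
    obtain ⟨h1, h2⟩ := Letter₃.word_mergeRight (hRt s t h.1 h.2)
    refine (isContinuation₃_mergeLeft hP hQ).1 ((isContinuation₃_mergeRight hQ hR).2 ?_)
    rw [h1, h2]
    exact h
  · rintro ⟨s, t⟩ h
    rw [Finset.mem_sigma] at h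
    obtain ⟨h1, h2⟩ := Letter₃.word_mergeLeft (hL s t h.1 h.2)
    simp only [Letter₃.mergeRight_word, h1, h2]
  · rintro ⟨s, t⟩ h
    rw [Finset.mem_sigma] at h
    obtain ⟨h1, h2⟩ := Letter₃.word_mergeRight (hRt s t h.1 h.2)
    simp only [Letter₃.mergeLeft_word, h1, h2]
  · rintro ⟨s, t⟩ h
    rw [Finset.mem_sigma] at h
    obtain ⟨h1, h2⟩ := Letter₃.word_mergeLeft (hL s t h.1 h.2)
    have hw : IsContinuation₃ P Q R 0 0 0 (Letter₃.mergeLeft s t) := by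
      rw [isContinuation₃_mergeLeft hP hQ, h1, h2]
      exact h
    have := weave_weave hP hQ hR hw
    rw [h1, h2] at this
    have hqr := (isContinuation₃_mergeRight hQ hR).1 hw
    simp only
    rw [tangle_eq_weave hR, tangle_eq_weave hQ, tangle_eq_weave (isPipeDream_tangle hQ hR hqr.1),
      tangle_eq_weave hR, this]

/-- The set of global descents. -/
def descents (F : Filling) : Finset ℕ := (Finset.range (F.size + 1)).filter F.IsGlobalDescent

lemma mem_descents {F : Filling} {γ : ℕ} : γ ∈ F.descents ↔ F.IsGlobalDescent γ := by
  rw [descents, Finset.mem_filter, Finset.mem_range, and_iff_right_iff_imp]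
  exact fun h => Nat.lt_succ_of_le h.le

/-- The pairs of packings of all tangled insertions of two pipe dreams are the pairs of tangled
insertions of their packings. -/
lemma sum_packings_tangle {M : Type*} [AddCommMonoid M] (f : Filling → Filling → M)
    (hR : R.IsPipeDream) (hG : G.IsPipeDream) :
    ∑ s ∈ R.shuffles G, ∑ γ ∈ (tangle s R G).descents,
        f ((tangle s R G).vpack γ) ((tangle s R G).hpack ((tangle s R G).size - γ)) =
      ∑ x ∈ R.descents ×ˢ G.descents,
        ∑ y ∈ (R.vpack x.1).shuffles (G.vpack x.2) ×ˢ
            (R.hpack (R.size - x.1)).shuffles (G.hpack (G.size - x.2)),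
          f (tangle y.1 (R.vpack x.1) (G.vpack x.2))
            (tangle y.2 (R.hpack (R.size - x.1)) (G.hpack (G.size - x.2))) := by
  rw [Finset.sum_sigma', Finset.sum_sigma']
  have key : ∀ s γ, s ∈ R.shuffles G → γ ∈ (tangle s R G).descents →
      (s.take γ).length = γ ∧ R.IsGlobalDescent ((s.take γ).count Letter.p) ∧
        G.IsGlobalDescent ((s.take γ).count Letter.q) := fun s γ hs hγ => by
    have h1 : γ ≤ s.length := by
      rw [length_of_mem_shuffles hs, ← tangle_size hR hG hs]
      exact (mem_descents.1 hγ).le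
    have h2 : (s.take γ).length = γ := by rw [List.length_take]; omega
    have h3 := isGlobalDescent_tangle hR hG (s := s.take γ) (t := s.drop γ)
      (by rwa [List.take_append_drop])
    rw [List.take_append_drop, h2] at h3
    exact ⟨h2, h3.1 (mem_descents.1 hγ)⟩
  refine Finset.sum_nbij'
    (fun x => ⟨((x.1.take x.2).count Letter.p, (x.1.take x.2).count Letter.q),
      (x.1.take x.2, x.1.drop x.2)⟩)
    (fun x => ⟨x.2.1 ++ x.2.2, x.2.1.length⟩) ?_ ?_ ?_ ?_ ?_
  · rintro ⟨s, γ⟩ h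
    simp only [Finset.mem_sigma, Finset.mem_product, mem_descents] at h ⊢
    obtain ⟨h1, h2, h3⟩ := key s γ h.1 (mem_descents.2 h.2)
    refine ⟨⟨h2, h3⟩, (append_mem_shuffles_iff hR hG h2 h3).2 ⟨?_, rfl, rfl⟩⟩
    rw [List.take_append_drop]
    exact h.1
  · rintro ⟨⟨α, β⟩, ⟨s, t⟩⟩ h
    simp only [Finset.mem_sigma, Finset.mem_product, mem_descents] at h ⊢
    obtain ⟨h1, rfl, rfl⟩ := (append_mem_shuffles_iff hR hG h.1.1 h.1.2).1 h.2
    exact ⟨h1, (isGlobalDescent_tangle hR hG h1).2 h.1⟩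
  · rintro ⟨s, γ⟩ h
    rw [Finset.mem_sigma] at h
    simp only [List.take_append_drop, (key s γ h.1 h.2).1]
  · rintro ⟨⟨α, β⟩, ⟨s, t⟩⟩ h
    simp only [Finset.mem_sigma, Finset.mem_product, mem_descents] at h
    obtain ⟨h1, rfl, rfl⟩ := (append_mem_shuffles_iff hR hG h.1.1 h.1.2).1 h.2
    simp
  · rintro ⟨s, γ⟩ h
    rw [Finset.mem_sigma] at h
    obtain ⟨h1, h2, h3⟩ := key s γ h.1 h.2
    have hs : s.take γ ++ s.drop γ ∈ R.shuffles G := by rw [List.take_append_drop]; exact h.1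
    have h4 := vpack_tangle hR hG hs h2 h3
    have h5 := hpack_tangle hR hG hs h2 h3
    rw [List.take_append_drop, h1] at h4 h5
    simp only
    rw [h4, h5]

/-- Both ways to iterate the untangling are indexed by the pairs `γ ≤ δ` of global descents. -/
lemma sum_packings_packings {M : Type*} [AddCommMonoid M] (f : Filling → Filling → Filling → M)
    (hP : P.IsPipeDream) :
    ∑ δ ∈ P.descents, ∑ γ ∈ (P.vpack δ).descents,
        f ((P.vpack δ).vpack γ) ((P.vpack δ).hpack (δ - γ)) (P.hpack (P.size - δ)) =
      ∑ γ ∈ P.descents, ∑ ε ∈ (P.hpack (P.size - γ)).descents,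
        f (P.vpack γ) ((P.hpack (P.size - γ)).vpack ε)
          ((P.hpack (P.size - γ)).hpack (P.size - γ - ε)) := by
  rw [Finset.sum_sigma', Finset.sum_sigma']
  refine Finset.sum_nbij' (fun x => ⟨x.2, x.1 - x.2⟩) (fun x => ⟨x.1 + x.2, x.1⟩) ?_ ?_ ?_ ?_ ?_
  · rintro ⟨δ, γ⟩ h
    simp only [Finset.mem_sigma, mem_descents] at h ⊢
    have hle : γ ≤ δ := h.2.le
    have hγ := (h.1.vpack_iff hP hle).1 h.2
    exact ⟨hγ, by rw [hγ.hpack_iff hP, Nat.add_sub_cancel' hle]; exact h.1⟩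
  · rintro ⟨γ, ε⟩ h
    simp only [Finset.mem_sigma, mem_descents] at h ⊢
    have hδ := (h.1.hpack_iff hP).1 h.2
    exact ⟨hδ, (hδ.vpack_iff hP (by omega)).2 h.1⟩
  · rintro ⟨δ, γ⟩ h
    simp only [Finset.mem_sigma, mem_descents] at h
    have hle : γ ≤ δ := h.2.le
    simp only [Nat.add_sub_cancel' hle]
  · rintro ⟨γ, ε⟩ h
    simp
  · rintro ⟨δ, γ⟩ h
    simp only [Finset.mem_sigma, mem_descents] at h
    have hle : γ ≤ δ := h.2.le
    have hγ := (h.1.vpack_iff hP hle).1 h.2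
    have hδle := h.1.le
    simp only
    rw [hP.vpack_vpack hle hδle, hγ.hpack_vpack_comm h.1 hP hle,
      hP.hpack_hpack (by omega) (by omega), show P.size - γ - (δ - γ) = P.size - δ by omega]

/-! ### Pipe dreams of size zero -/

lemma Triangular.eq_elbow (hF : F.Triangular) (h : F.size = 0) : F = PipeDream.elbow.1 := by
  refine Filling.ext h (Finset.eq_empty_of_forall_notMem fun ⟨i, j⟩ hc => ?_)
  have := hF i j hc
  omega

lemma shuffles_of_right_size_eq_zero (hG : G.IsPipeDream) (h : G.size = 0) :
    P.shuffles G = {List.replicate P.size Letter.p} := by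
  ext s
  rw [mem_shuffles, isContinuation_iff, Finset.mem_singleton, h]
  constructor
  · rintro ⟨h1, h2, -⟩
    rw [List.eq_replicate_iff, length_eq_count_add_count]
    refine ⟨by omega, fun x hx => ?_⟩
    have := List.count_pos_iff.2 hx
    cases x with
    | p => rfl
    | q => omega
  · rintro rfl
    refine ⟨by simp, by simp [List.count_replicate], fun i hi => ⟨fun _ => ?_, fun hq => ?_⟩⟩
    · simpa [List.take_replicate, List.count_replicate] using
        hG.triangular'.isGlobalDescent_zero
    · simp [List.getElem?_replicate] at hq

lemma shuffles_of_left_size_eq_zero (hP : P.IsPipeDream) (h : P.size = 0) :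
    P.shuffles G = {List.replicate G.size Letter.q} := by
  ext s
  rw [mem_shuffles, isContinuation_iff, Finset.mem_singleton, h]
  constructor
  · rintro ⟨h1, h2, -⟩
    rw [List.eq_replicate_iff, length_eq_count_add_count]
    refine ⟨by omega, fun x hx => ?_⟩
    have := List.count_pos_iff.2 hx
    cases x with
    | p => omega
    | q => rfl
  · rintro rfl
    refine ⟨by simp [List.count_replicate], by simp, fun i hi => ⟨fun hp => ?_, fun _ => ?_⟩⟩
    · simp [List.getElem?_replicate] at hp
    · simpa [List.take_replicate, List.count_replicate] using
        hP.triangular'.isGlobalDescent_zero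

lemma tangle_replicate_p (hG : G.IsPipeDream) (m : ℕ) :
    tangle (List.replicate m Letter.p) P G = P := by
  rw [tangle_eq_weave hG, ← List.append_nil (List.replicate _ _), weave_replicate_p hG, weave_nil,
    hG.insertAt_vpack_zero]

lemma tangle_replicate_q (hG : G.IsPipeDream) :
    tangle (List.replicate G.size Letter.q) PipeDream.elbow.1 G = G := by
  rw [tangle_eq_weave hG, ← List.append_nil (List.replicate _ _), weave_replicate_q, weave_nil,
    zero_add, hG.vpack_self]
  refine Filling.ext (Nat.zero_add _) (Finset.ext fun ⟨r, c⟩ => ?_)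
  rw [mem_insertAt]
  have h0 : PipeDream.elbow.1.size = 0 := rfl
  have h1 : ∀ a b, (a, b) ∉ PipeDream.elbow.1.cross := fun a b => Finset.notMem_empty _
  constructor
  · rintro (⟨a, b, h, -⟩ | ⟨a, b, h, h2, h3⟩ | h | h)
    · exact absurd h (h1 a b)
    · obtain rfl : a = r := by omega
      obtain rfl : b = c := by omega
      exact h
    · omega
    · omega
  · exact fun h => Or.inr (Or.inl ⟨r, c, h, by omega, by omega⟩)

lemma descents_of_size_eq_zero (hF : F.IsPipeDream) (h : F.size = 0) : F.descents = {0} := by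
  ext γ
  rw [mem_descents, Finset.mem_singleton]
  refine ⟨fun hγ => by have := hγ.le; omega, ?_⟩
  rintro rfl
  exact hF.triangular'.isGlobalDescent_zero

/-- The global descent `F.size` is singled out, as the recursion of the antipode is solved for its
term. -/
lemma sum_descents {M : Type*} [AddCommMonoid M] (hF : F.IsPipeDream) (f : ℕ → M) :
    ∑ γ ∈ F.descents, f γ =
      ∑ γ : Fin F.size, (if F.IsGlobalDescent γ then f γ else 0) + f F.size := by
  rw [descents, Finset.sum_filter, Finset.sum_range_succ, if_pos hF.isGlobalDescent_size,
    Finset.sum_range]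

end Filling

open Filling

/-! ### The algebra of pipe dreams -/

/-- The vector space with basis the pipe dreams. It is a copy of `HP k`, as the product of pipe
dreams must not be confused with the pointwise product of finitely supported functions. -/
def PipeDreamAlgebra (k : Type u) [Field k] : Type u := HP k

namespace PipeDreamAlgebra

variable (k : Type u) [Field k]

noncomputable instance : AddCommGroup (PipeDreamAlgebra k) :=
  inferInstanceAs (AddCommGroup (PipeDream →₀ k))

noncomputable instance : Module k (PipeDreamAlgebra k) :=
  inferInstanceAs (Module k (PipeDream →₀ k))

/-- The identity from `HP k` to its copy. -/
noncomputable def ofHP : HP k ≃ₗ[k] PipeDreamAlgebra k := LinearEquiv.refl k (HP k)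

/-- The basis element of a pipe dream, and `0` for other fillings. It is defined for all fillings,
as packings and tangled insertions are operations on fillings. -/
noncomputable def of (F : Filling) : PipeDreamAlgebra k := ofHP k (HP.of k F)

/-- The linear extension of a function on pipe dreams. -/
noncomputable def lift {M : Type*} [AddCommGroup M] [Module k M] (f : Filling → M) :
    PipeDreamAlgebra k →ₗ[k] M :=
  (Finsupp.linearCombination k fun P : PipeDream => f P.1) ∘ₗ (ofHP k).symm.toLinearMap

variable {k} {F P Q : Filling}

lemma hp_of (hF : F.IsPipeDream) : HP.of k F = Finsupp.single ⟨F, hF⟩ 1 := dif_pos hF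

lemma ofHP_single (P : PipeDream) : ofHP k (Finsupp.single P 1) = of k P.1 := by
  rw [of, hp_of P.2]

lemma ofHP_symm_of (hF : F.IsPipeDream) : (ofHP k).symm (of k F) = Finsupp.single ⟨F, hF⟩ 1 := by
  rw [of, LinearEquiv.symm_apply_apply, hp_of hF]

lemma lift_of {M : Type*} [AddCommGroup M] [Module k M] (f : Filling → M) (hF : F.IsPipeDream) :
    lift k f (of k F) = f F := by
  rw [lift, LinearMap.comp_apply, LinearEquiv.coe_coe, ofHP_symm_of hF,
    Finsupp.linearCombination_single, one_smul]

lemma hom_ext {M : Type*} [AddCommMonoid M] [Module k M] {f g : PipeDreamAlgebra k →ₗ[k] M}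
    (h : ∀ F : Filling, F.IsPipeDream → f (of k F) = g (of k F)) : f = g := by
  have : f ∘ₗ (ofHP k).toLinearMap = g ∘ₗ (ofHP k).toLinearMap := by
    refine Finsupp.lhom_ext' fun P => LinearMap.ext_ring ?_
    simpa [ofHP_single] using h P.1 P.2
  exact LinearMap.ext fun x => by simpa using LinearMap.congr_fun this ((ofHP k).symm x)

noncomputable instance : Mul (PipeDreamAlgebra k) where
  mul x y := ofHP k (HP.product k ((ofHP k).symm x) ((ofHP k).symm y))

noncomputable instance : One (PipeDreamAlgebra k) where
  one := of k PipeDream.elbow.1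

lemma ofHP_product (x y : HP k) : ofHP k (HP.product k x y) = ofHP k x * ofHP k y := rfl

lemma one_def : (1 : PipeDreamAlgebra k) = of k PipeDream.elbow.1 := rfl

lemma of_mul_of (hP : P.IsPipeDream) (hQ : Q.IsPipeDream) :
    of k P * of k Q = ∑ s ∈ P.shuffles Q, of k (tangle s P Q) := by
  change ofHP k (HP.product k ((ofHP k).symm (of k P)) ((ofHP k).symm (of k Q))) = _
  rw [ofHP_symm_of hP, ofHP_symm_of hQ, HP.product]
  simp [of]

lemma of_eq_one (hF : F.IsPipeDream) (h : F.size = 0) : of k F = 1 := by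
  rw [hF.triangular'.eq_elbow h, one_def]

variable (k) in
/-- The product of the algebra of pipe dreams as a bilinear map. -/
noncomputable def mulHom : PipeDreamAlgebra k →ₗ[k] PipeDreamAlgebra k →ₗ[k] PipeDreamAlgebra k :=
  LinearMap.mk₂ k (· * ·)
    (fun x y z => by
      change ofHP k (HP.product k ((ofHP k).symm (x + y)) ((ofHP k).symm z)) = _
      rw [map_add, map_add, LinearMap.add_apply, map_add]; rfl)
    (fun c x y => by
      change ofHP k (HP.product k ((ofHP k).symm (c • x)) ((ofHP k).symm y)) = _
      rw [map_smul, map_smul, LinearMap.smul_apply, map_smul]; rfl)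
    (fun x y z => by
      change ofHP k (HP.product k ((ofHP k).symm x) ((ofHP k).symm (y + z))) = _
      rw [map_add, map_add, map_add]; rfl)
    (fun c x y => by
      change ofHP k (HP.product k ((ofHP k).symm x) ((ofHP k).symm (c • y))) = _
      rw [map_smul, map_smul, map_smul]; rfl)

lemma mulHom_of (hP : P.IsPipeDream) (hQ : Q.IsPipeDream) :
    mulHom k (of k P) (of k Q) = ∑ s ∈ P.shuffles Q, of k (tangle s P Q) := of_mul_of hP hQ

@[elab_as_elim]
lemma induction_on {p : PipeDreamAlgebra k → Prop} (x : PipeDreamAlgebra k) (zero : p 0)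
    (add : ∀ x y, p x → p y → p (x + y)) (smul : ∀ (c : k) x, p x → p (c • x))
    (of : ∀ F : Filling, F.IsPipeDream → p (of k F)) : p x := by
  have h : ∀ y : HP k, p (ofHP k y) := fun y => by
    induction y using Finsupp.induction_linear with
    | zero => rwa [map_zero]
    | add y z hy hz => rw [map_add]; exact add _ _ hy hz
    | single P c =>
      rw [← mul_one c, ← smul_eq_mul, ← Finsupp.smul_single, map_smul, ofHP_single]
      exact smul _ _ (of _ P.2)
  simpa using h ((ofHP k).symm x)

lemma mulHom_assoc (x y z : PipeDreamAlgebra k) :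
    mulHom k (mulHom k x y) z = mulHom k x (mulHom k y z) := by
  induction x using induction_on with
  | zero => simp
  | add x x' h h' => simp [h, h']
  | smul c x h => simp [h]
  | of P hP =>
  induction y using induction_on with
  | zero => simp
  | add y y' h h' => simp [h, h']
  | smul c y h => simp [h]
  | of Q hQ =>
  induction z using induction_on with
  | zero => simp
  | add z z' h h' => simp [h, h']
  | smul c z h => simp [h]
  | of R hR =>
  rw [mulHom_of hP hQ, mulHom_of hQ hR, map_sum, map_sum, LinearMap.sum_apply]
  rw [Finset.sum_congr rfl fun s hs => mulHom_of (isPipeDream_tangle hP hQ hs) hR,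
    Finset.sum_congr rfl fun s hs => mulHom_of hP (isPipeDream_tangle hQ hR hs)]
  exact sum_tangle_tangle (of k) hP hQ hR

lemma isPipeDream_elbow : PipeDream.elbow.1.IsPipeDream := PipeDream.elbow.2

lemma mulHom_one_left (x : PipeDreamAlgebra k) : mulHom k 1 x = x := by
  induction x using induction_on with
  | zero => simp
  | add x x' h h' => simp [h, h']
  | smul c x h => simp [h]
  | of P hP =>
    rw [one_def, mulHom_of isPipeDream_elbow hP,
      shuffles_of_left_size_eq_zero isPipeDream_elbow rfl, Finset.sum_singleton,
      tangle_replicate_q hP]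

lemma mulHom_one_right (x : PipeDreamAlgebra k) : mulHom k x 1 = x := by
  induction x using induction_on with
  | zero => simp
  | add x x' h h' => simp [h, h']
  | smul c x h => simp [h]
  | of P hP =>
    rw [one_def, mulHom_of hP isPipeDream_elbow,
      shuffles_of_right_size_eq_zero isPipeDream_elbow rfl, Finset.sum_singleton,
      tangle_replicate_p isPipeDream_elbow]

noncomputable instance : Ring (PipeDreamAlgebra k) :=
  { (inferInstance : AddCommGroup (PipeDreamAlgebra k)) with
    mul := (· * ·)
    one := 1
    mul_assoc := mulHom_assoc
    one_mul := mulHom_one_left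
    mul_one := mulHom_one_right
    zero_mul := fun x => (mulHom k).map_zero₂ x
    mul_zero := fun x => (mulHom k x).map_zero
    left_distrib := fun x y z => (mulHom k x).map_add y z
    right_distrib := fun x y z => (mulHom k).map_add₂ x y z }

noncomputable instance : Algebra k (PipeDreamAlgebra k) :=
  Algebra.ofModule (fun c x y => (mulHom k).map_smul₂ c x y)
    fun c x y => (mulHom k x).map_smul c y

/-! ### The coalgebra of pipe dreams -/

noncomputable instance : CoalgebraStruct k (PipeDreamAlgebra k) where
  comul := TensorProduct.map (ofHP k).toLinearMap (ofHP k).toLinearMap ∘ₗ HP.coproduct k ∘ₗ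
    (ofHP k).symm.toLinearMap
  counit := Finsupp.lapply PipeDream.elbow ∘ₗ (ofHP k).symm.toLinearMap

lemma comul_ofHP (x : HP k) : Coalgebra.comul (R := k) (ofHP k x) =
    TensorProduct.map (ofHP k).toLinearMap (ofHP k).toLinearMap (HP.coproduct k x) := by
  change TensorProduct.map (ofHP k).toLinearMap (ofHP k).toLinearMap
    (HP.coproduct k ((ofHP k).symm (ofHP k x))) = _
  rw [LinearEquiv.symm_apply_apply]

lemma comul_of (hF : F.IsPipeDream) : Coalgebra.comul (R := k) (of k F) =
    ∑ γ ∈ F.descents, of k (F.vpack γ) ⊗ₜ[k] of k (F.hpack (F.size - γ)) := by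
  rw [of, comul_ofHP, hp_of hF, HP.coproduct, Finsupp.linearCombination_single, one_smul, map_sum]
  rfl

lemma counit_of (hF : F.IsPipeDream) :
    Coalgebra.counit (R := k) (of k F) = if F.size = 0 then 1 else 0 := by
  have h : (⟨F, hF⟩ : PipeDream) = PipeDream.elbow ↔ F.size = 0 :=
    ⟨fun h => congrArg (fun P : PipeDream => P.1.size) h,
      fun h => Subtype.ext (hF.triangular'.eq_elbow h)⟩
  change (ofHP k).symm (of k F) PipeDream.elbow = _
  rw [ofHP_symm_of hF, Finsupp.single_apply, if_congr h rfl rfl]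

noncomputable instance : Coalgebra k (PipeDreamAlgebra k) where
  coassoc := hom_ext fun P hP => by
    rw [LinearMap.comp_apply, LinearMap.comp_apply, LinearMap.comp_apply, comul_of hP, map_sum,
      map_sum, map_sum]
    simp only [LinearMap.rTensor_tmul, LinearMap.lTensor_tmul]
    rw [Finset.sum_congr rfl fun γ hγ => congrArg _ (congrArg (· ⊗ₜ[k] _)
        (comul_of (hP.vpack (mem_descents.1 hγ).le))),
      Finset.sum_congr (s₁ := P.descents) (f := fun γ => _ ⊗ₜ[k] _) rfl fun γ _ =>
        congrArg (_ ⊗ₜ[k] ·) (comul_of (hP.hpack (Nat.sub_le P.size γ)))]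
    simp only [TensorProduct.sum_tmul, TensorProduct.tmul_sum, map_sum, LinearEquiv.coe_coe,
      TensorProduct.assoc_tmul, vpack_size, hpack_size]
    exact sum_packings_packings (fun F G H => of k F ⊗ₜ[k] (of k G ⊗ₜ[k] of k H)) hP
  rTensor_counit_comp_comul := hom_ext fun P hP => by
    rw [LinearMap.comp_apply, comul_of hP, map_sum, Finset.sum_eq_single 0]
    · rw [LinearMap.rTensor_tmul, counit_of (hP.vpack (Nat.zero_le _)), vpack_size, if_pos rfl,
        Nat.sub_zero, hP.hpack_self, TensorProduct.mk_apply]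
    · intro γ hγ h0
      rw [LinearMap.rTensor_tmul, counit_of (hP.vpack (mem_descents.1 hγ).le), vpack_size,
        if_neg h0, TensorProduct.zero_tmul]
    · exact fun h => absurd (mem_descents.2 hP.triangular'.isGlobalDescent_zero) h
  lTensor_counit_comp_comul := hom_ext fun P hP => by
    rw [LinearMap.comp_apply, comul_of hP, map_sum, Finset.sum_eq_single P.size]
    · rw [LinearMap.lTensor_tmul, counit_of (hP.hpack (Nat.sub_le _ _)), hpack_size, Nat.sub_self,
        if_pos rfl, hP.vpack_self, LinearMap.flip_apply, TensorProduct.mk_apply]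
    · intro γ hγ h0
      have := (mem_descents.1 hγ).le
      rw [LinearMap.lTensor_tmul, counit_of (hP.hpack (Nat.sub_le _ _)), hpack_size,
        if_neg (by omega), TensorProduct.tmul_zero]
    · exact fun h => absurd (mem_descents.2 hP.isGlobalDescent_size) h

/-! ### The Hopf algebra of pipe dreams -/

lemma comul_of_mul_of (hP : P.IsPipeDream) (hQ : Q.IsPipeDream) :
    Coalgebra.comul (R := k) (of k P * of k Q) =
      Coalgebra.comul (R := k) (of k P) * Coalgebra.comul (R := k) (of k Q) := by
  rw [of_mul_of hP hQ, map_sum, Finset.sum_congr rfl fun s hs =>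
    comul_of (isPipeDream_tangle hP hQ hs), sum_packings_tangle (fun F G => of k F ⊗ₜ[k] of k G)
    hP hQ, comul_of hP, comul_of hQ, Finset.sum_mul_sum, Finset.sum_product]
  refine Finset.sum_congr rfl fun α hα => Finset.sum_congr rfl fun β hβ => ?_
  rw [mem_descents] at hα hβ
  rw [Algebra.TensorProduct.tmul_mul_tmul, of_mul_of (hP.vpack hα.le) (hQ.vpack hβ.le),
    of_mul_of (hP.hpack (Nat.sub_le _ _)) (hQ.hpack (Nat.sub_le _ _)), TensorProduct.sum_tmul,
    Finset.sum_product]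
  simp only [TensorProduct.tmul_sum]

lemma counit_of_mul_of (hP : P.IsPipeDream) (hQ : Q.IsPipeDream) :
    Coalgebra.counit (R := k) (of k P * of k Q) =
      Coalgebra.counit (R := k) (of k P) * Coalgebra.counit (R := k) (of k Q) := by
  rcases Nat.eq_zero_or_pos P.size with h | h
  · rw [of_eq_one hP h, one_mul, one_def, counit_of isPipeDream_elbow, if_pos (by rfl), one_mul]
  · rw [of_mul_of hP hQ, map_sum, counit_of hP, if_neg h.ne', zero_mul]
    refine Finset.sum_eq_zero fun s hs => ?_
    rw [counit_of (isPipeDream_tangle hP hQ hs), if_neg (by rw [tangle_size hP hQ hs]; omega)]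

noncomputable instance : Bialgebra k (PipeDreamAlgebra k) :=
  { (inferInstance : Coalgebra k (PipeDreamAlgebra k)) with
    counit_one := by rw [one_def, counit_of isPipeDream_elbow, if_pos (by rfl)]
    mul_compr₂_counit := hom_ext fun P hP => hom_ext fun Q hQ => counit_of_mul_of hP hQ
    comul_one := by
      rw [one_def, comul_of isPipeDream_elbow, descents_of_size_eq_zero isPipeDream_elbow rfl,
        Finset.sum_singleton, of_eq_one (isPipeDream_elbow.vpack (Nat.zero_le _)) rfl,
        of_eq_one (isPipeDream_elbow.hpack (Nat.sub_le _ _)) rfl]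
      rfl
    mul_compr₂_comul := hom_ext fun P hP => hom_ext fun Q hQ => comul_of_mul_of hP hQ }

/-- The left convolution inverse, evaluated on fillings, of a linear map `g` with `g 1 = 1`: the
equation that says that it is a left inverse at a pipe dream determines its value there from those
at smaller pipe dreams. -/
noncomputable def leftInv (g : PipeDreamAlgebra k →ₗ[k] PipeDreamAlgebra k) (F : Filling) :
    PipeDreamAlgebra k :=
  if F.size = 0 then 1
  else -∑ γ : Fin F.size, if F.IsGlobalDescent γ then
    leftInv g (F.vpack γ) * g (of k (F.hpack (F.size - γ))) else 0
termination_by F.size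
decreasing_by rw [vpack_size]; exact γ.2

lemma lift_leftInv_one (g : PipeDreamAlgebra k →ₗ[k] PipeDreamAlgebra k) :
    lift k (leftInv g) 1 = 1 := by
  rw [one_def, lift_of _ isPipeDream_elbow, leftInv, if_pos (by rfl), one_def]

open WithConv in
lemma lift_leftInv_mul {g : PipeDreamAlgebra k →ₗ[k] PipeDreamAlgebra k} (hg : g 1 = 1) :
    toConv (lift k (leftInv g)) * toConv g = 1 := by
  refine WithConv.ofConv_injective (hom_ext fun F hF => ?_)
  change (toConv (lift k (leftInv g)) * toConv g) (of k F) = (1 : WithConv (_ →ₗ[k] _)) (of k F)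
  rw [LinearMap.convMul_apply, LinearMap.convOne_apply, comul_of hF, counit_of hF, map_sum, map_sum]
  simp only [TensorProduct.map_tmul, LinearMap.mul'_apply]
  rw [Finset.sum_congr rfl fun γ hγ => by rw [lift_of _ (hF.vpack (mem_descents.1 hγ).le)],
    sum_descents hF, Nat.sub_self, of_eq_one (hF.hpack (Nat.zero_le _)) rfl, hg, mul_one,
    hF.vpack_self, leftInv.eq_1 g F]
  split_ifs with h
  · have : IsEmpty (Fin F.size) := by rw [h]; infer_instance
    simp
  · simp

variable (k) in
/-- The antipode of the algebra of pipe dreams. -/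
noncomputable def antipodeHom : PipeDreamAlgebra k →ₗ[k] PipeDreamAlgebra k :=
  lift k (leftInv LinearMap.id)

open WithConv in
lemma antipodeHom_mul : toConv (antipodeHom k) * toConv LinearMap.id = 1 :=
  lift_leftInv_mul rfl

open WithConv in
/-- The left inverse `antipodeHom` of the identity has a left inverse too, which is then the
identity. -/
lemma mul_antipodeHom : toConv LinearMap.id * toConv (antipodeHom k) = 1 := by
  have h := lift_leftInv_mul (g := antipodeHom k) (lift_leftInv_one _)
  rwa [left_inv_eq_right_inv h antipodeHom_mul] at h

noncomputable instance : HopfAlgebra k (PipeDreamAlgebra k) where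
  antipode := antipodeHom k
  mul_antipode_rTensor_comul := congrArg WithConv.ofConv (antipodeHom_mul (k := k))
  mul_antipode_lTensor_comul := congrArg WithConv.ofConv (mul_antipodeHom (k := k))

/-! ### The grading -/

variable (k) in
/-- The span of the pipe dreams of size `n`. -/
noncomputable def grade (n : ℕ) : Submodule k (PipeDreamAlgebra k) :=
  (HP.degree k n).map (ofHP k).toLinearMap

lemma of_mem_grade (hF : F.IsPipeDream) : of k F ∈ grade k F.size :=
  ⟨Finsupp.single ⟨F, hF⟩ 1, Submodule.subset_span ⟨⟨F, hF⟩, rfl, rfl⟩, ofHP_single _⟩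

lemma of_mem_grade_of_size_eq {n : ℕ} (hF : F.IsPipeDream) (h : F.size = n) :
    of k F ∈ grade k n := h ▸ of_mem_grade hF

lemma grade_eq_span (n : ℕ) :
    grade k n = Submodule.span k {x | ∃ F : Filling, F.IsPipeDream ∧ F.size = n ∧ of k F = x} := by
  rw [grade, HP.degree, Submodule.map_span]
  congr 1
  ext x
  constructor
  · rintro ⟨-, ⟨P, h, rfl⟩, rfl⟩
    exact ⟨P.1, P.2, h, (ofHP_single P).symm⟩
  · rintro ⟨F, hF, h, rfl⟩
    exact ⟨_, ⟨⟨F, hF⟩, h, rfl⟩, ofHP_single _⟩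

lemma grade_le_iff {n : ℕ} {p : Submodule k (PipeDreamAlgebra k)} :
    grade k n ≤ p ↔ ∀ F : Filling, F.IsPipeDream → F.size = n → of k F ∈ p := by
  rw [grade_eq_span, Submodule.span_le]
  exact ⟨fun h F hF hn => h ⟨F, hF, hn, rfl⟩, fun h x ⟨F, hF, hn, hx⟩ => hx ▸ h F hF hn⟩

lemma degree_eq_supported (n : ℕ) :
    HP.degree k n = Finsupp.supported k k {P : PipeDream | P.1.size = n} := by
  rw [HP.degree, Finsupp.supported_eq_span_single]
  congr 1
  ext x
  exact ⟨fun ⟨P, h, hx⟩ => ⟨P, h, hx.symm⟩, fun ⟨P, h, hx⟩ => ⟨P, h, hx.symm⟩⟩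

lemma isInternal_grade : DirectSum.IsInternal (grade k) := by
  rw [DirectSum.isInternal_submodule_iff_iSupIndep_and_iSup_eq_top]
  constructor
  · refine iSupIndep.map_orderIso (f := Submodule.orderIsoMapComap (ofHP k)) (a := HP.degree k)
      fun n => ?_
    simp only [degree_eq_supported]
    refine Disjoint.mono_right (iSup₂_le fun m hm => ?_)
      (Finsupp.disjoint_supported_supported (s := {P : PipeDream | P.1.size = n})
        disjoint_compl_right)
    exact Finsupp.supported_mono fun P (hP : P.1.size = m) h => hm (hP.symm.trans h)
  · refine eq_top_iff.2 fun x _ => ?_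
    induction x using induction_on with
    | zero => exact zero_mem _
    | add x y hx hy => exact add_mem (hx trivial) (hy trivial)
    | smul c x hx => exact Submodule.smul_mem _ _ (hx trivial)
    | of F hF => exact Submodule.mem_iSup_of_mem _ (of_mem_grade hF)

lemma mul_mem_grade {m n : ℕ} {x y : PipeDreamAlgebra k} (hx : x ∈ grade k m)
    (hy : y ∈ grade k n) : x * y ∈ grade k (m + n) := by
  have h1 : ∀ P : Filling, P.IsPipeDream → P.size = m → grade k n ≤
      (grade k (m + n)).comap (LinearMap.mulLeft k (of k P)) := by
    rintro P hP rfl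
    refine grade_le_iff.2 ?_
    rintro Q hQ rfl
    rw [Submodule.mem_comap, LinearMap.mulLeft_apply, of_mul_of hP hQ]
    exact Submodule.sum_mem _ fun s hs =>
      of_mem_grade_of_size_eq (isPipeDream_tangle hP hQ hs) (tangle_size hP hQ hs)
  have h2 : grade k m ≤ (grade k (m + n)).comap (LinearMap.mulRight k y) :=
    grade_le_iff.2 fun P hP hm => h1 P hP hm hy
  exact h2 hx

lemma tmul_mem_range {m n : ℕ} {x y : PipeDreamAlgebra k} (hx : x ∈ grade k m)
    (hy : y ∈ grade k n) :
    x ⊗ₜ[k] y ∈ LinearMap.range (TensorProduct.map (grade k m).subtype (grade k n).subtype) :=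
  ⟨(⟨x, hx⟩ : grade k m) ⊗ₜ[k] (⟨y, hy⟩ : grade k n), TensorProduct.map_tmul _ _ _ _⟩

lemma comul_of_mem (hP : P.IsPipeDream) : Coalgebra.comul (R := k) (of k P) ∈
    ⨆ (i : ℕ) (j : ℕ) (_ : i + j = P.size),
      LinearMap.range (TensorProduct.map (grade k i).subtype (grade k j).subtype) := by
  rw [comul_of hP]
  refine Submodule.sum_mem _ fun γ hγ => ?_
  have hle := (mem_descents.1 hγ).le
  have h1 : of k (P.vpack γ) ∈ grade k γ := of_mem_grade_of_size_eq (hP.vpack hle) (vpack_size ..)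
  have h2 : of k (P.hpack (P.size - γ)) ∈ grade k (P.size - γ) :=
    of_mem_grade_of_size_eq (hP.hpack (Nat.sub_le _ _)) (hpack_size ..)
  have h3 : γ + (P.size - γ) = P.size := by omega
  refine Submodule.mem_iSup_of_mem γ ?_
  refine Submodule.mem_iSup_of_mem (P.size - γ) ?_
  refine Submodule.mem_iSup_of_mem h3 ?_
  exact tmul_mem_range h1 h2

lemma comul_mem_of_mem_grade {n : ℕ} {x : PipeDreamAlgebra k} (hx : x ∈ grade k n) :
    Coalgebra.comul (R := k) x ∈ ⨆ (i : ℕ) (j : ℕ) (_ : i + j = n),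
      LinearMap.range (TensorProduct.map (grade k i).subtype (grade k j).subtype) := by
  suffices h : grade k n ≤ Submodule.comap Coalgebra.comul (⨆ (i : ℕ) (j : ℕ) (_ : i + j = n),
      LinearMap.range (TensorProduct.map (grade k i).subtype (grade k j).subtype)) from h hx
  exact grade_le_iff.2 fun P hP hn => hn ▸ comul_of_mem hP

lemma counit_eq_zero_of_mem_grade {n : ℕ} (hn : n ≠ 0) {x : PipeDreamAlgebra k}
    (hx : x ∈ grade k n) : Coalgebra.counit (R := k) x = 0 := by
  suffices h : grade k n ≤ LinearMap.ker Coalgebra.counit from h hx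
  refine grade_le_iff.2 fun P hP h => ?_
  rw [LinearMap.mem_ker, counit_of hP, if_neg (h.trans_ne hn)]

lemma leftInv_id_mem_grade (n : ℕ) (hF : F.IsPipeDream) (h : F.size = n) :
    leftInv LinearMap.id F ∈ grade k n := by
  induction n using Nat.strong_induction_on generalizing F with
  | _ n ih =>
  subst h
  rw [leftInv]
  split_ifs with h0
  · rw [one_def]
    exact of_mem_grade_of_size_eq isPipeDream_elbow h0.symm
  · refine neg_mem (Submodule.sum_mem _ fun γ _ => ?_)
    split_ifs with hγ
    · have := mul_mem_grade (ih γ γ.2 (hF.vpack hγ.le) rfl)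
        (of_mem_grade (k := k) (hF.hpack (Nat.sub_le F.size γ)))
      rwa [hpack_size, Nat.add_sub_cancel' hγ.le] at this
    · exact zero_mem _

lemma antipodeHom_mem_grade {n : ℕ} {x : PipeDreamAlgebra k} (hx : x ∈ grade k n) :
    antipodeHom k x ∈ grade k n := by
  suffices h : grade k n ≤ (grade k n).comap (antipodeHom k) from h hx
  refine grade_le_iff.2 fun P hP h => ?_
  rw [Submodule.mem_comap, antipodeHom, lift_of _ hP]
  exact leftInv_id_mem_grade n hP h

lemma grade_zero : grade k 0 = Submodule.span k {1} := by
  rw [grade_eq_span]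
  congr 1
  ext x
  constructor
  · rintro ⟨F, hF, h, rfl⟩
    exact of_eq_one hF h
  · rintro rfl
    exact ⟨_, isPipeDream_elbow, rfl, rfl⟩

lemma one_ne_zero' : (1 : PipeDreamAlgebra k) ≠ 0 := by
  rw [one_def, ← ofHP_single, (ofHP k).map_ne_zero_iff]
  exact Finsupp.single_ne_zero.2 one_ne_zero

lemma one_mem_grade : (1 : PipeDreamAlgebra k) ∈ grade k 0 := by
  rw [one_def]
  exact of_mem_grade_of_size_eq isPipeDream_elbow rfl

lemma gradedMonoid_grade : SetLike.GradedMonoid (grade k) where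
  one_mem := one_mem_grade
  mul_mem _ _ _ _ hx hy := mul_mem_grade hx hy

lemma finrank_grade_zero : Module.finrank k (grade k 0) = 1 := by
  rw [grade_zero]
  exact finrank_span_singleton one_ne_zero'

lemma isGradedConnectedHopf : IsGradedConnectedHopf k (PipeDreamAlgebra k) (grade k) where
  isInternal := isInternal_grade
  gradedMonoid := gradedMonoid_grade
  comul_mem _ _ hx := comul_mem_of_mem_grade hx
  counit_eq_zero _ hn _ hx := counit_eq_zero_of_mem_grade hn hx
  antipode_mem _ _ hx := antipodeHom_mem_grade hx
  connected := finrank_grade_zero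

end PipeDreamAlgebra

theorem mainTheorem1 (k : Type u) [Field k] :
    -- all the operations on pipe dreams produce pipe dreams
    (∀ (P : PipeDream) (r : ℕ), r ≤ P.1.size →
      (P.1.hpack r).IsPipeDream ∧ (P.1.vpack r).IsPipeDream) ∧
    (∀ (P Q : PipeDream) (γ : ℕ), P.1.IsGlobalDescent γ → (P.1.insertAt γ Q.1).IsPipeDream) ∧
    (∀ (P Q : PipeDream), ∀ s ∈ P.1.shuffles Q.1, (Filling.tangle s P.1 Q.1).IsPipeDream) ∧
    -- the product and the coproduct make `HP k` into a graded connected Hopf algebra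
    ∃ (A : Type u) (_ : Ring A) (_ : HopfAlgebra k A) (e : HP k ≃ₗ[k] A),
      (∀ x y : HP k, e (HP.product k x y) = e x * e y) ∧
      e (Finsupp.single PipeDream.elbow 1) = 1 ∧
      (∀ x : HP k, Coalgebra.comul (R := k) (e x) =
        TensorProduct.map e.toLinearMap e.toLinearMap (HP.coproduct k x)) ∧
      (∀ P : PipeDream, Coalgebra.counit (R := k) (e (Finsupp.single P 1)) =
        if P = PipeDream.elbow then 1 else 0) ∧
      IsGradedConnectedHopf k A fun n => (HP.degree k n).map e.toLinearMap := by
  refine ⟨fun P r hr => ⟨P.2.hpack hr, P.2.vpack hr⟩, fun P Q γ h => P.2.insertAt Q.2 h,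
    fun P Q s hs => isPipeDream_tangle P.2 Q.2 hs, PipeDreamAlgebra k, inferInstance, inferInstance,
    PipeDreamAlgebra.ofHP k, PipeDreamAlgebra.ofHP_product, PipeDreamAlgebra.ofHP_single _,
    PipeDreamAlgebra.comul_ofHP, fun P => ?_, PipeDreamAlgebra.isGradedConnectedHopf⟩
  rw [PipeDreamAlgebra.ofHP_single, PipeDreamAlgebra.counit_of P.2]
  refine if_congr ⟨fun h => Subtype.ext (P.2.triangular'.eq_elbow h), ?_⟩ rfl rfl
  rintro rfl
  rfl
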